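/- Let $N\ge 1$ be an integer and $\alpha\in\mathbb{R}$, $\alpha\neq 0$. For a real function $u$ on $\mathbb{Z}^2$ write $u_{i,j}=u(i,j)$, and let $\mathcal{S}$, $\mathcal{T}$ be the shifts $\mathcal{S}^i\mathcal{T}^j(u_{0,0})=u_{i,j}$. For integers $i,j\ge 0$ with $i+j>0$ let $Q_{(i,j)}$ be the sum, over all lattice paths from $(0,0)$ to $(i,j)$ with steps $(1,0)$ and $(0,1)$, of the product of the values of $u$ at the $i+j+1$ points of the path. Let $\Sigma_N$ be the system of difference equations $$Q_{(i,N-i+1)}+(-1)^{N-i}\alpha=0,\qquad i=1,\dots,N,$$ imposed, with all its shifts, on the whole lattice. A flow $\partial_t u_{0,0}=F([u])$, where $F$ is a real function of finitely many shifts of $u$, is a symmetry of $\Sigma_N$ if for every equation $P=0$ of $\Sigma_N$ $$\sum_{i,j}\frac{\partial P}{\partial u_{i,j}}\,\mathcal{S}^i\mathcal{T}^j(F)=0$$ holds on the real solutions of $\Sigma_N$ on which the shifts of $F$ that occur are defined. Here $F$ is smooth and defined on an open dense set of values of its arguments. A flow in the first (second) lattice direction is one in which $F$ is a function of variables $u_{k,0}$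 (respectively $u_{0,k}$), $k\in\mathbb{Z}$, only; its order is the least $r\ge 0$ such that $F$ depends only on those with $|k|\le r$. Then the flow $$\partial_t u_{0,0}=u_{0,0}\,(\mathcal{S}-1)\prod_{k=0}^{N}\mathcal{S}^{k-N-1}\left(\frac{1}{Q_{(N+1,0)}-\alpha}\right)$$ is a lowest order symmetry of $\Sigma_N$ in the first lattice direction, and the flow $$\partial_s u_{0,0}=u_{0,0}\,(\mathcal{T}-1)\prod_{k=0}^{N}\mathcal{T}^{k-N-1}\left(\frac{1}{Q_{(0,N+1)}+(-1)^N\alpha}\right)$$ is a lowest order symmetry of $\Sigma_N$ in the second lattice direction. That is, each of them is a symmetry of the whole system $\Sigma_N$, not identically zero, in the respective direction, of order exactly $N+1$, and every symmetry of $\Sigma_N$ in that direction that is not identically zero has order at least $N+1$. -/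

import Mathlib

open MvPolynomial
open scoped ContDiff

namespace LatticePathSystem

/-- Points `(n, m)` of the two-dimensional lattice. -/
abbrev Pt : Type := ℤ × ℤ

/-- A real function `u` on the lattice; `u (i, j)` is the value written `u_{i,j}`. -/
abbrev LatticeField : Type := Pt → ℝ

/-- The translate of `u` for which the value at `q` is `u (p + q)`. For `p = (i, j)`, evaluating an
expression on `translate p u` amounts to applying `S^i T^j` to the expression. -/
def translate (p : Pt) (u : LatticeField) : LatticeField := fun q => u (p + q)

/-! ### Lattice paths and the polynomials `Q_{(i,j)}` -/

/-- A monotone lattice path from the origin is encoded by the set `s` of the times at which it steps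
to the right (at the other times it steps up). This is its position after `k` steps. -/
def pathPoint (s : Finset ℕ) (k : ℕ) : Pt :=
  (((s ∩ Finset.range k).card : ℤ), ((Finset.range k \ s).card : ℤ))

/-- `Q_{(i,j)}`: the sum over all lattice paths from `(0,0)` to `(i,j)`, made of `i` steps to the
right and `j` steps up, of the product of the values of `u` at the `i + j + 1` points of the path. -/
noncomputable def Q (i j : ℕ) : MvPolynomial Pt ℝ :=
  ∑ s ∈ (Finset.range (i + j)).powersetCard i,
    ∏ k ∈ Finset.range (i + j + 1), X (pathPoint s k)

/-- The left-hand sides `Q_{(i,N-i+1)} + (-1)^{N-i} α`, `i = 1, …, N`, of the system `Σ_N`. -/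
def system (N : ℕ) (α : ℝ) : Set (MvPolynomial Pt ℝ) :=
  {P | ∃ i : ℕ, 1 ≤ i ∧ i ≤ N ∧ P = Q i (N + 1 - i) + C ((-1) ^ (N - i) * α)}

/-- `u` solves a system of autonomous difference equations: every equation holds at every lattice
point. -/
def IsSolution (E : Set (MvPolynomial Pt ℝ)) (u : LatticeField) : Prop :=
  ∀ P ∈ E, ∀ p : Pt, eval (translate p u) P = 0

/-! ### Evolutionary flows `∂_t u_{0,0} = F([u])` and symmetries -/

/-- A real function `F([u])` of finitely many shifts of `u`, namely of the `u_p` with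
`p ∈ stencil`, defined on the domain `dom`. -/
structure Flow where
  stencil : Finset Pt
  dom : Set (stencil → ℝ)
  toFun : (stencil → ℝ) → ℝ

namespace Flow

/-- The values of `u` on the stencil shifted by `p`. -/
def window (F : Flow) (p : Pt) (u : LatticeField) : F.stencil → ℝ := fun q => u (p + q)

/-- `S^i T^j (F)` is defined on `u`, for `p = (i, j)`. -/
def DefinedAt (F : Flow) (p : Pt) (u : LatticeField) : Prop := F.window p u ∈ F.dom

/-- The value of `S^i T^j (F)` on `u`, for `p = (i, j)`. -/
def shifted (F : Flow) (p : Pt) (u : LatticeField) : ℝ := F.toFun (F.window p u)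

/-- `F` is a smooth function on an open dense set of values of its arguments. -/
structure IsSmooth (F : Flow) : Prop where
  isOpen_dom : IsOpen F.dom
  dense_dom : Dense F.dom
  contDiffOn : ContDiffOn ℝ ∞ F.toFun F.dom

/-- `∂_t u_{0,0} = F([u])` is a symmetry of the system `E`: for each equation `P` of the system,
`∑ (∂P/∂u_{i,j}) S^i T^j (F) = 0` on the solutions of the system (where the `S^i T^j (F)` that
occur are defined). -/
structure IsSymmetry (F : Flow) (E : Set (MvPolynomial Pt ℝ)) : Prop where
  isSmooth : F.IsSmooth
  determining : ∀ u : LatticeField, IsSolution E u → ∀ P ∈ E, (∀ p ∈ P.vars, F.DefinedAt p u) →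
    ∑ p ∈ P.vars, eval u (pderiv p P) * F.shifted p u = 0

/-- `F` is not identically zero. -/
def IsNontrivial (F : Flow) : Prop := ∃ x ∈ F.dom, F.toFun x ≠ 0

/-- `F` depends only on the variables `u_p` with `p ∈ T`. -/
def DependsOnlyOn (F : Flow) (T : Set Pt) : Prop :=
  ∀ x ∈ F.dom, ∀ y ∈ F.dom, (∀ p : F.stencil, (p : Pt) ∈ T → x p = y p) → F.toFun x = F.toFun y

/-- `F` is a flow in the lattice direction `e`, where `e = (1, 0)` or `e = (0, 1)`: a function of
variables `u_{k e}`, `k ∈ ℤ`, only. -/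
def InDirection (F : Flow) (e : Pt) : Prop := ∀ p ∈ F.stencil, ∃ k : ℤ, p = k • e

/-- `F` depends on the `u_{k e}` with `|k| ≤ r` only. -/
def OrderLE (F : Flow) (e : Pt) (r : ℕ) : Prop :=
  F.DependsOnlyOn {p | ∃ k : ℤ, |k| ≤ (r : ℤ) ∧ p = k • e}

/-- `F` is a flow in the lattice direction `e`, and its order is `r`: the least `r` such that `F`
depends on `u_{-r e}, …, u_{r e}` only. -/
structure HasOrder (F : Flow) (e : Pt) (r : ℕ) : Prop where
  inDirection : F.InDirection e
  isLeast : IsLeast {s : ℕ | F.OrderLE e s} r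

/-- `F` is a nontrivial symmetry of `E` in the lattice direction `e`, of order `r`, and no nontrivial
symmetry of `E` in this direction has a lower order. -/
structure IsLowestOrderSymmetry (F : Flow) (E : Set (MvPolynomial Pt ℝ)) (e : Pt) (r : ℕ) :
    Prop where
  isSymmetry : F.IsSymmetry E
  isNontrivial : F.IsNontrivial
  hasOrder : F.HasOrder e r
  minimal : ∀ (G : Flow) (s : ℕ), G.IsSymmetry E → G.IsNontrivial → G.HasOrder e s → r ≤ s

end Flow

/-! ### The two flows -/

/-- The lattice function with the values `x` on the finite set `T`, and `0` elsewhere. -/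
noncomputable def extendZero (T : Finset Pt) (x : T → ℝ) : LatticeField :=
  fun q => if h : q ∈ T then x ⟨q, h⟩ else 0

/-- `∏_{k=0}^{N} E^{k-N-1} (1 / R)`, evaluated on `u`, where `E` is the shift by `e`. -/
noncomputable def shiftedProd (N : ℕ) (e : Pt) (R : MvPolynomial Pt ℝ) (u : LatticeField) : ℝ :=
  ∏ k ∈ Finset.range (N + 1), 1 / eval (translate (((k : ℤ) - N - 1) • e) u) R

/-- The flow `∂_t u_{0,0} = u_{0,0} (E - 1) ∏_{k=0}^{N} E^{k-N-1} (1 / R)`, where `E` is the shift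
by `e` and `R` is a polynomial in `u_0, u_e, …, u_{(N+1)e}`, defined where the denominators that
occur, `E^k (R)` with `-N-1 ≤ k ≤ 0`, do not vanish. -/
noncomputable def pathFlow (N : ℕ) (e : Pt) (R : MvPolynomial Pt ℝ) : Flow where
  stencil := (Finset.Icc (-(N : ℤ) - 1) (N + 1)).image (fun k : ℤ => k • e)
  dom := {x | ∀ k ∈ Finset.Icc (-(N : ℤ) - 1) 0, eval (translate (k • e) (extendZero _ x)) R ≠ 0}
  toFun := fun x =>
    extendZero _ x 0 *
      (shiftedProd N e R (translate e (extendZero _ x)) - shiftedProd N e R (extendZero _ x))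

/-- `∂_t u_{0,0} = u_{0,0} (S - 1) ∏_{k=0}^{N} S^{k-N-1} (1 / (Q_{(N+1,0)} - α))`. -/
noncomputable def flowUN (N : ℕ) (α : ℝ) : Flow :=
  pathFlow N (1, 0) (Q (N + 1) 0 - C α)

/-- `∂_s u_{0,0} = u_{0,0} (T - 1) ∏_{k=0}^{N} T^{k-N-1} (1 / (Q_{(0,N+1)} + (-1)^N α))`. -/
noncomputable def flowUM (N : ℕ) (α : ℝ) : Flow :=
  pathFlow N (0, 1) (Q 0 (N + 1) + C ((-1) ^ N * α))

end LatticePathSystem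

/-!
Write `π(x, y)` for the product of the `N + 1` values of `u` at `(x, y), …, (x + N, y)`, and `R` for
the denominator `Q_{(N+1,0)} - α`. The reflection in the diagonal exchanges the two directions and
replaces `α` by `(-1) ^ (N + 1) * α`, so only the first direction needs an argument.

*The flow is a symmetry.* Path sums satisfy one recursion for the first step and one for the last
step. Comparing the two for the paths with `N + 1` steps to the right and one step up shows that, on
solutions, `R` evolves from row to row by an explicit factor (`LatticeSol.rowDenom_up`). Hence the
functions `F_k = P α ^ k / (π_1 ⋯ π_k)`, with `P` the product of the shifts of `1 / R` and `π_m` the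
value of `π` at height `m` above the point, satisfy a discrete exactness relation
(`LatticeSol.flowTower_sub`), and the derivative of a path sum along the flow telescopes to a sum at
the starting point and a sum at the end point (`LatticeSol.pathDeriv_flow`). Both vanish for the
rectangles of the system (`LatticeSol.cornerSum_eq`). The order of the flow is `N + 1` because the
value at `(N + 1) e` occurs in one factor only (`pathFlow_test`).

*There are enough solutions.* A finite pair of adjacent rows that satisfies the equation for
`Q_{(N,1)}` extends to a solution on the lattice (`RowPairOn.exists_latticeSol`). The extension of
the two rows is elementary. When a block of rows is extended by a row, the equation that involves
the most rows becomes, for the new row written as `φ n / φ (n + 1)`, a linear recurrence for `φ`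
with nonvanishing extreme coefficients, which has nowhere vanishing solutions; the other equations
follow from it (`RowsSol.exists_next`). So the determining equation of a symmetry for `Q_{(N,1)}`
may be used on all pairs of rows `u`, `v`, and these are locally parametrized by the values of `u`
to the left and of `v` to the right of some index (`RowPairOn.exists_chart`).

*There is no symmetry of lower order.* Let `u_0 A` be a symmetry of order at most `N`.
- Suppose that `A` depends locally on no values beyond the index `r`, with `1 ≤ r ≤ N`. Vary the
  value of `v` at `N + r`. The derivative of the determining equation is an identity between a
  function of `u` and a function of `v`, both multiples of `B = ∂A/∂u_r`
  (`RowSymmetry.lowerTerm_eq_upperTerm`). The function of `u` is constant along the variations of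
  `u` that keep `v` fixed. For a single `v` these variations form a hyperplane in the solution space
  of a linear recurrence which does not involve `v`, so with two rows `v` the function is
  annihilated by the whole solution space (`GoodPair.tilt_deriv_eq_zero`). The same holds for the
  function of `v`. On a row that is the upper row of one pair and the lower row of another one, a
  common variation gives two different logarithmic derivatives of `B`, so `B = 0`
  (`RowSymmetry.rowPartial_eq_zero_of_locDep`). By descending induction on `r`, and by reflection,
  `A` depends locally on the value at `0` only (`RowSymmetry.locDep_zero`).
- Two further variations show that `A` is locally constant (`RowSymmetry.locDep_empty`). The terms
  of the determining equation, which scale differently under the variations of `v`, then vanish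
  one by one (`RowSymmetry.relSum_eq_zero`). It follows that the sum of `N + 2` consecutive shifts
  of `A` vanishes, so `A` takes equal values at a row and at its shift by a multiple of `N + 2`. A
  row may agree with two given rows near `0` and near such a multiple; therefore `A` is constant,
  and zero (`RowSymmetry.eq_zero`).

All of this takes place on the rows at which the flow is defined. Pairs of rows for which the
relevant shifts lie in this open dense set (`GoodPair`) are dense among all pairs of rows
(`RowPairOn.exists_goodPair`).
-/

namespace LatticePathSystem

/-! ### Path sums -/

/-- The sum, over all lattice paths with `n` steps `(1, 0)` or `(0, 1)` from `(a, b)` to `(c, d)`,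
of the product of the values of `u` at the `n + 1` points of the path. It is `0` when `(c, d)`
cannot be reached in exactly `n` steps. -/
def pathSum {A : Type*} [CommSemiring A] (u : ℤ → ℤ → A) : ℕ → ℤ → ℤ → ℤ → ℤ → A
  | 0, a, b, c, d => if a = c ∧ b = d then u a b else 0
  | n + 1, a, b, c, d => u a b * (pathSum u n (a + 1) b c d + pathSum u n a (b + 1) c d)

section PathSum

variable {A : Type*} [CommSemiring A] (u : ℤ → ℤ → A)

lemma pathSum_zero (a b c d : ℤ) :
    pathSum u 0 a b c d = if a = c ∧ b = d then u a b else 0 := rfl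

lemma pathSum_succ (n : ℕ) (a b c d : ℤ) :
    pathSum u (n + 1) a b c d =
      u a b * (pathSum u n (a + 1) b c d + pathSum u n a (b + 1) c d) := rfl

/-- Recursion with respect to the last step of a path. -/
lemma pathSum_succ_end (n : ℕ) (a b c d : ℤ) :
    pathSum u (n + 1) a b c d =
      (pathSum u n a b (c - 1) d + pathSum u n a b c (d - 1)) * u c d := by
  induction n generalizing a b with
  | zero =>
    simp only [pathSum_succ, pathSum_zero]
    have h1 : (a = c - 1 ∧ b = d) ↔ (a + 1 = c ∧ b = d) := by omega
    have h2 : (a = c ∧ b = d - 1) ↔ (a = c ∧ b + 1 = d) := by omega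
    rw [if_congr h1 rfl rfl, if_congr h2 rfl rfl, mul_add, add_mul]
    congr 1
    · split_ifs with h
      · obtain ⟨rfl, rfl⟩ := h; ring
      · simp
    · split_ifs with h
      · obtain ⟨rfl, rfl⟩ := h; ring
      · simp
  | succ n ih =>
    rw [pathSum_succ, ih, ih, pathSum_succ, pathSum_succ]
    ring

lemma pathSum_eq_zero (n : ℕ) (a b c d : ℤ) (h : ¬(a ≤ c ∧ b ≤ d ∧ c - a + (d - b) = n)) :
    pathSum u n a b c d = 0 := by
  induction n generalizing a b with
  | zero =>
    rw [pathSum_zero, if_neg]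
    rintro ⟨rfl, rfl⟩
    simp at h
  | succ n ih =>
    rw [pathSum_succ, ih, ih]
    · simp
    · push_cast at h; omega
    · push_cast at h; omega

lemma pathSum_swap (n : ℕ) (a b c d : ℤ) :
    pathSum (fun x y => u y x) n a b c d = pathSum u n b a d c := by
  induction n generalizing a b with
  | zero => simp only [pathSum_zero, and_comm]
  | succ n ih => rw [pathSum_succ, ih, ih, pathSum_succ, add_comm]

lemma pathSum_translate (s t : ℤ) (n : ℕ) (a b c d : ℤ) :
    pathSum (fun x y => u (s + x) (t + y)) n a b c d =
      pathSum u n (s + a) (t + b) (s + c) (t + d) := by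
  induction n generalizing a b with
  | zero => simp [pathSum_zero]
  | succ n ih => rw [pathSum_succ, ih, ih, pathSum_succ, add_assoc, add_assoc]

lemma pathSum_neg (n : ℕ) (a b c d : ℤ) :
    pathSum (fun x y => u (-x) (-y)) n a b c d = pathSum u n (-c) (-d) (-a) (-b) := by
  induction n generalizing a b with
  | zero =>
    simp only [pathSum_zero, neg_inj]
    by_cases h : a = c ∧ b = d
    · obtain ⟨rfl, rfl⟩ := h; simp
    · rw [if_neg h, if_neg (by omega)]
  | succ n ih =>
    rw [pathSum_succ, ih, ih, pathSum_succ_end, mul_comm]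
    congr 3 <;> ring

lemma pathSum_row (n : ℕ) (a b : ℤ) :
    pathSum u n a b (a + n) b = ∏ i ∈ Finset.range (n + 1), u (a + i) b := by
  induction n with
  | zero => simp [pathSum_zero]
  | succ n ih =>
    rw [pathSum_succ_end, Finset.prod_range_succ, ← ih,
      pathSum_eq_zero u n a b _ (b - 1) (by omega), add_zero]
    congr 2; push_cast; ring

lemma pathSum_congr {u w : ℤ → ℤ → A} (n : ℕ) (a b c d : ℤ)
    (h : ∀ x y, a ≤ x → x ≤ c → b ≤ y → y ≤ d → u x y = w x y) :
    pathSum u n a b c d = pathSum w n a b c d := by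
  induction n generalizing a b with
  | zero =>
    simp only [pathSum_zero]
    split_ifs with hh
    · obtain ⟨rfl, rfl⟩ := hh
      exact h _ _ le_rfl le_rfl le_rfl le_rfl
    · rfl
  | succ n ih =>
    by_cases hh : a ≤ c ∧ b ≤ d
    · rw [pathSum_succ, pathSum_succ, h a b le_rfl hh.1 le_rfl hh.2,
        ih (a + 1) b fun x y h1 h2 h3 h4 => h x y (by omega) h2 h3 h4,
        ih a (b + 1) fun x y h1 h2 h3 h4 => h x y h1 h2 (by omega) h4]
    · rw [pathSum_eq_zero _ _ _ _ _ _ (by tauto), pathSum_eq_zero _ _ _ _ _ _ (by tauto)]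

end PathSum

/-! ### Solutions of the system in terms of path sums -/

/-- `u` solves the system `Σ_N` with parameter `α`, written with path sums. The index `j` is the
height of the rectangle, so the equation is the one for `Q_{(N+1-j, j)}`. -/
def LatticeSol (N : ℕ) (α : ℝ) (u : ℤ → ℤ → ℝ) : Prop :=
  ∀ x y : ℤ, ∀ j : ℕ, 1 ≤ j → j ≤ N →
    pathSum u (N + 1) x y (x + (N + 1 - j)) (y + j) = (-1) ^ j * α

/-- The product of `N + 1` consecutive values of `u` in a row. -/
def rowProd (N : ℕ) (u : ℤ → ℤ → ℝ) (x y : ℤ) : ℝ := ∏ i ∈ Finset.range (N + 1), u (x + i) y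

/-- The denominator `Q_{(N+1,0)} - α` of the flow in the first direction. -/
def rowDenom (N : ℕ) (α : ℝ) (u : ℤ → ℤ → ℝ) (x y : ℤ) : ℝ :=
  ∏ i ∈ Finset.range (N + 2), u (x + i) y - α

/-- The product of `N + 1` consecutive shifts of the inverse of `rowDenom`; the flow
is `u (S - 1) flowProd`. -/
noncomputable def flowProd (N : ℕ) (α : ℝ) (u : ℤ → ℤ → ℝ) (x y : ℤ) : ℝ :=
  ∏ k ∈ Finset.range (N + 1), 1 / rowDenom N α u (x + (k - N - 1)) y

lemma LatticeSol.ne_zero {N : ℕ} {α : ℝ} {u : ℤ → ℤ → ℝ} (h : LatticeSol N α u) (hN : 1 ≤ N)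
    (hα : α ≠ 0) (x y : ℤ) : u x y ≠ 0 := by
  intro h0
  have := h x y 1 le_rfl hN
  rw [pathSum_succ, h0, zero_mul] at this
  simp at this
  exact hα this

lemma LatticeSol.neg {N : ℕ} {α : ℝ} {u : ℤ → ℤ → ℝ} (h : LatticeSol N α u) :
    LatticeSol N α (fun x y => u (-x) (-y)) := by
  intro x y j h1 h2
  rw [pathSum_neg, ← h (-(x + (N + 1 - j))) (-(y + j)) j h1 h2]
  congr 1 <;> ring

lemma LatticeSol.swap {N : ℕ} {α : ℝ} {u : ℤ → ℤ → ℝ} (h : LatticeSol N α u) :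
    LatticeSol N ((-1) ^ (N + 1) * α) (fun x y => u y x) := by
  intro x y j h1 h2
  have := h y x (N + 1 - j) (by omega) (by omega)
  rw [pathSum_swap]
  rw [Nat.cast_sub (by omega)] at this
  convert this using 1
  · congr 1; push_cast; ring
  · have h3 : N + 1 = (N + 1 - j) + j := by omega
    rw [← mul_assoc, ← pow_add]
    congr 1
    conv_lhs => rw [h3]
    rw [show j + (N + 1 - j + j) = (N + 1 - j) + 2 * j by ring, pow_add, pow_mul]
    simp

lemma rowDenom_eq (N : ℕ) (α : ℝ) (u : ℤ → ℤ → ℝ) (x y : ℤ) :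
    rowDenom N α u x y = rowProd N u x y * u (x + (N + 1)) y - α := by
  simp only [rowDenom, rowProd]
  rw [Finset.prod_range_succ]
  push_cast
  rfl

lemma rowDenom_eq' (N : ℕ) (α : ℝ) (u : ℤ → ℤ → ℝ) (x y : ℤ) :
    rowDenom N α u x y = u x y * rowProd N u (x + 1) y - α := by
  simp only [rowDenom, rowProd]
  rw [Finset.prod_range_succ', mul_comm]
  simp only [Nat.cast_add, Nat.cast_one, Nat.cast_zero, add_zero]
  congr 2
  refine Finset.prod_congr rfl fun i _ => ?_
  congr 1; ring

/-- On solutions, `rowDenom` evolves in the second direction by an explicit factor: compare the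
first-step and the last-step recursion for the paths to `(N + 1, 1)`. -/
lemma LatticeSol.rowDenom_up {N : ℕ} {α : ℝ} {u : ℤ → ℤ → ℝ} (h : LatticeSol N α u) (hN : 1 ≤ N)
    (x y : ℤ) :
    u x y * rowDenom N α u x (y + 1) = rowDenom N α u x y * u (x + (N + 1)) (y + 1) := by
  have e1 := pathSum_succ u (N + 1) x y (x + (N + 1)) (y + 1)
  rw [pathSum_succ_end] at e1
  have h1 := h (x + 1) y 1 le_rfl hN
  have h2 := h x y 1 le_rfl hN
  have r1 := pathSum_row u (N + 1) x y
  have r2 := pathSum_row u (N + 1) x (y + 1)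
  push_cast at h1 h2 r1 r2
  rw [show x + 1 + ((N : ℤ) + 1 - 1) = x + (N + 1) by ring] at h1
  rw [show x + ((N : ℤ) + 1 - 1) = x + (N + 1) - 1 by ring] at h2
  rw [h1, h2, r2, show y + 1 - 1 = y by ring, r1] at e1
  simp only [rowDenom]
  linarith

/-! ### The flow in the first direction is a symmetry -/

/-- The derivative of `pathSum u n a b c d` with respect to `u` in the direction `V`. -/
def pathDeriv {A : Type*} [CommSemiring A] (u V : ℤ → ℤ → A) : ℕ → ℤ → ℤ → ℤ → ℤ → A
  | 0, a, b, c, d => if a = c ∧ b = d then V a b else 0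
  | n + 1, a, b, c, d =>
    V a b * (pathSum u n (a + 1) b c d + pathSum u n a (b + 1) c d) +
      u a b * (pathDeriv u V n (a + 1) b c d + pathDeriv u V n a (b + 1) c d)

lemma pathDeriv_zero {A : Type*} [CommSemiring A] (u V : ℤ → ℤ → A) (a b c d : ℤ) :
    pathDeriv u V 0 a b c d = if a = c ∧ b = d then V a b else 0 := rfl

lemma pathDeriv_succ {A : Type*} [CommSemiring A] (u V : ℤ → ℤ → A) (n : ℕ) (a b c d : ℤ) :
    pathDeriv u V (n + 1) a b c d =
      V a b * (pathSum u n (a + 1) b c d + pathSum u n a (b + 1) c d) +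
        u a b * (pathDeriv u V n (a + 1) b c d + pathDeriv u V n a (b + 1) c d) := rfl

lemma pathDeriv_swap {A : Type*} [CommSemiring A] (u V : ℤ → ℤ → A) (n : ℕ) (a b c d : ℤ) :
    pathDeriv (fun x y => u y x) (fun x y => V y x) n a b c d = pathDeriv u V n b a d c := by
  induction n generalizing a b with
  | zero => simp only [pathDeriv_zero, and_comm]
  | succ n ih =>
    rw [pathDeriv_succ, ih, ih, pathDeriv_succ, pathSum_swap u, pathSum_swap u,
      add_comm (pathSum u n b (a + 1) d c), add_comm (pathDeriv u V n b (a + 1) d c)]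

lemma pathDeriv_eq_zero {A : Type*} [CommSemiring A] (u V : ℤ → ℤ → A) (n : ℕ) (a b c d : ℤ)
    (h : c < a) : pathDeriv u V n a b c d = 0 := by
  induction n generalizing a b with
  | zero => rw [pathDeriv_zero, if_neg (by omega)]
  | succ n ih =>
    rw [pathDeriv_succ, ih (a + 1) b (by omega), ih a (b + 1) h,
      pathSum_eq_zero _ _ _ _ _ _ (by omega), pathSum_eq_zero _ _ _ _ _ _ (by omega)]
    simp

/-- The factor `α ^ k / (π_1 ⋯ π_k)`, with `π_m` the product of `N + 1` consecutive values in the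
row at height `m` above `(x, y)`. -/
noncomputable def towerCoeff (N : ℕ) (α : ℝ) (u : ℤ → ℤ → ℝ) (k : ℕ) (x y : ℤ) : ℝ :=
  α ^ k / ∏ m ∈ Finset.range k, rowProd N u x (y + (m + 1))

/-- The functions `F_k = P α ^ k / (π_1 ⋯ π_k)`, where `P` is `flowProd`; their
differences `F_k(x + 1, y) - F_k(x, y + 1)` are expressed by `F_{k+1}`. -/
noncomputable def flowTower (N : ℕ) (α : ℝ) (u : ℤ → ℤ → ℝ) (k : ℕ) (x y : ℤ) : ℝ :=
  flowProd N α u x y * towerCoeff N α u k x y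

section Tower

variable {N : ℕ} {α : ℝ} {u : ℤ → ℤ → ℝ}

lemma rowProd_ne_zero (hu : ∀ x y, u x y ≠ 0) (x y : ℤ) : rowProd N u x y ≠ 0 :=
  Finset.prod_ne_zero_iff.2 fun _ _ => hu _ _

lemma rowProd_shift (x y : ℤ) :
    u x y * rowProd N u (x + 1) y = rowProd N u x y * u (x + (N + 1)) y := by
  have h1 := rowDenom_eq N 0 u x y
  have h2 := rowDenom_eq' N 0 u x y
  linarith

lemma flowProd_right (x y : ℤ) (h0 : rowDenom N α u x y ≠ 0)
    (h1 : rowDenom N α u (x - N - 1) y ≠ 0) :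
    flowProd N α u (x + 1) y * rowDenom N α u x y =
      flowProd N α u x y * rowDenom N α u (x - N - 1) y := by
  have e1 := Finset.prod_range_succ (fun k : ℕ => 1 / rowDenom N α u (x + (k - N - 1)) y) (N + 1)
  have e2 := Finset.prod_range_succ' (fun k : ℕ => 1 / rowDenom N α u (x + (k - N - 1)) y) (N + 1)
  have e3 : ∏ k ∈ Finset.range (N + 1), 1 / rowDenom N α u (x + (((k + 1 : ℕ) : ℤ) - N - 1)) y =
      flowProd N α u (x + 1) y := by
    refine Finset.prod_congr rfl fun k _ => ?_
    congr 2; push_cast; ring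
  rw [e3] at e2
  rw [e2] at e1
  rw [show x + (((0 : ℕ) : ℤ) - N - 1) = x - N - 1 by push_cast; ring,
    show x + (((N + 1 : ℕ) : ℤ) - N - 1) = x by push_cast; ring] at e1
  change _ = flowProd N α u x y * _ at e1
  field_simp at e1
  linarith

lemma LatticeSol.flowProd_up (h : LatticeSol N α u) (hN : 1 ≤ N) (hα : α ≠ 0) (x y : ℤ) :
    flowProd N α u x (y + 1) * rowProd N u x (y + 1) =
      flowProd N α u x y * rowProd N u (x - N - 1) y := by
  have e : rowProd N u (x - N - 1) y =
      ∏ k ∈ Finset.range (N + 1), u (x + (k - N - 1)) y := by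
    refine Finset.prod_congr rfl fun k _ => ?_
    congr 1; ring
  rw [e]
  simp only [flowProd, rowProd]
  rw [← Finset.prod_mul_distrib, ← Finset.prod_mul_distrib]
  refine Finset.prod_congr rfl fun k _ => ?_
  have h1 := h.rowDenom_up hN (x + (k - N - 1)) y
  have h2 := h.ne_zero hN hα (x + (k - N - 1)) y
  have h3 := h.ne_zero hN hα (x + k) (y + 1)
  rw [show x + ((k : ℤ) - N - 1) + (N + 1) = x + k by ring] at h1
  by_cases h0 : rowDenom N α u (x + (k - N - 1)) y = 0
  · have h0' : rowDenom N α u (x + (k - N - 1)) (y + 1) = 0 := by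
      rw [h0, zero_mul] at h1
      exact (mul_eq_zero.1 h1).resolve_left h2
    rw [h0, h0']; simp
  · have h0' : rowDenom N α u (x + (k - N - 1)) (y + 1) ≠ 0 := by
      intro hh
      rw [hh, mul_zero] at h1
      exact mul_ne_zero h0 h3 h1.symm
    field_simp
    linarith

lemma LatticeSol.rowDenom_up_iter (h : LatticeSol N α u) (hN : 1 ≤ N) (x y : ℤ) (k : ℕ) :
    rowDenom N α u x (y + k) * ∏ m ∈ Finset.range k, u x (y + m) =
      rowDenom N α u x y * ∏ m ∈ Finset.range k, u (x + (N + 1)) (y + (m + 1)) := by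
  induction k with
  | zero => simp
  | succ k ih =>
    rw [Finset.prod_range_succ, Finset.prod_range_succ]
    have := h.rowDenom_up hN x (y + k)
    rw [add_assoc] at this
    push_cast
    linear_combination (∏ m ∈ Finset.range k, u x (y + m)) * this +
      u (x + (N + 1)) (y + (k + 1)) * ih

/-- The relation that makes the summation by parts along vertical steps work. -/
lemma LatticeSol.flowTower_sub (h : LatticeSol N α u) (hN : 1 ≤ N) (hα : α ≠ 0) (k : ℕ) (x y : ℤ)
    (h0 : rowDenom N α u x y ≠ 0) (h1 : rowDenom N α u (x - N - 1) y ≠ 0) :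
    flowTower N α u k (x + 1) y - flowTower N α u k x (y + 1) =
      flowTower N α u (k + 1) (x + 1) y / u x (y + (k + 1)) -
        flowTower N α u (k + 1) x y / u x y := by
  have hu := h.ne_zero hN hα
  have r1 := flowProd_right x y h0 h1
  have r2 := h.flowProd_up hN hα x y
  have r3 := h.rowDenom_up_iter hN x y (k + 1)
  have r4 : (∏ m ∈ Finset.range (k + 1), rowProd N u (x + 1) (y + (m + 1))) *
        (∏ m ∈ Finset.range (k + 1), u x (y + (m + 1))) =
      (∏ m ∈ Finset.range (k + 1), rowProd N u x (y + (m + 1))) *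
        ∏ m ∈ Finset.range (k + 1), u (x + (N + 1)) (y + (m + 1)) := by
    rw [← Finset.prod_mul_distrib, ← Finset.prod_mul_distrib]
    refine Finset.prod_congr rfl fun m _ => ?_
    rw [mul_comm, rowProd_shift]
  have r5 : (∏ m ∈ Finset.range (k + 1), u x (y + m)) * u x (y + (k + 1)) =
      u x y * ∏ m ∈ Finset.range (k + 1), u x (y + (m + 1)) := by
    have e1 := Finset.prod_range_succ (fun m : ℕ => u x (y + m)) (k + 1)
    rw [Finset.prod_range_succ'] at e1
    push_cast at e1
    rw [add_zero] at e1
    linarith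
  have r6 := rowDenom_eq' N α u x (y + (k + 1))
  have r7 := rowDenom_eq N α u (x - N - 1) y
  rw [show x - (N : ℤ) - 1 + (N + 1) = x by ring] at r7
  have hG1 : (∏ m ∈ Finset.range k, rowProd N u (x + 1) (y + (m + 1))) ≠ 0 :=
    Finset.prod_ne_zero_iff.2 fun _ _ => rowProd_ne_zero hu _ _
  have hG : (∏ m ∈ Finset.range k, rowProd N u x (y + 1 + (m + 1))) ≠ 0 :=
    Finset.prod_ne_zero_iff.2 fun _ _ => rowProd_ne_zero hu _ _
  have hC : (∏ m ∈ Finset.range (k + 1), u x (y + m)) ≠ 0 :=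
    Finset.prod_ne_zero_iff.2 fun _ _ => hu _ _
  have s1 : (∏ m ∈ Finset.range (k + 1), rowProd N u (x + 1) (y + (m + 1))) =
      (∏ m ∈ Finset.range k, rowProd N u (x + 1) (y + (m + 1))) *
        rowProd N u (x + 1) (y + (k + 1)) := by
    rw [Finset.prod_range_succ]
  have s2 : (∏ m ∈ Finset.range (k + 1), rowProd N u x (y + (m + 1))) =
      (∏ m ∈ Finset.range k, rowProd N u x (y + 1 + (m + 1))) * rowProd N u x (y + 1) := by
    rw [Finset.prod_range_succ']
    rw [show y + (((0 : ℕ) : ℤ) + 1) = y + 1 by simp]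
    congr 1
    refine Finset.prod_congr rfl fun m _ => ?_
    congr 1; push_cast; ring
  have p1 := rowProd_ne_zero (N := N) hu (x + 1) (y + (k + 1))
  have p2 := rowProd_ne_zero (N := N) hu x (y + 1)
  have u0 := hu x y
  have u1 := hu x (y + (k + 1))
  simp only [flowTower, towerCoeff]
  rw [s1, s2]
  rw [s1, s2] at r4
  push_cast at r3
  generalize (∏ m ∈ Finset.range k, rowProd N u (x + 1) (y + (m + 1))) = G1 at *
  generalize (∏ m ∈ Finset.range k, rowProd N u x (y + 1 + (m + 1))) = G at *
  generalize (∏ m ∈ Finset.range (k + 1), u x (y + m)) = Cc at *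
  generalize (∏ m ∈ Finset.range (k + 1), u x (y + (m + 1))) = Aa at *
  generalize (∏ m ∈ Finset.range (k + 1), u (x + (N + 1)) (y + (m + 1))) = Bb at *
  generalize rowProd N u (x + 1) (y + (k + 1)) = q1 at *
  generalize rowProd N u x (y + 1) = q0 at *
  generalize rowProd N u (x - N - 1) y = qm at *
  generalize flowProd N α u (x + 1) y = P1 at *
  generalize flowProd N α u x (y + 1) = P01 at *
  generalize flowProd N α u x y = P0 at *
  generalize rowDenom N α u x (y + (k + 1)) = Rk at *
  generalize rowDenom N α u (x - N - 1) y = Rm at *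
  generalize rowDenom N α u x y = R0 at *
  generalize u x y = a0 at *
  generalize u x (y + (k + 1)) = a1 at *
  have key : P1 * Rk * a0 * (G * q0) = P0 * Rm * a1 * (G1 * q1) := by
    apply mul_right_cancel₀ hC
    linear_combination (P1 * a0 * G * q0) * r3 + (Bb * a0 * G * q0) * r1
      - P0 * Rm * a0 * r4 - P0 * Rm * (G1 * q1) * r5
  have hP : P01 = P0 * qm / q0 := by field_simp; linarith
  rw [hP]
  field_simp
  rw [pow_succ]
  rw [r6, r7] at key
  linear_combination α ^ k * key

/-- The derivative of a path sum along the flow reduces to boundary terms. -/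
lemma LatticeSol.pathDeriv_flow (h : LatticeSol N α u) (hN : 1 ≤ N) (hα : α ≠ 0) (n : ℕ)
    (a b c d : ℤ)
    (hR : ∀ x, a ≤ x → x ≤ c → ∀ y, rowDenom N α u x y ≠ 0 ∧ rowDenom N α u (x - N - 1) y ≠ 0) :
    pathDeriv u (fun x y => u x y * (flowProd N α u (x + 1) y - flowProd N α u x y)) n a b c d =
      ∑ k ∈ Finset.range (n + 1),
        (flowTower N α u k (c + 1) (d - k) * pathSum u (n - k) a b c (d - k) -
          flowTower N α u k a b * pathSum u (n - k) a (b + k) c d) := by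
  have hu := h.ne_zero hN hα
  by_cases hac : a ≤ c
  swap
  · rw [pathDeriv_eq_zero _ _ _ _ _ _ _ (by omega)]
    symm
    refine Finset.sum_eq_zero fun k _ => ?_
    rw [pathSum_eq_zero _ _ _ _ _ _ (by omega), pathSum_eq_zero _ _ _ _ _ _ (by omega)]
    simp
  induction n generalizing a b with
  | zero =>
    simp only [pathDeriv_zero, zero_add, Finset.range_one, Finset.sum_singleton, Nat.sub_zero,
      flowTower, towerCoeff, pathSum_zero]
    by_cases hh : a = c ∧ b = d
    · obtain ⟨rfl, rfl⟩ := hh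
      simp; ring
    · have h1 : ¬(a = c ∧ b = d - ((0 : ℕ) : ℤ)) := by simpa using hh
      have h2 : ¬(a = c ∧ b + ((0 : ℕ) : ℤ) = d) := by simpa using hh
      rw [if_neg hh, if_neg h1, if_neg h2]; simp
  | succ n ih =>
    have ih1 : pathDeriv u (fun x y => u x y * (flowProd N α u (x + 1) y - flowProd N α u x y)) n
        (a + 1) b c d = ∑ k ∈ Finset.range (n + 1),
        (flowTower N α u k (c + 1) (d - k) * pathSum u (n - k) (a + 1) b c (d - k) -
          flowTower N α u k (a + 1) b * pathSum u (n - k) (a + 1) (b + k) c d) := by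
      by_cases h1 : a + 1 ≤ c
      · exact ih _ _ (fun x hx hx' y => hR x (by omega) hx' y) h1
      · rw [pathDeriv_eq_zero _ _ _ _ _ _ _ (by omega)]
        symm
        refine Finset.sum_eq_zero fun k _ => ?_
        rw [pathSum_eq_zero _ _ _ _ _ _ (by omega), pathSum_eq_zero _ _ _ _ _ _ (by omega)]
        simp
    rw [pathDeriv_succ, ih1, ih a (b + 1) hR hac]
    -- `w k` is the path sum from the point at height `k` above the starting point
    set w : ℕ → ℝ := fun k => pathSum u (n + 1 - k) a (b + k) c d with hw
    have hw0 : u a b * (pathSum u n (a + 1) b c d + pathSum u n a (b + 1) c d) = w 0 := by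
      simp only [hw, Nat.sub_zero, Nat.cast_zero, add_zero]
      rw [pathSum_succ]
    have hwk : ∀ k ∈ Finset.range (n + 1), pathSum u (n - k) (a + 1) (b + k) c d =
        w k / u a (b + k) - w (k + 1) := by
      intro k hk
      have hk' : k ≤ n := by simpa [Nat.lt_succ_iff] using hk
      simp only [hw]
      rw [show n + 1 - k = (n - k) + 1 by omega, show n + 1 - (k + 1) = n - k by omega,
        pathSum_succ]
      have := hu a (b + k)
      push_cast
      rw [← add_assoc]
      field_simp
      ring
    have hwk' : ∀ k ∈ Finset.range (n + 1), pathSum u (n - k) a (b + 1 + k) c d = w (k + 1) := by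
      intro k hk
      simp only [hw]
      rw [show n + 1 - (k + 1) = n - k by omega]
      congr 1; push_cast; ring
    have hF : ∀ k, flowTower N α u k (a + 1) b - flowTower N α u k a (b + 1) =
        flowTower N α u (k + 1) (a + 1) b / u a (b + ((k + 1 : ℕ) : ℤ)) -
          flowTower N α u (k + 1) a b / u a b := by
      intro k
      have := h.flowTower_sub hN hα k a b (hR a le_rfl hac b).1 (hR a le_rfl hac b).2
      push_cast
      exact this
    have e1 : ∑ k ∈ Finset.range (n + 1),
        (flowTower N α u k (c + 1) (d - k) * pathSum u (n - k) (a + 1) b c (d - k) -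
          flowTower N α u k (a + 1) b * pathSum u (n - k) (a + 1) (b + k) c d) +
        ∑ k ∈ Finset.range (n + 1),
        (flowTower N α u k (c + 1) (d - k) * pathSum u (n - k) a (b + 1) c (d - k) -
          flowTower N α u k a (b + 1) * pathSum u (n - k) a (b + 1 + k) c d) =
        ∑ k ∈ Finset.range (n + 1),
          (flowTower N α u k (c + 1) (d - k) * (pathSum u (n + 1 - k) a b c (d - k) / u a b)) -
        ∑ k ∈ Finset.range (n + 1), (flowTower N α u k (a + 1) b * (w k / u a (b + k)) -
          flowTower N α u (k + 1) (a + 1) b * (w (k + 1) / u a (b + ((k + 1 : ℕ) : ℤ)))) -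
        ∑ k ∈ Finset.range (n + 1), flowTower N α u (k + 1) a b * w (k + 1) / u a b := by
      rw [← Finset.sum_add_distrib, ← Finset.sum_sub_distrib, ← Finset.sum_sub_distrib]
      refine Finset.sum_congr rfl fun k hk => ?_
      rw [hwk k hk, hwk' k hk]
      have hk' : k ≤ n := by simpa [Nat.lt_succ_iff] using hk
      rw [show n + 1 - k = (n - k) + 1 by omega, pathSum_succ, mul_div_cancel_left₀ _ (hu a b)]
      have := hF k
      linear_combination (w (k + 1)) * this
    rw [e1, Finset.sum_range_sub']
    rw [Finset.sum_sub_distrib, Finset.sum_range_succ (n := n + 1),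
      Finset.sum_range_succ' (fun k : ℕ => flowTower N α u k a b *
        pathSum u (n + 1 - k) a (b + k) c d)]
    have e2 : flowTower N α u (n + 1) (c + 1) (d - ((n + 1 : ℕ) : ℤ)) *
          pathSum u (n + 1 - (n + 1)) a b c (d - ((n + 1 : ℕ) : ℤ)) =
        u a b * (flowTower N α u (n + 1) (a + 1) b *
          (w (n + 1) / u a (b + ((n + 1 : ℕ) : ℤ)))) := by
      simp only [hw, Nat.sub_self, pathSum_zero]
      by_cases hh : a = c ∧ b + ((n + 1 : ℕ) : ℤ) = d
      · obtain ⟨rfl, rfl⟩ := hh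
        have := hu a (b + ((n + 1 : ℕ) : ℤ))
        rw [if_pos (by constructor <;> ring), if_pos ⟨rfl, rfl⟩, add_sub_cancel_right,
          div_self this]
        ring
      · rw [if_neg (by omega), if_neg hh]; simp
    have e3 : ∀ k, pathSum u (n + 1 - k) a (b + k) c d = w k := fun k => rfl
    have e4 : ∑ k ∈ Finset.range (n + 1),
          (flowTower N α u k (c + 1) (d - k) * (pathSum u (n + 1 - k) a b c (d - k) / u a b)) =
        (∑ k ∈ Finset.range (n + 1),
          flowTower N α u k (c + 1) (d - k) * pathSum u (n + 1 - k) a b c (d - k)) / u a b := by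
      rw [Finset.sum_div]
      exact Finset.sum_congr rfl fun k _ => by ring
    have e5 : ∑ k ∈ Finset.range (n + 1), flowTower N α u (k + 1) a b * w (k + 1) / u a b =
        (∑ k ∈ Finset.range (n + 1), flowTower N α u (k + 1) a b * w (k + 1)) / u a b := by
      rw [Finset.sum_div]
    have e6 : ∀ x y, flowTower N α u 0 x y = flowProd N α u x y := by
      intro x y; simp [flowTower, towerCoeff]
    rw [e2, e4, e5]
    simp only [e3, e6]
    rw [mul_right_comm, hw0, Nat.cast_zero, add_zero]
    have := hu a b
    field_simp
    ring

/-- The sum that `LatticeSol.pathDeriv_flow` leaves at the starting point, without the common factor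
`flowProd`. By `LatticeSol.cornerSum_eq` it vanishes for the rectangles of the system. -/
noncomputable def cornerSum (N : ℕ) (α : ℝ) (u : ℤ → ℤ → ℝ) (n : ℕ) (a b c d : ℤ) : ℝ :=
  ∑ k ∈ Finset.range (n + 1), towerCoeff N α u k a b * pathSum u (n - k) a (b + k) c d

lemma cornerSum_succ (n : ℕ) (a b c d : ℤ) :
    cornerSum N α u (n + 1) a b c d = pathSum u (n + 1) a b c d +
      α / rowProd N u a (b + 1) * cornerSum N α u n a (b + 1) c d := by
  simp only [cornerSum]
  rw [Finset.sum_range_succ', add_comm, Finset.mul_sum]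
  congr 1
  · simp [towerCoeff]
  · refine Finset.sum_congr rfl fun k _ => ?_
    rw [show n + 1 - (k + 1) = n - k by omega,
      show b + ((k + 1 : ℕ) : ℤ) = b + 1 + k by push_cast; ring]
    have : towerCoeff N α u (k + 1) a b =
        α / rowProd N u a (b + 1) * towerCoeff N α u k a (b + 1) := by
      simp only [towerCoeff]
      rw [Finset.prod_range_succ', pow_succ, div_mul_div_comm,
        show b + (((0 : ℕ) : ℤ) + 1) = b + 1 by simp]
      congr 1
      · ring
      · rw [mul_comm]
        congr 1
        · refine Finset.prod_congr rfl fun m _ => ?_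
          congr 1; push_cast; ring
    rw [this]; ring

lemma cornerSum_succ_end (n : ℕ) (a b c d : ℤ) (hac : a < c) :
    cornerSum N α u (n + 1) a b c d =
      (cornerSum N α u n a b (c - 1) d + cornerSum N α u n a b c (d - 1)) * u c d := by
  simp only [cornerSum]
  rw [Finset.sum_range_succ, Nat.sub_self, pathSum_zero, if_neg (by omega), mul_zero, add_zero,
    ← Finset.sum_add_distrib, Finset.sum_mul]
  refine Finset.sum_congr rfl fun k hk => ?_
  have hk' : k ≤ n := by simpa [Nat.lt_succ_iff] using hk
  rw [show n + 1 - k = (n - k) + 1 by omega, pathSum_succ_end]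
  ring

/-- On solutions, `cornerSum` at level `N` alternates along an antidiagonal, and therefore vanishes
at level `N + 1`. -/
lemma LatticeSol.cornerSum_eq (h : LatticeSol N α u) (hN : 1 ≤ N) (hα : α ≠ 0) (j : ℕ)
    (hj : j ≤ N) (a b : ℤ) :
    cornerSum N α u N a b (a + (N - j)) (b + j) = (-1) ^ j * rowProd N u a b ∧
      (1 ≤ j → cornerSum N α u (N + 1) a b (a + (N + 1 - j)) (b + j) = 0) := by
  have hu := h.ne_zero hN hα
  induction j generalizing a b with
  | zero =>
    simp only [Nat.cast_zero, sub_zero, add_zero, pow_zero, one_mul]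
    refine ⟨?_, by omega⟩
    simp only [cornerSum]
    rw [Finset.sum_range_succ', Finset.sum_eq_zero, zero_add]
    · simp only [towerCoeff, Nat.sub_zero, Nat.cast_zero, add_zero]
      rw [pathSum_row]; simp [rowProd]
    · intro k _
      rw [pathSum_eq_zero _ _ _ _ _ _ (by push_cast; omega), mul_zero]
  | succ j ih =>
    have hp := rowProd_ne_zero (N := N) hu a (b + 1)
    have h2 : cornerSum N α u (N + 1) a b (a + (N + 1 - (j + 1 : ℕ))) (b + (j + 1 : ℕ)) = 0 := by
      rw [cornerSum_succ, h a b (j + 1) (by omega) hj]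
      have := (ih (by omega) a (b + 1)).1
      rw [show a + ((N : ℤ) + 1 - (j + 1 : ℕ)) = a + (N - j) by push_cast; ring,
        show b + ((j + 1 : ℕ) : ℤ) = b + 1 + j by push_cast; ring, this, pow_succ]
      field_simp
      ring
    refine ⟨?_, fun _ => h2⟩
    rw [cornerSum_succ_end _ _ _ _ _ (by push_cast; omega)] at h2
    have h3 := (mul_eq_zero.1 h2).resolve_right (hu _ _)
    have h4 := (ih (by omega) a b).1
    rw [show a + ((N : ℤ) + 1 - (j + 1 : ℕ)) - 1 = a + (N - (j + 1 : ℕ)) by push_cast; ring,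
      show a + ((N : ℤ) + 1 - (j + 1 : ℕ)) = a + (N - j) by push_cast; ring,
      show b + ((j + 1 : ℕ) : ℤ) - 1 = b + j by push_cast; ring, h4] at h3
    rw [pow_succ]
    linarith

/-- `flowProd` moves down by `k` steps at the price of products over rows on either side. -/
lemma LatticeSol.flowTower_down (h : LatticeSol N α u) (hN : 1 ≤ N) (hα : α ≠ 0) (k : ℕ)
    (x y : ℤ) :
    flowTower N α u k x (y - k) = flowProd N α u x y *
      (α ^ k / ∏ m ∈ Finset.range k, rowProd N u (x - N - 1) (y - (m + 1))) := by
  have hu := h.ne_zero hN hα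
  induction k with
  | zero => simp [flowTower, towerCoeff]
  | succ k ih =>
    have e1 : flowTower N α u (k + 1) x (y - ((k + 1 : ℕ) : ℤ)) =
        flowProd N α u x (y - (k + 1)) / rowProd N u x (y - k) * (α *
          towerCoeff N α u k x (y - k)) := by
      simp only [flowTower, towerCoeff]
      rw [Finset.prod_range_succ', pow_succ]
      have : ∏ m ∈ Finset.range k, rowProd N u x (y - ((k + 1 : ℕ) : ℤ) + (((m + 1 : ℕ) : ℤ) + 1)) =
          ∏ m ∈ Finset.range k, rowProd N u x (y - k + (m + 1)) := by
        refine Finset.prod_congr rfl fun m _ => ?_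
        congr 1; push_cast; ring
      rw [this]
      have h1 : (∏ m ∈ Finset.range k, rowProd N u x (y - k + (m + 1))) ≠ 0 :=
        Finset.prod_ne_zero_iff.2 fun _ _ => rowProd_ne_zero hu _ _
      have h2 := rowProd_ne_zero (N := N) hu x (y - k)
      rw [show y - ((k + 1 : ℕ) : ℤ) + (((0 : ℕ) : ℤ) + 1) = y - k by push_cast; ring]
      push_cast
      field_simp
    have e2 := h.flowProd_up hN hα x (y - (k + 1))
    rw [show y - ((k : ℤ) + 1) + 1 = y - k by ring] at e2
    have h1 := rowProd_ne_zero (N := N) hu x (y - k)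
    have h2 := rowProd_ne_zero (N := N) hu (x - N - 1) (y - (k + 1))
    have h3 : (∏ m ∈ Finset.range k, rowProd N u (x - N - 1) (y - (m + 1))) ≠ 0 :=
      Finset.prod_ne_zero_iff.2 fun _ _ => rowProd_ne_zero hu _ _
    have e3 : flowProd N α u x (y - (k + 1)) / rowProd N u x (y - k) =
        flowProd N α u x (y - k) / rowProd N u (x - N - 1) (y - (k + 1)) := by
      field_simp; linarith
    rw [e1, e3, Finset.prod_range_succ]
    simp only [flowTower] at ih
    calc _ = (flowProd N α u x (y - k) * towerCoeff N α u k x (y - k)) *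
          (α / rowProd N u (x - N - 1) (y - (k + 1))) := by ring
      _ = _ := by rw [ih, pow_succ]; field_simp

/-- The derivatives of the equations of the system along the flow vanish on solutions. -/
theorem LatticeSol.pathDeriv_flow_eq_zero (h : LatticeSol N α u) (hN : 1 ≤ N) (hα : α ≠ 0)
    (a b : ℤ) (j : ℕ) (hj1 : 1 ≤ j) (hjN : j ≤ N)
    (hR : ∀ x, a ≤ x → x ≤ a + (N + 1 - j) → ∀ y,
      rowDenom N α u x y ≠ 0 ∧ rowDenom N α u (x - N - 1) y ≠ 0) :
    pathDeriv u (fun x y => u x y * (flowProd N α u (x + 1) y - flowProd N α u x y)) (N + 1) a b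
      (a + (N + 1 - j)) (b + j) = 0 := by
  rw [h.pathDeriv_flow hN hα _ _ _ _ _ hR, Finset.sum_sub_distrib]
  have e1 : ∑ k ∈ Finset.range (N + 1 + 1), flowTower N α u k a b *
      pathSum u (N + 1 - k) a (b + k) (a + (N + 1 - j)) (b + j) = 0 := by
    have := (h.cornerSum_eq hN hα j hjN a b).2 hj1
    simp only [cornerSum] at this
    simp only [flowTower, mul_assoc]
    rw [← Finset.mul_sum, this, mul_zero]
  -- the sum at the end point is a `cornerSum` for the solution reflected in the origin
  have e2 : ∑ k ∈ Finset.range (N + 1 + 1), flowTower N α u k (a + (N + 1 - j) + 1) (b + j - k) *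
      pathSum u (N + 1 - k) a b (a + (N + 1 - j)) (b + j - k) = 0 := by
    have := (h.neg.cornerSum_eq hN hα j hjN (-(a + (N + 1 - j))) (-(b + j))).2 hj1
    simp only [cornerSum] at this
    simp only [h.flowTower_down hN hα, mul_assoc]
    rw [← Finset.mul_sum]
    convert mul_zero _
    rw [← this]
    refine Finset.sum_congr rfl fun k _ => ?_
    rw [pathSum_neg]
    congr 1
    · simp only [towerCoeff]
      congr 1
      refine Finset.prod_congr rfl fun m _ => ?_
      simp only [rowProd]
      rw [← Finset.prod_range_reflect]
      refine Finset.prod_congr rfl fun i hi => ?_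
      have hi' : i ≤ N := by simpa [Nat.lt_succ_iff] using hi
      congr 1
      · rw [show N + 1 - 1 - i = N - i by omega, Nat.cast_sub hi']; ring
      · ring
    · congr 1 <;> ring
  rw [e1, e2, sub_zero]

end Tower

/-! ### The polynomials `Q_{(i,j)}` as path sums -/

lemma map_pathSum {A B : Type*} [CommSemiring A] [CommSemiring B] (f : A →+* B) (u : ℤ → ℤ → A)
    (n : ℕ) (a b c d : ℤ) :
    f (pathSum u n a b c d) = pathSum (fun x y => f (u x y)) n a b c d := by
  induction n generalizing a b with
  | zero => simp only [pathSum_zero]; split_ifs <;> simp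
  | succ n ih => rw [pathSum_succ, map_mul, map_add, ih, ih, pathSum_succ]

lemma map_pathDeriv {A B : Type*} [CommSemiring A] [CommSemiring B] (f : A →+* B)
    (u V : ℤ → ℤ → A) (n : ℕ) (a b c d : ℤ) :
    f (pathDeriv u V n a b c d) =
      pathDeriv (fun x y => f (u x y)) (fun x y => f (V x y)) n a b c d := by
  induction n generalizing a b with
  | zero => simp only [pathDeriv_zero]; split_ifs <;> simp
  | succ n ih =>
    rw [pathDeriv_succ, map_add, map_mul, map_add, map_mul, map_add, ih, ih, map_pathSum,
      map_pathSum, pathDeriv_succ]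

lemma pathPoint_zero (s : Finset ℕ) : pathPoint s 0 = (0, 0) := by simp [pathPoint]

lemma pathPoint_insert {s : Finset ℕ} {n k : ℕ} (hk : k ≤ n) :
    pathPoint (insert n s) k = pathPoint s k := by
  simp only [pathPoint]
  rw [Finset.insert_inter_of_notMem (by simp; omega), Finset.sdiff_insert_of_notMem
      (by simp; omega)]

lemma pathPoint_succ_of_notMem {s : Finset ℕ} {n : ℕ} (h : n ∉ s) :
    pathPoint s (n + 1) = pathPoint s n + (0, 1) := by
  simp only [pathPoint, Finset.range_add_one]
  rw [Finset.inter_insert_of_notMem h, Finset.insert_sdiff_of_notMem _ h,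
    Finset.card_insert_of_notMem (by simp)]
  simp

lemma pathPoint_succ_of_mem {s : Finset ℕ} {n : ℕ} (h : n ∈ s) :
    pathPoint s (n + 1) = pathPoint s n + (1, 0) := by
  simp only [pathPoint, Finset.range_add_one]
  rw [Finset.inter_insert_of_mem h, Finset.insert_sdiff_of_mem _ h,
    Finset.card_insert_of_notMem (by simp)]
  simp

lemma sum_powerset_pathPoint {A : Type*} [CommSemiring A] (w : Pt → A) (n : ℕ) (c d : ℤ) :
    ∑ s ∈ (Finset.range n).powerset,
      (if pathPoint s n = (c, d) then ∏ k ∈ Finset.range (n + 1), w (pathPoint s k) else 0) =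
    pathSum (fun x y => w (x, y)) n 0 0 c d := by
  induction n generalizing c d with
  | zero =>
    simp only [Finset.range_zero, Finset.powerset_empty, Finset.sum_singleton, pathPoint_zero,
      pathSum_zero, Prod.mk.injEq]
    simp [pathPoint_zero]
  | succ n ih =>
    rw [Finset.range_add_one, Finset.sum_powerset_insert (by simp), pathSum_succ_end, add_mul,
      ← ih, ← ih, add_comm, Finset.sum_mul, Finset.sum_mul]
    have hn : ∀ s ∈ (Finset.range n).powerset, n ∉ s := fun s hs hn => by
      simpa using Finset.mem_powerset.1 hs hn
    congr 1
    · refine Finset.sum_congr rfl fun s hs => ?_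
      have e : pathPoint (insert n s) (n + 1) = pathPoint s n + (1, 0) := by
        rw [pathPoint_succ_of_mem (Finset.mem_insert_self n s), pathPoint_insert le_rfl]
      have e2 : (pathPoint s n + (1, 0) = (c, d)) ↔ pathPoint s n = (c - 1, d) := by
        rw [← eq_sub_iff_add_eq]; simp
      rw [e, if_congr e2 rfl rfl]
      split_ifs with h
      · rw [Finset.prod_range_succ, e, e2.2 h]
        congr 1
        refine Finset.prod_congr rfl fun k hk => ?_
        rw [pathPoint_insert (by simpa [Nat.lt_succ_iff] using hk)]
      · simp
    · refine Finset.sum_congr rfl fun s hs => ?_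
      have e := pathPoint_succ_of_notMem (hn s hs)
      have e2 : (pathPoint s n + (0, 1) = (c, d)) ↔ pathPoint s n = (c, d - 1) := by
        rw [← eq_sub_iff_add_eq]; simp
      rw [e, if_congr e2 rfl rfl]
      split_ifs with h
      · rw [Finset.prod_range_succ, e, e2.2 h]
      · simp

lemma pathPoint_eq_iff {s : Finset ℕ} {i j : ℕ} (hs : s ⊆ Finset.range (i + j)) :
    pathPoint s (i + j) = ((i : ℤ), (j : ℤ)) ↔ s.card = i := by
  simp only [pathPoint, Prod.mk.injEq, Nat.cast_inj]
  rw [Finset.inter_eq_left.2 hs, Finset.card_sdiff_of_subset hs, Finset.card_range]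
  have := Finset.card_le_card hs
  rw [Finset.card_range] at this
  omega

lemma Q_eq_pathSum (i j : ℕ) :
    Q i j = pathSum (fun x y => (X (x, y) : MvPolynomial Pt ℝ)) (i + j) 0 0 i j := by
  rw [← sum_powerset_pathPoint, ← Finset.sum_filter, Q]
  refine Finset.sum_congr ?_ fun _ _ => rfl
  ext s
  simp only [Finset.mem_powersetCard, Finset.mem_filter, Finset.mem_powerset]
  exact and_congr_right fun hs => (pathPoint_eq_iff hs).symm

lemma eval_Q (U : LatticeField) (i j : ℕ) :
    eval U (Q i j) = pathSum (fun x y => U (x, y)) (i + j) 0 0 i j := by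
  rw [Q_eq_pathSum, map_pathSum]
  simp

lemma eval_translate_Q (U : LatticeField) (q : Pt) (i j : ℕ) :
    eval (translate q U) (Q i j) =
      pathSum (fun x y => U (x, y)) (i + j) q.1 q.2 (q.1 + i) (q.2 + j) := by
  rw [eval_Q]
  have := pathSum_translate (fun x y => U (x, y)) q.1 q.2 (i + j) 0 0 i j
  rw [add_zero, add_zero] at this
  rw [← this]
  rfl

lemma isSolution_system_iff {N : ℕ} {α : ℝ} {U : LatticeField} :
    IsSolution (system N α) U ↔ LatticeSol N α fun x y => U (x, y) := by
  have key : ∀ (j : ℕ), 1 ≤ j → j ≤ N → ∀ x y : ℤ,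
      eval (translate (x, y) U) (Q (N + 1 - j) (N + 1 - (N + 1 - j)) +
        C ((-1) ^ (N - (N + 1 - j)) * α)) =
      pathSum (fun x y => U (x, y)) (N + 1) x y (x + (N + 1 - j)) (y + j) - (-1) ^ j * α := by
    intro j h1 h2 x y
    rw [map_add, eval_translate_Q, eval_C, show N + 1 - (N + 1 - j) = j by omega,
      show N + 1 - j + j = N + 1 by omega, show N - (N + 1 - j) = j - 1 by omega,
      Nat.cast_sub (by omega)]
    obtain ⟨m, rfl⟩ : ∃ m, j = m + 1 := ⟨j - 1, by omega⟩
    rw [Nat.add_sub_cancel, pow_succ]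
    push_cast
    ring
  constructor
  · intro h x y j h1 h2
    have := h _ ⟨N + 1 - j, by omega, by omega, rfl⟩ (x, y)
    rw [key j h1 h2] at this
    linarith
  · rintro h P ⟨i, h1, h2, rfl⟩ ⟨x, y⟩
    have := key (N + 1 - i) (by omega) (by omega) x y
    rw [show N + 1 - (N + 1 - i) = i by omega] at this
    rw [this, h x y (N + 1 - i) (by omega) (by omega), sub_self]

/-- The left-hand side of the determining equations as a derivation. -/
lemma sum_vars_pderiv (U V : LatticeField) (P : MvPolynomial Pt ℝ) :
    ∑ p ∈ P.vars, eval U (pderiv p P) * V p =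
      eval U (mkDerivation ℝ (fun p => (C (V p) : MvPolynomial Pt ℝ)) P) := by
  have hs : ∀ (s : Finset Pt) (q : MvPolynomial Pt ℝ),
      (∑ p ∈ s, (C (V p) : MvPolynomial Pt ℝ) • pderiv (R := ℝ) p) q =
        ∑ p ∈ s, C (V p) * pderiv p q := fun s q => by
    rw [← Derivation.coeFnAddMonoidHom_apply, map_sum, Finset.sum_apply]
    rfl
  have h : mkDerivation ℝ (fun p => (C (V p) : MvPolynomial Pt ℝ)) P =
      (∑ p ∈ P.vars, (C (V p) : MvPolynomial Pt ℝ) • pderiv (R := ℝ) p) P := by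
    refine derivation_eq_of_forall_mem_vars fun q hq => ?_
    rw [mkDerivation_X, hs, Finset.sum_eq_single q]
    · simp
    · intro p _ hpq
      simp [pderiv_X_of_ne hpq.symm]
    · exact fun h => absurd hq h
  rw [h, hs, map_sum]
  refine Finset.sum_congr rfl fun p _ => ?_
  simp [mul_comm]

lemma derivation_pathSum (V : LatticeField) (n : ℕ) (a b c d : ℤ) :
    mkDerivation ℝ (fun p => (C (V p) : MvPolynomial Pt ℝ))
      (pathSum (fun x y => (X (x, y) : MvPolynomial Pt ℝ)) n a b c d) =
    pathDeriv (fun x y => (X (x, y) : MvPolynomial Pt ℝ)) (fun x y => C (V (x, y))) n a b c d := by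
  induction n generalizing a b with
  | zero =>
    simp only [pathSum_zero, pathDeriv_zero]
    split_ifs
    · rw [mkDerivation_X]
    · rw [map_zero]
  | succ n ih =>
    rw [pathSum_succ, Derivation.leibniz, mkDerivation_X, map_add, ih, ih, pathDeriv_succ,
      smul_eq_mul, smul_eq_mul]
    ring

lemma sum_vars_pderiv_Q (U V : LatticeField) (i j : ℕ) (r : ℝ) :
    ∑ p ∈ (Q i j + C r).vars, eval U (pderiv p (Q i j + C r)) * V p =
      pathDeriv (fun x y => U (x, y)) (fun x y => V (x, y)) (i + j) 0 0 i j := by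
  rw [sum_vars_pderiv, map_add, Q_eq_pathSum, derivation_pathSum,
    show (C r : MvPolynomial Pt ℝ) = algebraMap ℝ _ r from rfl, Derivation.map_algebraMap, add_zero,
    map_pathDeriv]
  simp

/-- Every point of a path is a variable of the polynomial. -/
lemma pathPoint_mem_vars {i j k : ℕ} {s : Finset ℕ} (hs : s ∈ (Finset.range (i + j)).powersetCard i)
    (hk : k ≤ i + j) (r : ℝ) : pathPoint s k ∈ (Q i j + C r).vars := by
  by_contra hp
  -- compare the values at the constant function `1` and at its modification at the point
  set U : LatticeField := Function.update (fun _ => 1) (pathPoint s k) 0 with hU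
  have h1 : eval U (Q i j + C r) = eval (fun _ => (1 : ℝ)) (Q i j + C r) := by
    refine eval₂Hom_congr' rfl (fun p hp' _ => ?_) rfl
    rw [hU, Function.update_of_ne]
    rintro rfl
    exact hp hp'
  have h2 : eval U (Q i j) < eval (fun _ => (1 : ℝ)) (Q i j) := by
    simp only [Q, map_sum, map_prod, eval_X]
    have hU1 : ∀ p, 0 ≤ U p ∧ U p ≤ 1 := fun p => by
      by_cases h : p = pathPoint s k
      · subst h; simp [hU]
      · simp [hU, h]
    refine Finset.sum_lt_sum (fun t _ => ?_) ⟨s, hs, ?_⟩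
    · exact Finset.prod_le_prod (fun _ _ => (hU1 _).1) fun _ _ => (hU1 _).2
    · rw [Finset.prod_eq_zero (i := k) (by simp; omega) (by simp [hU])]
      simp
  rw [map_add, map_add] at h1
  simp only [eval_C] at h1
  linarith

lemma mem_vars_bounds {i j : ℕ} {r : ℝ} {p : Pt} (hp : p ∈ (Q i j + C r).vars) :
    (0 ≤ p.1 ∧ p.1 ≤ i) ∧ 0 ≤ p.2 ∧ p.2 ≤ j := by
  have h1 := vars_add_subset _ _ hp
  rw [vars_C, Finset.union_empty, Q] at h1
  obtain ⟨s, hs, h2⟩ := Finset.mem_biUnion.1 (vars_sum_subset _ _ h1)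
  obtain ⟨k, hk, h3⟩ := Finset.mem_biUnion.1 (vars_prod _ h2)
  rw [vars_X, Finset.mem_singleton] at h3
  subst h3
  rw [Finset.mem_powersetCard] at hs
  have hk' : k ≤ i + j := by simp at hk; omega
  simp only [pathPoint]
  refine ⟨⟨by positivity, ?_⟩, by positivity, ?_⟩
  · have := Finset.card_le_card (Finset.inter_subset_left (s₁ := s) (s₂ := Finset.range k))
    omega
  · have e := Finset.card_sdiff_of_subset hs.1
    rw [Finset.card_range] at e
    have := Finset.card_le_card (Finset.sdiff_subset_sdiff (Finset.range_mono hk') (le_refl s))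
    omega

lemma origin_mem_vars (i j : ℕ) (r : ℝ) : ((0, 0) : Pt) ∈ (Q i j + C r).vars := by
  have h : Finset.range i ∈ (Finset.range (i + j)).powersetCard i := by
    rw [Finset.mem_powersetCard]; simp
  simpa [pathPoint_zero] using pathPoint_mem_vars h (Nat.zero_le _) r

lemma right_mem_vars (i j : ℕ) (r : ℝ) : ((i, 0) : Pt) ∈ (Q i j + C r).vars := by
  have h : Finset.range i ∈ (Finset.range (i + j)).powersetCard i := by
    rw [Finset.mem_powersetCard]; simp
  simpa [pathPoint] using pathPoint_mem_vars h (Nat.le_add_right i j) r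

lemma top_mem_vars (i j : ℕ) (r : ℝ) : ((0, j) : Pt) ∈ (Q i j + C r).vars := by
  have h : Finset.Ico j (i + j) ∈ (Finset.range (i + j)).powersetCard i := by
    rw [Finset.mem_powersetCard]
    constructor
    · intro x hx; simp at hx ⊢; omega
    · simp
  have e : pathPoint (Finset.Ico j (i + j)) j = (0, (j : ℤ)) := by
    have h1 : Finset.Ico j (i + j) ∩ Finset.range j = ∅ := by
      ext x; simp
      omega
    have h2 : Finset.range j \ Finset.Ico j (i + j) = Finset.range j := by
      ext x; simp
      omega
    simp [pathPoint, h1, h2]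
  rw [← e]
  exact pathPoint_mem_vars h (Nat.le_add_left j i) r

/-! ### The two flows: symmetry, domain and order -/

/-- The value of `E^q (R)` on `U` for a denominator `R` that is a product of `N + 2` consecutive
values in the direction `e` minus a constant. -/
def lineDenom (N : ℕ) (β : ℝ) (e : Pt) (U : LatticeField) (q : Pt) : ℝ :=
  ∏ m ∈ Finset.range (N + 2), U (q + (m : ℤ) • e) - β

section PathFlow

variable {N : ℕ} {β : ℝ} {e : Pt} {R : MvPolynomial Pt ℝ}

lemma extendZero_window {l : ℤ} (h1 : -(N : ℤ) - 1 ≤ l) (h2 : l ≤ N + 1) (q : Pt)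
    (U : LatticeField) :
    extendZero (pathFlow N e R).stencil ((pathFlow N e R).window q U) (l • e) = U (q + l • e) := by
  have : l • e ∈ (pathFlow N e R).stencil :=
    Finset.mem_image_of_mem _ (Finset.mem_Icc.2 ⟨h1, h2⟩)
  rw [extendZero, dif_pos this]
  rfl

lemma window_zero_extendZero (F : Flow) (x : F.stencil → ℝ) :
    F.window 0 (extendZero F.stencil x) = x := by
  funext p
  simp [Flow.window, extendZero]

variable (hR : ∀ U : LatticeField, eval U R = ∏ m ∈ Finset.range (N + 2), U ((m : ℤ) • e) - β)

include hR

lemma eval_translate_denom {k : ℤ} (h1 : -(N : ℤ) - 1 ≤ k) (h2 : k ≤ 0) (q : Pt)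
    (U : LatticeField) :
    eval (translate (k • e)
      (extendZero (pathFlow N e R).stencil ((pathFlow N e R).window q U))) R =
      lineDenom N β e U (q + k • e) := by
  rw [hR, lineDenom]
  congr 1
  refine Finset.prod_congr rfl fun m hm => ?_
  rw [Finset.mem_range] at hm
  rw [translate, ← add_smul, extendZero_window (by omega) (by omega), add_smul, add_assoc]

lemma pathFlow_definedAt (q : Pt) (U : LatticeField) :
    (pathFlow N e R).DefinedAt q U ↔
      ∀ k ∈ Finset.Icc (-(N : ℤ) - 1) 0, lineDenom N β e U (q + k • e) ≠ 0 := by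
  refine forall₂_congr fun k hk => ?_
  rw [Finset.mem_Icc] at hk
  rw [← eval_translate_denom hR hk.1 hk.2]
  rfl

lemma pathFlow_shifted (q : Pt) (U : LatticeField) :
    (pathFlow N e R).shifted q U = U q *
      ((∏ k ∈ Finset.range (N + 1), 1 / lineDenom N β e U (q + ((k : ℤ) - N) • e)) -
        ∏ k ∈ Finset.range (N + 1), 1 / lineDenom N β e U (q + ((k : ℤ) - N - 1) • e)) := by
  have h0 := extendZero_window (N := N) (e := e) (R := R) (l := 0) (by omega) (by omega) q U
  rw [zero_smul, add_zero] at h0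
  simp only [Flow.shifted]
  change extendZero (pathFlow N e R).stencil ((pathFlow N e R).window q U) 0 * _ = _
  rw [h0]
  congr 2
  · refine Finset.prod_congr rfl fun k hk => ?_
    rw [Finset.mem_range] at hk
    rw [← eval_translate_denom hR (by omega) (by omega)]
    congr 3
    funext r
    simp only [translate]
    congr 1
    rw [← add_assoc]
    congr 1
    rw [sub_smul _ (1 : ℤ), one_smul]
    abel
  · refine Finset.prod_congr rfl fun k hk => ?_
    rw [Finset.mem_range] at hk
    rw [← eval_translate_denom hR (by omega) (by omega)]
    rfl

lemma pathFlow_mem_dom (x : (pathFlow N e R).stencil → ℝ) :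
    x ∈ (pathFlow N e R).dom ↔ ∀ k ∈ Finset.Icc (-(N : ℤ) - 1) 0,
      lineDenom N β e (extendZero (pathFlow N e R).stencil x) (k • e) ≠ 0 := by
  have := pathFlow_definedAt hR 0 (extendZero (pathFlow N e R).stencil x)
  rw [Flow.DefinedAt, window_zero_extendZero] at this
  simpa using this

lemma pathFlow_toFun (x : (pathFlow N e R).stencil → ℝ) :
    (pathFlow N e R).toFun x = extendZero (pathFlow N e R).stencil x 0 *
      ((∏ k ∈ Finset.range (N + 1),
          1 / lineDenom N β e (extendZero (pathFlow N e R).stencil x) (((k : ℤ) - N) • e)) -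
        ∏ k ∈ Finset.range (N + 1),
          1 / lineDenom N β e (extendZero (pathFlow N e R).stencil x) (((k : ℤ) - N - 1) • e)) := by
  have := pathFlow_shifted hR 0 (extendZero (pathFlow N e R).stencil x)
  rw [Flow.shifted, window_zero_extendZero] at this
  simpa using this

omit hR in
lemma contDiff_extendZero (T : Finset Pt) (p : Pt) :
    ContDiff ℝ ∞ fun x : T → ℝ => extendZero T x p := by
  unfold extendZero
  split_ifs with h
  · exact contDiff_apply ℝ ℝ _
  · exact contDiff_const

omit hR in
lemma contDiff_lineDenom (T : Finset Pt) (q : Pt) :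
    ContDiff ℝ ∞ fun x : T → ℝ => lineDenom N β e (extendZero T x) q := by
  unfold lineDenom
  exact (contDiff_prod fun m _ => contDiff_extendZero T _).sub contDiff_const

/-- The domain is dense since a product of denominators, restricted to a line through the
origin, is a polynomial with a nonzero constant term. -/
lemma pathFlow_isSmooth (hβ : β ≠ 0) : (pathFlow N e R).IsSmooth where
  isOpen_dom := by
    have : (pathFlow N e R).dom = ⋂ k ∈ Finset.Icc (-(N : ℤ) - 1) 0,
        {x | lineDenom N β e (extendZero (pathFlow N e R).stencil x) (k • e) ≠ 0} := by
      ext x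
      rw [pathFlow_mem_dom hR]
      simp only [Set.mem_iInter, Set.mem_ofPred_eq]
    rw [this]
    exact isOpen_biInter_finset fun k _ =>
      isOpen_ne_fun (contDiff_lineDenom _ _).continuous continuous_const
  dense_dom := by
    intro x
    set p : Polynomial ℝ := ∏ k ∈ Finset.Icc (-(N : ℤ) - 1) 0, (Polynomial.C (∏ m ∈
      Finset.range (N + 2), extendZero (pathFlow N e R).stencil x (k • e + (m : ℤ) • e)) *
        Polynomial.X ^ (N + 2) - Polynomial.C β) with hp
    have hp0 : p ≠ 0 := by
      intro h
      have h1 : p.eval 0 = 0 := by rw [h]; simp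
      rw [hp, Polynomial.eval_prod, Finset.prod_eq_zero_iff] at h1
      obtain ⟨k, _, hk⟩ := h1
      simp at hk
      exact hβ hk
    have hfin : {t : ℝ | p.eval t = 0}.Finite := by
      refine (p.roots.toFinset.finite_toSet).subset fun t ht => ?_
      simpa [hp0] using ht
    have hd : Dense {t : ℝ | p.eval t = 0}ᶜ := hfin.countable.dense_compl ℝ
    have hc : Continuous fun t : ℝ => t • x := by fun_prop
    have h1 : x ∈ closure ((fun t : ℝ => t • x) '' {t : ℝ | p.eval t = 0}ᶜ) := by
      have := hc.range_subset_closure_image_dense hd ⟨1, rfl⟩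
      simpa using this
    refine closure_mono ?_ h1
    rintro _ ⟨t, ht, rfl⟩
    rw [pathFlow_mem_dom hR]
    intro k hk h0
    apply ht
    change p.eval t = 0
    rw [hp, Polynomial.eval_prod]
    refine Finset.prod_eq_zero hk ?_
    have e1 : ∀ r, extendZero (pathFlow N e R).stencil (t • x) r =
        extendZero (pathFlow N e R).stencil x r * t := by
      intro r
      unfold extendZero
      split_ifs
      · simp [mul_comm]
      · simp
    simp only [lineDenom, e1, Finset.prod_mul_distrib, Finset.prod_const, Finset.card_range] at h0
    rw [Polynomial.eval_sub, Polynomial.eval_mul, Polynomial.eval_C, Polynomial.eval_pow,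
      Polynomial.eval_X, Polynomial.eval_C]
    exact h0
  contDiffOn := by
    have h1 : ∀ k ∈ Finset.Icc (-(N : ℤ) - 1) 0, ContDiffOn ℝ ∞ (fun x =>
        1 / lineDenom N β e (extendZero (pathFlow N e R).stencil x) (k • e))
        (pathFlow N e R).dom := fun k hk =>
      contDiffOn_const.div (contDiff_lineDenom _ _).contDiffOn
        fun x hx => (pathFlow_mem_dom hR x).1 hx k hk
    have h2 := (contDiff_extendZero (pathFlow N e R).stencil 0).contDiffOn.mul
      ((contDiffOn_prod fun (k : ℕ) (hk : k ∈ Finset.range (N + 1)) =>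
        h1 ((k : ℤ) - N) (by simp at hk ⊢; omega)).sub
      (contDiffOn_prod fun (k : ℕ) (hk : k ∈ Finset.range (N + 1)) =>
        h1 ((k : ℤ) - N - 1) (by simp at hk ⊢; omega)))
    exact h2.congr fun x _ => pathFlow_toFun hR x

/-- On the fields that are constant except at `(N + 1) e`, only the last factor of the
shifted product varies. -/
lemma pathFlow_test (he : Function.Injective fun k : ℤ => k • e) {c y : ℝ}
    (hc : c ^ (N + 2) - β ≠ 0) (hy : c ^ (N + 1) * y - β ≠ 0) :
    (pathFlow N e R).DefinedAt 0 (Function.update (fun _ => c) (((N : ℤ) + 1) • e) y) ∧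
      (pathFlow N e R).shifted 0 (Function.update (fun _ => c) (((N : ℤ) + 1) • e) y) =
        c * ((1 / (c ^ (N + 2) - β)) ^ N * (1 / (c ^ (N + 1) * y - β)) -
          (1 / (c ^ (N + 2) - β)) ^ (N + 1)) := by
  set U : LatticeField := Function.update (fun _ => c) (((N : ℤ) + 1) • e) y with hU
  have hval : ∀ l : ℤ, U (l • e) = if l = N + 1 then y else c := by
    intro l
    rw [hU, Function.update_apply]
    exact if_congr he.eq_iff rfl rfl
  have h1 : ∀ k : ℤ, k < 0 → lineDenom N β e U (k • e) = c ^ (N + 2) - β := by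
    intro k hk
    rw [lineDenom]
    congr 1
    rw [Finset.prod_congr rfl (g := fun _ => c)]
    · simp
    · intro m hm
      rw [Finset.mem_range] at hm
      rw [← add_smul, hval, if_neg (by omega)]
  have h2 : lineDenom N β e U ((0 : ℤ) • e) = c ^ (N + 1) * y - β := by
    rw [lineDenom, Finset.prod_range_succ, Finset.prod_congr rfl (g := fun _ => c)]
    · rw [← add_smul, hval, if_pos (by push_cast; ring)]
      simp
    · intro m hm
      rw [Finset.mem_range] at hm
      rw [← add_smul, hval, if_neg (by omega)]
  refine ⟨?_, ?_⟩
  · rw [pathFlow_definedAt hR]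
    intro k hk
    rw [Finset.mem_Icc] at hk
    rw [zero_add]
    rcases hk.2.lt_or_eq with h | rfl
    · rw [h1 k h]; exact hc
    · rw [h2]; exact hy
  · rw [pathFlow_shifted hR]
    have h0 := hval 0
    rw [zero_smul, if_neg (by omega)] at h0
    rw [h0, Finset.prod_range_succ]
    simp only [zero_add]
    congr 2
    · congr 1
      · rw [Finset.prod_congr rfl (g := fun _ => 1 / (c ^ (N + 2) - β))]
        · simp
        · intro k hk
          rw [Finset.mem_range] at hk
          rw [h1 _ (by omega)]
      · rw [sub_self, h2]
    · rw [Finset.prod_congr rfl (g := fun _ => 1 / (c ^ (N + 2) - β))]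
      · simp
      · intro k hk
        rw [Finset.mem_range] at hk
        rw [h1 _ (by omega)]

lemma pathFlow_isNontrivial_hasOrder (he : Function.Injective fun k : ℤ => k • e) :
    (pathFlow N e R).IsNontrivial ∧ (pathFlow N e R).HasOrder e (N + 1) := by
  set c : ℝ := |β| + 2 with hc
  have hc2 : 2 ≤ c := by rw [hc]; linarith [abs_nonneg β]
  have hcp : c ≤ c ^ (N + 2) := le_self_pow₀ (by linarith) (by omega)
  have h1 : 0 < c ^ (N + 2) - β := by linarith [le_abs_self β]
  have h2 : c ^ (N + 2) - β < c ^ (N + 1) * (2 * c) - β := by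
    rw [show c ^ (N + 1) * (2 * c) = c ^ (N + 2) + c ^ (N + 2) by ring]; linarith
  obtain ⟨a1, a2⟩ := pathFlow_test hR he (c := c) (y := c) h1.ne' (by
    rw [← pow_succ]; exact h1.ne')
  obtain ⟨b1, b2⟩ := pathFlow_test hR he (c := c) (y := 2 * c) h1.ne' (h1.trans h2).ne'
  have hz :
      (pathFlow N e R).shifted 0 (Function.update (fun _ => c) (((N : ℤ) + 1) • e) c) = 0 := by
    rw [a2, ← pow_succ c, ← pow_succ]
    ring
  have hnz : (pathFlow N e R).shifted 0
      (Function.update (fun _ => c) (((N : ℤ) + 1) • e) (2 * c)) ≠ 0 := by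
    rw [b2, pow_succ (1 / (c ^ (N + 2) - β)), ← mul_sub]
    refine mul_ne_zero (by linarith) (mul_ne_zero (pow_ne_zero _ (one_div_pos.2 h1).ne') ?_)
    exact (sub_neg.2 (one_div_lt_one_div_of_lt h1 h2)).ne
  refine ⟨⟨_, b1, hnz⟩, ⟨?_, ?_, ?_⟩⟩
  · intro p hp
    obtain ⟨k, _, rfl⟩ := Finset.mem_image.1 hp
    exact ⟨k, rfl⟩
  · intro x _ y _ hxy
    congr 1
    funext p
    refine hxy p ?_
    obtain ⟨k, hk, hkp⟩ := Finset.mem_image.1 p.2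
    rw [Finset.mem_Icc] at hk
    exact ⟨k, by rw [abs_le]; push_cast; omega, hkp.symm⟩
  · intro s hs
    by_contra hlt
    refine hnz ?_
    rw [← hz]
    refine hs _ b1 _ a1 ?_
    rintro p ⟨k, hk, hkp⟩
    simp only [Flow.window, zero_add, hkp]
    have : k ≠ (N : ℤ) + 1 := by
      have := (abs_le.1 hk).2
      omega
    rw [Function.update_of_ne (fun h => this (he h)), Function.update_of_ne (fun h => this (he h))]

end PathFlow

lemma smul_right_injective_unit : Function.Injective fun k : ℤ => k • ((1, 0) : Pt) := by
  intro k l h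
  simpa using h

lemma smul_up_injective_unit : Function.Injective fun k : ℤ => k • ((0, 1) : Pt) := by
  intro k l h
  simpa using h

lemma eval_denom_right (N : ℕ) (α : ℝ) (U : LatticeField) :
    eval U (Q (N + 1) 0 - C α) =
      ∏ m ∈ Finset.range (N + 2), U ((m : ℤ) • ((1, 0) : Pt)) - α := by
  rw [map_sub, eval_Q, eval_C, add_zero]
  have := pathSum_row (fun x y => U (x, y)) (N + 1) 0 0
  rw [zero_add] at this
  rw [Nat.cast_zero, this]
  simp

lemma eval_denom_up (N : ℕ) (α : ℝ) (U : LatticeField) :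
    eval U (Q 0 (N + 1) + C ((-1) ^ N * α)) =
      ∏ m ∈ Finset.range (N + 2), U ((m : ℤ) • ((0, 1) : Pt)) - (-1) ^ (N + 1) * α := by
  rw [map_add, eval_Q, eval_C, zero_add]
  have := pathSum_row (fun x y => U (y, x)) (N + 1) 0 0
  rw [zero_add, pathSum_swap (fun x y => U (x, y))] at this
  rw [Nat.cast_zero, this, pow_succ]
  simp

lemma LatticeSol.rowDenom_ne_zero {N : ℕ} {α : ℝ} {u : ℤ → ℤ → ℝ} (h : LatticeSol N α u)
    (hN : 1 ≤ N) (hα : α ≠ 0) {x : ℤ} (h0 : rowDenom N α u x 0 ≠ 0) (y : ℤ) :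
    rowDenom N α u x y ≠ 0 := by
  have hu := h.ne_zero hN hα
  have step : ∀ y, rowDenom N α u x y ≠ 0 ↔ rowDenom N α u x (y + 1) ≠ 0 := by
    intro y
    have := h.rowDenom_up hN x y
    constructor
    · intro h1 h2
      rw [h2, mul_zero] at this
      exact mul_ne_zero h1 (hu _ _) this.symm
    · intro h1 h2
      rw [h2, zero_mul] at this
      exact mul_ne_zero (hu _ _) h1 this
  induction y using Int.induction_on with
  | zero => exact h0
  | succ i ih => exact (step i).1 ih
  | pred i ih => exact (step _).2 (by simpa using ih)

theorem flowUN_isSymmetry {N : ℕ} (hN : 1 ≤ N) {α : ℝ} (hα : α ≠ 0) :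
    (flowUN N α).IsSymmetry (system N α) where
  isSmooth := pathFlow_isSmooth (eval_denom_right N α) hα
  determining := by
    rintro U hU P ⟨i, h1, h2, rfl⟩ hdef
    have hsol := isSolution_system_iff.1 hU
    set u : ℤ → ℤ → ℝ := fun x y => U (x, y) with hu
    rw [sum_vars_pderiv_Q U fun p => (flowUN N α).shifted p U]
    have hline : ∀ x y k : ℤ, lineDenom N α (1, 0) U ((x, y) + k • (1, 0)) =
        rowDenom N α u (x + k) y := by
      intro x y k
      simp [lineDenom, rowDenom, hu]
    have hV : (fun x y => (flowUN N α).shifted (x, y) U) =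
        fun x y => u x y * (flowProd N α u (x + 1) y - flowProd N α u x y) := by
      funext x y
      rw [flowUN, pathFlow_shifted (eval_denom_right N α)]
      simp only [hline, flowProd]
      congr 2
      refine Finset.prod_congr rfl fun k _ => ?_
      congr 2; ring
    rw [hV, show i + (N + 1 - i) = N + 1 by omega]
    have d0 := (pathFlow_definedAt (eval_denom_right N α) _ U).1 (hdef _ (origin_mem_vars i _ _))
    have d1 := (pathFlow_definedAt (eval_denom_right N α) _ U).1 (hdef _ (right_mem_vars i _ _))
    simp only [hline] at d0 d1
    have hcol : ∀ x : ℤ, -(N : ℤ) - 1 ≤ x → x ≤ i → ∀ y, rowDenom N α u x y ≠ 0 := by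
      intro x hx hx' y
      refine hsol.rowDenom_ne_zero hN hα ?_ y
      by_cases hx0 : x ≤ 0
      · simpa using d0 x (Finset.mem_Icc.2 ⟨hx, hx0⟩)
      · simpa using d1 (x - i) (Finset.mem_Icc.2 ⟨by omega, by omega⟩)
    have := hsol.pathDeriv_flow_eq_zero hN hα 0 0 (N + 1 - i) (by omega) (by omega) (by
      intro x hx hx' y
      rw [Nat.cast_sub (by omega)] at hx'
      push_cast at hx'
      exact ⟨hcol x (by omega) (by omega) y, hcol _ (by omega) (by omega) y⟩)
    convert this using 1
    congr 1
    · rw [Nat.cast_sub (by omega)]; push_cast; ring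
    · rw [zero_add]

theorem flowUM_isSymmetry {N : ℕ} (hN : 1 ≤ N) {α : ℝ} (hα : α ≠ 0) :
    (flowUM N α).IsSymmetry (system N α) where
  isSmooth := pathFlow_isSmooth (eval_denom_up N α) (by positivity)
  determining := by
    rintro U hU P ⟨i, h1, h2, rfl⟩ hdef
    -- reflection in the diagonal turns the second direction into the first one
    have hsol := (isSolution_system_iff.1 hU).swap
    have hβ : (-1) ^ (N + 1) * α ≠ 0 := by positivity
    set β : ℝ := (-1) ^ (N + 1) * α with hβdef
    set u : ℤ → ℤ → ℝ := fun x y => U (y, x) with hu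
    rw [sum_vars_pderiv_Q U fun p => (flowUM N α).shifted p U]
    have hline : ∀ x y k : ℤ, lineDenom N β (0, 1) U ((x, y) + k • (0, 1)) =
        rowDenom N β u (y + k) x := by
      intro x y k
      simp [lineDenom, rowDenom, hu]
    have hV : (fun x y => (flowUM N α).shifted (x, y) U) =
        fun x y => u y x * (flowProd N β u (y + 1) x - flowProd N β u y x) := by
      funext x y
      rw [flowUM, pathFlow_shifted (eval_denom_up N α)]
      simp only [← hβdef, hline, flowProd]
      congr 2
      refine Finset.prod_congr rfl fun k _ => ?_
      congr 2; ring
    rw [hV, show i + (N + 1 - i) = N + 1 by omega]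
    have d0 := (pathFlow_definedAt (eval_denom_up N α) _ U).1 (hdef _ (origin_mem_vars i _ _))
    have d1 := (pathFlow_definedAt (eval_denom_up N α) _ U).1 (hdef _ (top_mem_vars i _ _))
    simp only [← hβdef, hline] at d0 d1
    have hcol : ∀ x : ℤ, -(N : ℤ) - 1 ≤ x → x ≤ (N + 1 - i : ℕ) → ∀ y,
        rowDenom N β u x y ≠ 0 := by
      intro x hx hx' y
      refine hsol.rowDenom_ne_zero hN hβ ?_ y
      by_cases hx0 : x ≤ 0
      · simpa using d0 x (Finset.mem_Icc.2 ⟨hx, hx0⟩)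
      · simpa using d1 (x - (N + 1 - i : ℕ)) (Finset.mem_Icc.2 ⟨by omega, by omega⟩)
    have := hsol.pathDeriv_flow_eq_zero hN hβ 0 0 i h1 h2 (by
      intro x hx hx' y
      have e := Nat.cast_sub (R := ℤ) (show i ≤ N + 1 by omega)
      push_cast at e
      exact ⟨hcol x (by omega) (by omega) y, hcol _ (by omega) (by omega) y⟩)
    rw [← pathDeriv_swap] at this
    convert this using 1
    congr 1
    · rw [zero_add]
    · rw [Nat.cast_sub (by omega)]; push_cast; ring

/-! ### Sequences defined step by step -/

/-- A property `P k` of the values at the indices `≤ k` that can be extended from `k` to `k + 1` by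
choosing one more value holds, for all large `k`, for some sequence. -/
lemma exists_chain {X : Type*} [Nonempty X] (P : ℤ → (ℤ → X) → Prop)
    (hP : ∀ k f g, (∀ i ≤ k, f i = g i) → P k f → P k g) (c : ℤ)
    (hstep : ∀ k ≥ c, ∀ f, P k f → ∃ y, P (k + 1) (Function.update f (k + 1) y))
    (f₀ : ℤ → X) (h₀ : P c f₀) :
    ∃ f, (∀ i ≤ c, f i = f₀ i) ∧ ∀ k ≥ c, P k f := by
  choose! y hy using hstep
  let g : ℕ → ℤ → X := fun n => Nat.rec f₀
      (fun n f => Function.update f (c + n + 1) (y (c + n) f)) n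
  have gs : ∀ n, g (n + 1) = Function.update (g n) (c + n + 1) (y (c + n) (g n)) := fun n => rfl
  have gP : ∀ n : ℕ, P (c + n) (g n) := by
    intro n
    induction n with
    | zero => rw [Nat.cast_zero, add_zero]; exact h₀
    | succ n ih =>
      rw [gs]
      have := hy (c + n) (by omega) (g n) ih
      push_cast
      rwa [← add_assoc]
  have gst : ∀ (n m : ℕ) (i : ℤ), i ≤ c + n → g (n + m) i = g n i := by
    intro n m i hi
    induction m with
    | zero => rfl
    | succ m ih =>
      rw [← add_assoc, gs, Function.update_of_ne (by push_cast; omega), ih]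
  have fg : ∀ (n : ℕ) (i : ℤ), i ≤ c + n → g (i - c).toNat i = g n i := by
    intro n i hi
    have h1 : (i - c).toNat ≤ n := by omega
    obtain ⟨m, rfl⟩ := Nat.exists_eq_add_of_le h1
    rw [gst _ m i (by omega)]
  refine ⟨fun i => g (i - c).toNat i, fun i hi => ?_, fun k hk => ?_⟩
  · exact fg 0 i (by simpa using hi)
  · obtain ⟨n, rfl⟩ : ∃ n : ℕ, k = c + n := ⟨(k - c).toNat, by omega⟩
    exact hP _ _ _ (fun i hi => (fg n i hi).symm) (gP n)

section LinearRecurrence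

variable {D : ℕ} {c : ℤ → ℕ → ℝ}

lemma linrec_right (hD : ∀ l, c l D ≠ 0) (m : ℤ) (f₀ : ℤ → ℝ) :
    ∃ f : ℤ → ℝ, (∀ i < m + D, f i = f₀ i) ∧
      ∀ l ≥ m, ∑ k ∈ Finset.range (D + 1), c l k * f (l + k) = 0 := by
  obtain ⟨f, h1, h2⟩ := exists_chain (X := ℝ)
    (fun k f => ∀ l ≥ m, l + D ≤ k → ∑ i ∈ Finset.range (D + 1), c l i * f (l + i) = 0)
    (fun k f g hfg h l hl hk => by
      rw [← h l hl hk]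
      refine Finset.sum_congr rfl fun i hi => ?_
      rw [Finset.mem_range] at hi
      rw [hfg _ (by omega)])
    (m + D - 1)
    (fun k hk f h => by
      refine ⟨-(∑ i ∈ Finset.range D, c (k + 1 - D) i * f (k + 1 - D + i)) / c (k + 1 - D) D, ?_⟩
      intro l hl hlk
      by_cases hlk' : l + D ≤ k
      · rw [← h l hl hlk']
        refine Finset.sum_congr rfl fun i hi => ?_
        rw [Finset.mem_range] at hi
        rw [Function.update_of_ne (by omega)]
      · have e : l = k + 1 - D := by omega
        subst e
        rw [Finset.sum_range_succ, Finset.sum_congr rfl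
          (g := fun i : ℕ => c (k + 1 - D) i * f (k + 1 - D + i))]
        · rw [sub_add_cancel, Function.update_self]
          have := hD (k + 1 - D)
          field_simp
          ring
        · intro i hi
          rw [Finset.mem_range] at hi
          rw [Function.update_of_ne (by omega)])
    f₀ (fun l hl hl' => by omega)
  refine ⟨f, fun i hi => h1 i (by omega), fun l hl => h2 (max (l + D) (m + D - 1))
    (le_max_right _ _) l hl (le_max_left _ _)⟩

/-- A linear recurrence of order `D` whose extreme coefficients do not vanish has solutions on `ℤ`
with prescribed values at `D` consecutive indices. -/
lemma linrec_exists (h0 : ∀ l, c l 0 ≠ 0) (hD : ∀ l, c l D ≠ 0) (m : ℤ) (f₀ : ℤ → ℝ) :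
    ∃ f : ℤ → ℝ, (∀ i, m ≤ i → i < m + D → f i = f₀ i) ∧
      ∀ l, ∑ k ∈ Finset.range (D + 1), c l k * f (l + k) = 0 := by
  obtain ⟨f, h1, h2⟩ := linrec_right hD m f₀
  -- the reflected recurrence extends the solution to the left
  obtain ⟨g, h3, h4⟩ := linrec_right (D := D) (c := fun l k => c (-l - D) (D - k))
    (by intro l; simpa using h0 _) (-(m + D) + 1) (fun i => f (-i))
  have hg : ∀ i ≥ m, g (-i) = f i := by
    intro i hi
    rw [h3 (-i) (by omega), neg_neg]
  refine ⟨fun i => g (-i), fun i hi hi' => ?_, fun l => ?_⟩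
  · change g (-i) = f₀ i
    rw [hg i hi, h1 i hi']
  · by_cases hl : m ≤ l
    · rw [← h2 l hl]
      refine Finset.sum_congr rfl fun k _ => ?_
      change c l k * g (-(l + k)) = _
      rw [hg _ (by omega)]
    · rw [← h4 (-l - D) (by omega), ← Finset.sum_range_reflect]
      refine Finset.sum_congr rfl fun k hk => ?_
      have hk' : k ≤ D := by simpa [Nat.lt_succ_iff] using hk
      change c l _ * g _ = c _ _ * g _
      rw [show D + 1 - 1 - k = D - k by omega, Nat.cast_sub hk']
      congr 2
      · ring
      · ring

lemma linrec_unique (h0 : ∀ l, c l 0 ≠ 0) (hD : ∀ l, c l D ≠ 0) (m : ℤ) (f : ℤ → ℝ)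
    (hf : ∀ i, m ≤ i → i < m + D → f i = 0)
    (hrec : ∀ l, ∑ k ∈ Finset.range (D + 1), c l k * f (l + k) = 0) (i : ℤ) : f i = 0 := by
  have right : ∀ n : ℕ, ∀ i, m ≤ i → i < m + D + n → f i = 0 := by
    intro n
    induction n with
    | zero => simpa using hf
    | succ n ih =>
      intro i hi hi'
      by_cases h : i < m + D + n
      · exact ih i hi h
      · have := hrec (i - D)
        rw [Finset.sum_range_succ, Finset.sum_eq_zero, zero_add, sub_add_cancel] at this
        · exact (mul_eq_zero.1 this).resolve_left (hD _)
        · intro k hk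
          rw [Finset.mem_range] at hk
          rw [ih _ (by push_cast at hi'; omega) (by push_cast at hi'; omega), mul_zero]
  have left : ∀ n : ℕ, ∀ i, m - n ≤ i → i < m + D → f i = 0 := by
    intro n
    induction n with
    | zero => simpa using hf
    | succ n ih =>
      intro i hi hi'
      by_cases h : m - n ≤ i
      · exact ih i h hi'
      · have := hrec i
        rw [Finset.sum_range_succ', Finset.sum_eq_zero, zero_add] at this
        · rw [Nat.cast_zero, add_zero] at this
          exact (mul_eq_zero.1 this).resolve_left (h0 _)
        · intro k hk
          rw [Finset.mem_range] at hk
          rw [ih _ (by push_cast at hi ⊢; omega) (by push_cast at hi ⊢; omega), mul_zero]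
  by_cases hi : m ≤ i
  · exact right (i - m).toNat.succ i hi (by push_cast; omega)
  · exact left (m - i).toNat i (by omega) (by omega)

/-- A linear recurrence of order `D ≥ 1` whose extreme coefficients do not vanish has a nowhere
vanishing solution: in the one-parameter family of solutions with initial values `1, t, t ^ 2, …`,
each value is a nonzero polynomial in `t`. -/
lemma linrec_exists_ne_zero (hD1 : 1 ≤ D) (h0 : ∀ l, c l 0 ≠ 0) (hD : ∀ l, c l D ≠ 0) :
    ∃ f : ℤ → ℝ, (∀ i, f i ≠ 0) ∧
      ∀ l, ∑ k ∈ Finset.range (D + 1), c l k * f (l + k) = 0 := by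
  choose b hb1 hb2 using fun i : ℕ => linrec_exists h0 hD 0 (Pi.single (i : ℤ) 1)
  have hne : ∀ n : ℤ, ∃ i < D, b i n ≠ 0 := by
    intro n
    by_contra! hcon
    obtain ⟨g, hg1, hg2⟩ := linrec_exists h0 hD n (fun _ => 1)
    have h1 := linrec_unique h0 hD 0 (fun m => g m - ∑ i ∈ Finset.range D, g i * b i m)
      (fun m hm hm' => by
        lift m to ℕ using hm
        rw [Finset.sum_eq_single m]
        · rw [hb1 m m (by omega) (by omega)]; simp
        · intro j hj hjm
          rw [hb1 j m (by omega) (by omega), Pi.single_eq_of_ne (by omega), mul_zero]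
        · intro h
          simp at h; omega)
      (fun l => by
        simp only [mul_sub, Finset.sum_sub_distrib, hg2, zero_sub, neg_eq_zero, Finset.mul_sum]
        rw [Finset.sum_comm]
        refine Finset.sum_eq_zero fun i _ => ?_
        calc _ = g i * ∑ k ∈ Finset.range (D + 1), c l k * b i (l + k) := by
              rw [Finset.mul_sum]; exact Finset.sum_congr rfl fun k _ => by ring
          _ = 0 := by rw [hb2, mul_zero]) n
    rw [Finset.sum_eq_zero, hg1 n le_rfl (by omega)] at h1
    · norm_num at h1
    · intro i hi
      rw [hcon i (by simpa using hi), mul_zero]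
  have hcount : (⋃ n : ℤ, {t : ℝ | ∑ i ∈ Finset.range D, t ^ i * b i n = 0}).Countable := by
    refine Set.countable_iUnion fun n => Set.Finite.countable ?_
    obtain ⟨i, hi, hin⟩ := hne n
    set p : Polynomial ℝ := ∑ i ∈ Finset.range D, Polynomial.monomial i (b i n) with hp
    have hp0 : p ≠ 0 := by
      intro h
      apply hin
      have : p.coeff i = 0 := by rw [h]; simp
      rw [hp, Polynomial.finsetSum_coeff, Finset.sum_eq_single i] at this
      · simpa using this
      · intro j _ hji
        rw [Polynomial.coeff_monomial, if_neg hji]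
      · intro h
        simp at h; omega
    refine p.roots.toFinset.finite_toSet.subset fun t ht => ?_
    have : p.eval t = 0 := by
      rw [hp, Polynomial.eval_finsetSum, ← ht]
      exact Finset.sum_congr rfl fun i _ => by rw [Polynomial.eval_monomial, mul_comm]
    simpa [hp0] using this
  obtain ⟨t, ht⟩ := (hcount.dense_compl ℝ).nonempty
  refine ⟨fun n => ∑ i ∈ Finset.range D, t ^ i * b i n, fun n h => ht ?_, fun l => ?_⟩
  · exact Set.mem_iUnion.2 ⟨n, h⟩
  · simp only [Finset.mul_sum]
    rw [Finset.sum_comm]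
    refine Finset.sum_eq_zero fun i _ => ?_
    calc _ = t ^ i * ∑ k ∈ Finset.range (D + 1), c l k * b i (l + k) := by
          rw [Finset.mul_sum]; exact Finset.sum_congr rfl fun k _ => by ring
      _ = 0 := by rw [hb2, mul_zero]

end LinearRecurrence

/-! ### Existence of solutions with prescribed rows -/

/-- The rows `y ≤ M` with `L y` of `w` do not vanish and satisfy all equations of the system that
involve these rows only. -/
def RowsSol (N : ℕ) (α : ℝ) (L : ℤ → Prop) (M : ℤ) (w : ℤ → ℤ → ℝ) : Prop :=
  (∀ x y, L y → y ≤ M → w x y ≠ 0) ∧ ∀ x y, ∀ j : ℕ, 1 ≤ j → j ≤ N → L y → y + j ≤ M →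
    pathSum w (N + 1) x y (x + (N + 1 - j)) (y + j) = (-1) ^ j * α

section Rows

variable {N : ℕ} {α : ℝ} {L : ℤ → Prop}

lemma pathSum_column (u : ℤ → ℤ → ℝ) (n : ℕ) (a b : ℤ) :
    pathSum u n a b a (b + n) = ∏ i ∈ Finset.range (n + 1), u a (b + i) := by
  rw [← pathSum_swap u, pathSum_row]

/-- Decomposition of the paths that end in a row according to the point where they enter it. -/
lemma pathSum_enter_row (u : ℤ → ℤ → ℝ) (h d : ℕ) (a b : ℤ) :
    pathSum u (h + 1 + d) a b (a + d) (b + h + 1) =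
      ∑ k ∈ Finset.range (d + 1), pathSum u (h + k) a b (a + k) (b + h) *
        ∏ i ∈ Finset.range (d + 1 - k), u (a + k + i) (b + h + 1) := by
  induction d with
  | zero =>
    rw [Nat.add_zero, pathSum_succ_end, pathSum_eq_zero _ _ _ _ _ _ (by push_cast; omega)]
    simp
  | succ d ih =>
    rw [← add_assoc, pathSum_succ_end, Finset.sum_range_succ, add_mul]
    congr 1
    · rw [show a + ((d + 1 : ℕ) : ℤ) - 1 = a + d by push_cast; ring, ih, Finset.sum_mul]
      refine Finset.sum_congr rfl fun k hk => ?_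
      have hk' : k ≤ d := by simpa [Nat.lt_succ_iff] using hk
      rw [show d + 1 + 1 - k = d + 1 - k + 1 by omega, Finset.prod_range_succ, ← mul_assoc]
      congr 2
      rw [Nat.cast_sub (by omega)]
      push_cast; ring
    · rw [show d + 1 + 1 - (d + 1) = 1 by omega, Finset.prod_range_one, add_sub_cancel_right,
        show h + 1 + d = h + (d + 1) by ring]
      simp

/-- Any admissible block of rows can be extended by one more row. The equation with the largest
number of rows becomes a linear recurrence with nonvanishing extreme coefficients, and it implies
the other ones. -/
lemma RowsSol.exists_next (hα : α ≠ 0) (hN : 1 ≤ N) (hL : ∀ y z, y ≤ z → L y → L z) {M : ℤ}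
    (hM : L M) {w : ℤ → ℤ → ℝ} (h : RowsSol N α L M w) :
    ∃ g : ℤ → ℝ, RowsSol N α L (M + 1) fun x y => if y = M + 1 then g x else w x y := by
  -- `J` is the largest height of an equation that ends in the new row and begins in the block
  obtain ⟨J, hJ1, hJN, hJ⟩ : ∃ J : ℕ, 1 ≤ J ∧ J ≤ N ∧
      ∀ j : ℕ, 1 ≤ j → j ≤ N → (L (M + 1 - j) ↔ j ≤ J) := by
    classical
    refine ⟨Nat.findGreatest (fun j => L (M + 1 - j)) N, ?_, Nat.findGreatest_le _, ?_⟩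
    · exact Nat.le_findGreatest hN (by simpa using hM)
    · intro j h1 h2
      refine ⟨fun hj => Nat.le_findGreatest h2 hj, fun hj => ?_⟩
      have := Nat.findGreatest_spec (P := fun j : ℕ => L (M + 1 - j)) hN (by simpa using hM)
      exact hL _ _ (by omega) this
  obtain ⟨h', rfl⟩ : ∃ h', J = h' + 1 := ⟨J - 1, by omega⟩
  obtain ⟨d, hd⟩ : ∃ d, N = h' + d := ⟨N - h', by omega⟩
  have hd1 : 1 ≤ d := by omega
  have hLJ : L (M - h') := by
    have := (hJ (h' + 1) (by omega) hJN).2 le_rfl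
    rwa [show M + 1 - ((h' + 1 : ℕ) : ℤ) = M - h' by push_cast; ring] at this
  -- with the new row written as `φ n / φ (n + 1)`, the equation of height `J` is linear in `φ`
  obtain ⟨φ, hφ0, hφ⟩ := linrec_exists_ne_zero (D := d + 1)
    (c := fun l k => if k = d + 1 then -((-1) ^ (h' + 1) * α)
      else pathSum w (h' + k) l (M - h') (l + k) M) (by omega)
    (by
      intro l
      rw [if_neg (by omega)]
      have := pathSum_column w h' l (M - h')
      rw [sub_add_cancel] at this
      rw [Nat.add_zero, Nat.cast_zero, add_zero, this]
      refine Finset.prod_ne_zero_iff.2 fun i hi => h.1 _ _ (hL _ _ (by omega) hLJ) ?_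
      rw [Finset.mem_range] at hi
      omega)
    (by
      intro l
      rw [if_pos rfl]
      exact neg_ne_zero.2 (mul_ne_zero (pow_ne_zero _ (by norm_num)) hα))
  set g : ℤ → ℝ := fun n => φ n / φ (n + 1) with hg
  have hg0 : ∀ n, g n ≠ 0 := fun n => div_ne_zero (hφ0 _) (hφ0 _)
  have hprod : ∀ (a : ℤ) (n : ℕ), ∏ i ∈ Finset.range n, g (a + i) = φ a / φ (a + n) := by
    intro a n
    induction n with
    | zero => simp [hφ0]
    | succ n ih =>
      rw [Finset.prod_range_succ, ih, hg]
      have := hφ0 (a + n)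
      push_cast
      rw [← add_assoc]
      field_simp
  set w' : ℤ → ℤ → ℝ := fun x y => if y = M + 1 then g x else w x y with hw'
  have hww : ∀ (n : ℕ) (a b c d : ℤ), d ≤ M → pathSum w' n a b c d = pathSum w n a b c d :=
    fun n a b c d hd => pathSum_congr n a b c d fun x y _ _ _ hy => by
      simp only [hw']; rw [if_neg (by omega)]
  have hw0 : ∀ x y, L y → y ≤ M + 1 → w' x y ≠ 0 := by
    intro x y hy hyM
    simp only [hw']
    split_ifs with hh
    · exact hg0 x
    · exact h.1 x y hy (by omega)
  -- the equation that involves the largest number of rows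
  have top : ∀ l : ℤ, pathSum w' (N + 1) l (M - h') (l + d) (M + 1) = (-1) ^ (h' + 1) * α := by
    intro l
    have e := pathSum_enter_row w' h' d l (M - h')
    rw [show h' + 1 + d = N + 1 by omega, sub_add_cancel] at e
    rw [e]
    have e2 := hφ l
    rw [Finset.sum_range_succ, if_pos rfl] at e2
    have e3 : ∀ k ∈ Finset.range (d + 1), pathSum w' (h' + k) l (M - h') (l + k) M *
        ∏ i ∈ Finset.range (d + 1 - k), w' (l + k + i) (M + 1) =
        (if k = d + 1 then -((-1) ^ (h' + 1) * α)
          else pathSum w (h' + k) l (M - h') (l + k) M) * φ (l + k) / φ (l + (d + 1)) := by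
      intro k hk
      rw [Finset.mem_range] at hk
      rw [if_neg (by omega), hww _ _ _ _ _ le_rfl]
      have : ∏ i ∈ Finset.range (d + 1 - k), w' (l + k + i) (M + 1) =
          ∏ i ∈ Finset.range (d + 1 - k), g (l + k + i) :=
        Finset.prod_congr rfl fun i _ => by simp [hw']
      rw [this, hprod, Nat.cast_sub (by omega), mul_div_assoc]
      congr 3
      push_cast; ring
    rw [Finset.sum_congr rfl e3, ← Finset.sum_div, eq_neg_of_add_eq_zero_left e2]
    have := hφ0 (l + (d + 1))
    push_cast
    field_simp
  -- the equations of smaller height follow one after another: compare the recursions for the first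
  -- and the last step of the paths with `N + 2` steps
  have all : ∀ m : ℕ, m ≤ h' → ∀ x : ℤ,
      pathSum w' (N + 1) x (M - h' + m) (x + (d + m)) (M + 1) = (-1) ^ (h' + 1 - m) * α := by
    intro m
    induction m with
    | zero => intro _ x; simpa using top x
    | succ m ih =>
      intro hm x
      have e1 := pathSum_succ w' (N + 1) x (M - h' + m) (x + (d + (m + 1))) (M + 1)
      rw [pathSum_succ_end] at e1
      have i1 := ih (by omega) x
      have i2 := ih (by omega) (x + 1)
      have hLm : L (M - h' + m) := hL _ _ (by omega) hLJ
      have i3 := h.2 x (M - h' + m) (h' - m) (by omega) (by omega) hLm (by omega)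
      rw [← hww _ _ _ _ _ (by omega)] at i3
      rw [show M - (h' : ℤ) + m + ((h' - m : ℕ) : ℤ) = M by omega,
        show x + ((N : ℤ) + 1 - ((h' - m : ℕ) : ℤ)) = x + (d + (m + 1)) by omega] at i3
      rw [show x + ((d : ℤ) + (m + 1)) - 1 = x + (d + m) by ring, i1, add_sub_cancel_right, i3,
        show x + ((d : ℤ) + (m + 1)) = x + 1 + (d + m) by ring, i2,
        show h' + 1 - m = (h' - m) + 1 by omega, pow_succ] at e1
      have hne := hw0 x (M - h' + m) hLm (by omega)
      have e2 : (-1) ^ (h' - m) * -1 * α + (-1) ^ (h' - m) * α = 0 := by ring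
      rw [e2, zero_mul] at e1
      have e3 := (mul_eq_zero.1 e1.symm).resolve_left hne
      push_cast
      rw [show x + ((d : ℤ) + (m + 1)) = x + 1 + (d + m) by ring, ← add_assoc]
      linarith
  refine ⟨g, hw0, ?_⟩
  intro x y j h1 h2 hy hyj
  by_cases hyM : y + j ≤ M
  · rw [hww _ _ _ _ _ hyM]
    exact h.2 x y j h1 h2 hy hyM
  · have e : y = M + 1 - j := by omega
    subst e
    have hj := (hJ j h1 h2).1 hy
    have := all (h' + 1 - j) (by omega) x
    rw [show M - (h' : ℤ) + ((h' + 1 - j : ℕ) : ℤ) = M + 1 - j by omega,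
      show x + ((d : ℤ) + ((h' + 1 - j : ℕ) : ℤ)) = x + (N + 1 - j) by omega,
      show h' + 1 - (h' + 1 - j) = j by omega] at this
    rw [show M + 1 - (j : ℤ) + j = M + 1 by ring]
    exact this

lemma RowsSol.congr {M : ℤ} {w w' : ℤ → ℤ → ℝ} (h : RowsSol N α L M w)
    (hw : ∀ x y, y ≤ M → w x y = w' x y) : RowsSol N α L M w' := by
  refine ⟨fun x y hy hM => hw x y hM ▸ h.1 x y hy hM, fun x y j h1 h2 hy hM => ?_⟩
  rw [← h.2 x y j h1 h2 hy hM]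
  exact (pathSum_congr _ _ _ _ _ fun a b _ _ _ hb => hw a b (by omega)).symm

lemma RowsSol.exists_upward (hα : α ≠ 0) (hN : 1 ≤ N) (hL : ∀ y z, y ≤ z → L y → L z) {M : ℤ}
    (hM : L M) {w : ℤ → ℤ → ℝ} (h : RowsSol N α L M w) :
    ∃ W : ℤ → ℤ → ℝ, (∀ x y, y ≤ M → W x y = w x y) ∧ ∀ k ≥ M, RowsSol N α L k W := by
  obtain ⟨f, h1, h2⟩ := exists_chain (X := ℤ → ℝ)
    (fun k f => RowsSol N α L k fun x y => f y x)
    (fun k f g hfg hf => hf.congr fun x y hy => by rw [hfg y hy]) M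
    (fun k hk f hf => by
      obtain ⟨g, hg⟩ := hf.exists_next hα hN hL (hL _ _ hk hM)
      refine ⟨g, hg.congr fun x y _ => ?_⟩
      rw [Function.update_apply]
      split_ifs <;> rfl) (fun y x => w x y) h
  exact ⟨fun x y => f y x, fun x y hy => by (show f y x = _; rw [h1 y hy]), h2⟩

/-- A finite nonempty block of rows that satisfies the equations extends to a solution on the
lattice. -/
theorem RowsSol.exists_latticeSol (hα : α ≠ 0) (hN : 1 ≤ N) {M : ℤ} (hM : 0 ≤ M)
    {w : ℤ → ℤ → ℝ} (h : RowsSol N α (fun y => 0 ≤ y) M w) :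
    ∃ W, LatticeSol N α W ∧ ∀ x y, 0 ≤ y → y ≤ M → W x y = w x y := by
  obtain ⟨W, hW1, hW2⟩ := h.exists_upward hα hN (fun y z h1 h2 => le_trans h2 h1) hM
  -- the reflected half plane is extended upwards in turn
  have h2 : RowsSol N α (fun _ => True) 0 (fun x y => W (-x) (-y)) := by
    refine ⟨fun x y _ hy => (hW2 (max M (-y)) (le_max_left _ _)).1 _ _ (by omega)
      (le_max_right _ _), fun x y j h1 h2 _ hyj => ?_⟩
    rw [pathSum_neg, ← (hW2 (max M (-y)) (le_max_left _ _)).2 (-(x + (N + 1 - j)))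
        (-(y + j)) j h1 h2
      (by omega) (by simp)]
    congr 1 <;> ring
  obtain ⟨V, hV1, hV2⟩ := h2.exists_upward hα hN (fun _ _ _ _ => trivial) trivial
  have hV : LatticeSol N α V := fun x y j h1 h2 =>
    (hV2 (max 0 (y + j)) (le_max_left _ _)).2 x y j h1 h2 trivial (le_max_right _ _)
  refine ⟨_, hV.neg, fun x y hy hyM => ?_⟩
  rw [hV1 _ _ (by omega), neg_neg, neg_neg, hW1 x y hyM]

end Rows

/-! ### Pairs of adjacent rows -/

/-- The translate of a row. -/
def shiftRow (k : ℤ) (x : ℤ → ℝ) : ℤ → ℝ := fun i => x (k + i)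

/-- The mirror image of a row. -/
def reflectRow (x : ℤ → ℝ) : ℤ → ℝ := fun i => x (-i)

@[simp] lemma shiftRow_apply (k : ℤ) (x : ℤ → ℝ) (i : ℤ) : shiftRow k x i = x (k + i) := rfl

@[simp] lemma reflectRow_apply (x : ℤ → ℝ) (i : ℤ) : reflectRow x i = x (-i) := rfl

lemma reflectRow_reflectRow (x : ℤ → ℝ) : reflectRow (reflectRow x) = x := by
  funext i; simp

lemma shiftRow_shiftRow (k l : ℤ) (x : ℤ → ℝ) : shiftRow k (shiftRow l x) = shiftRow (l + k) x := by
  funext i; simp [add_assoc]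

lemma shiftRow_zero (x : ℤ → ℝ) : shiftRow 0 x = x := by
  funext i; simp

/-- For a row `u` and the row `v` above it, the product of the values along the path from the point
`l` of the lower row to the point `l + N` of the upper row that steps up at `l + n`. -/
def pairTerm (N : ℕ) (u v : ℤ → ℝ) (l : ℤ) (n : ℕ) : ℝ :=
  (∏ i ∈ Finset.range (n + 1), u (l + i)) * ∏ i ∈ Finset.range (N + 1 - n), v (l + n + i)

/-- The equation of the system for `Q_{(N,1)}`, at the point `l`, for a row `u` and the row `v`
above it. -/
def RowEq (N : ℕ) (α : ℝ) (u v : ℤ → ℝ) (l : ℤ) : Prop :=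
  ∑ n ∈ Finset.range (N + 1), pairTerm N u v l n = -α

/-- The rows `u` and `v` do not vanish on `I` and satisfy the equations that involve only indices in
the interval `I`. -/
structure RowPairOn (N : ℕ) (α : ℝ) (I : Set ℤ) (u v : ℤ → ℝ) : Prop where
  left_ne : ∀ i ∈ I, u i ≠ 0
  right_ne : ∀ i ∈ I, v i ≠ 0
  rowEq : ∀ l ∈ I, l + N ∈ I → RowEq N α u v l

/-- The sum of the `pairTerm N u v l n` with `n < N`, without their last factor `v (l + N)`. -/
def pairHead (N : ℕ) (u v : ℤ → ℝ) (l : ℤ) : ℝ :=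
  ∑ n ∈ Finset.range N,
    (∏ i ∈ Finset.range (n + 1), u (l + i)) * ∏ i ∈ Finset.range (N - n), v (l + n + i)

section RowPairs

variable {N : ℕ} {α : ℝ} {u v u' v' : ℤ → ℝ} {l : ℤ} {n : ℕ}

lemma pairTerm_congr (hn : n ≤ N) (hu : ∀ i, l ≤ i → i ≤ l + n → u i = u' i)
    (hv : ∀ i, l + n ≤ i → i ≤ l + N → v i = v' i) :
    pairTerm N u v l n = pairTerm N u' v' l n := by
  simp only [pairTerm]
  congr 1
  · refine Finset.prod_congr rfl fun i hi => hu _ (by omega) ?_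
    rw [Finset.mem_range] at hi; omega
  · refine Finset.prod_congr rfl fun i hi => hv _ (by omega) ?_
    rw [Finset.mem_range] at hi; omega

lemma RowEq.congr (h : RowEq N α u v l) (hu : ∀ i, l ≤ i → i ≤ l + N → u i = u' i)
    (hv : ∀ i, l ≤ i → i ≤ l + N → v i = v' i) : RowEq N α u' v' l := by
  rw [RowEq, ← h]
  refine Finset.sum_congr rfl fun n hn => (pairTerm_congr ?_ ?_ ?_).symm
  · rw [Finset.mem_range] at hn; omega
  · rw [Finset.mem_range] at hn
    exact fun i h1 h2 => hu i h1 (by omega)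
  · exact fun i h1 h2 => hv i (by omega) h2

lemma RowPairOn.congr {I : Set ℤ} (h : RowPairOn N α I u v) (hI : I.OrdConnected)
    (hu : ∀ i ∈ I, u i = u' i) (hv : ∀ i ∈ I, v i = v' i) : RowPairOn N α I u' v' where
  left_ne i hi := hu i hi ▸ h.left_ne i hi
  right_ne i hi := hv i hi ▸ h.right_ne i hi
  rowEq l h1 h2 := (h.rowEq l h1 h2).congr (fun i h3 h4 => hu i (hI.out h1 h2 ⟨h3, h4⟩))
    fun i h3 h4 => hv i (hI.out h1 h2 ⟨h3, h4⟩)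

lemma RowPairOn.mono {I J : Set ℤ} (h : RowPairOn N α I u v) (hJ : J ⊆ I) :
    RowPairOn N α J u v where
  left_ne i hi := h.left_ne i (hJ hi)
  right_ne i hi := h.right_ne i (hJ hi)
  rowEq l h1 h2 := h.rowEq l (hJ h1) (hJ h2)

lemma pairTerm_shift (k : ℤ) :
    pairTerm N (shiftRow k u) (shiftRow k v) l n = pairTerm N u v (k + l) n := by
  simp only [pairTerm, shiftRow_apply, ← add_assoc]

lemma RowPairOn.shift {I : Set ℤ} (h : RowPairOn N α I u v) (k : ℤ) :
    RowPairOn N α {i | k + i ∈ I} (shiftRow k u) (shiftRow k v) where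
  left_ne i hi := h.left_ne _ hi
  right_ne i hi := h.right_ne _ hi
  rowEq l h1 h2 := by
    rw [RowEq, ← h.rowEq (k + l) h1 (by rw [add_assoc]; exact h2)]
    exact Finset.sum_congr rfl fun n _ => pairTerm_shift k

lemma pairTerm_reflect (hn : n ≤ N) :
    pairTerm N (reflectRow v) (reflectRow u) l n = pairTerm N u v (-(l + N)) (N - n) := by
  simp only [pairTerm, reflectRow_apply]
  rw [mul_comm, show N - n + 1 = N + 1 - n by omega, show N + 1 - (N - n) = n + 1 by omega]
  congr 1
  · rw [← Finset.prod_range_reflect]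
    refine Finset.prod_congr rfl fun i hi => ?_
    rw [Finset.mem_range] at hi
    congr 1; omega
  · rw [← Finset.prod_range_reflect]
    refine Finset.prod_congr rfl fun i hi => ?_
    rw [Finset.mem_range] at hi
    congr 1; omega

lemma rowEq_reflect :
    RowEq N α (reflectRow v) (reflectRow u) l ↔ RowEq N α u v (-(l + N)) := by
  rw [RowEq, RowEq, ← Finset.sum_range_reflect]
  refine Eq.congr_left (Finset.sum_congr rfl fun n hn => ?_)
  rw [Finset.mem_range] at hn
  rw [pairTerm_reflect (by omega)]
  congr 1; omega

lemma RowPairOn.reflect {I : Set ℤ} (h : RowPairOn N α I u v) :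
    RowPairOn N α {i | -i ∈ I} (reflectRow v) (reflectRow u) where
  left_ne i hi := h.right_ne _ hi
  right_ne i hi := h.left_ne _ hi
  rowEq l h1 h2 := by
    rw [rowEq_reflect]
    exact h.rowEq _ h2 (by rw [neg_add, neg_add_cancel_right]; exact h1)

lemma pairTerm_eq_mul (hn : n < N) :
    pairTerm N u v l n = (∏ i ∈ Finset.range (n + 1), u (l + i)) *
      (∏ i ∈ Finset.range (N - n), v (l + n + i)) * v (l + N) := by
  rw [pairTerm, show N + 1 - n = N - n + 1 by omega,
    Finset.prod_range_succ (fun i : ℕ => v (l + n + i)), ← mul_assoc]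
  congr 2; omega

lemma pairTerm_self :
    pairTerm N u v l N = (∏ i ∈ Finset.range N, u (l + i)) * u (l + N) * v (l + N) := by
  rw [pairTerm, Finset.prod_range_succ, Nat.add_sub_cancel_left, Finset.prod_range_one]
  simp

lemma sum_pairTerm : ∑ n ∈ Finset.range (N + 1), pairTerm N u v l n =
    (pairHead N u v l + (∏ i ∈ Finset.range N, u (l + i)) * u (l + N)) * v (l + N) := by
  rw [Finset.sum_range_succ, pairTerm_self, pairHead, add_mul, Finset.sum_mul]
  congr 1
  exact Finset.sum_congr rfl fun n hn => pairTerm_eq_mul (Finset.mem_range.1 hn)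

/-- The equation of a pair of rows is linear in the last value of each of the rows. -/
lemma rowEq_iff : RowEq N α u v l ↔
    (pairHead N u v l + (∏ i ∈ Finset.range N, u (l + i)) * u (l + N)) * v (l + N) = -α := by
  rw [RowEq, sum_pairTerm]

lemma pairHead_congr (hu : ∀ i, l ≤ i → i < l + N → u i = u' i)
    (hv : ∀ i, l ≤ i → i < l + N → v i = v' i) : pairHead N u v l = pairHead N u' v' l := by
  refine Finset.sum_congr rfl fun n hn => ?_
  rw [Finset.mem_range] at hn
  congr 1
  · refine Finset.prod_congr rfl fun i hi => hu _ (by omega) ?_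
    rw [Finset.mem_range] at hi; omega
  · refine Finset.prod_congr rfl fun i hi => hv _ (by omega) ?_
    rw [Finset.mem_range] at hi; omega

lemma prod_congr_row {m : ℕ} (hu : ∀ i, l ≤ i → i < l + m → u i = u' i) :
    ∏ i ∈ Finset.range m, u (l + i) = ∏ i ∈ Finset.range m, u' (l + i) :=
  Finset.prod_congr rfl fun i hi => hu _ (by omega) (by rw [Finset.mem_range] at hi; omega)

lemma prod_row_ne_zero {m : ℕ} (hu : ∀ i, l ≤ i → i < l + m → u i ≠ 0) :
    ∏ i ∈ Finset.range m, u (l + i) ≠ 0 :=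
  Finset.prod_ne_zero_iff.2 fun i hi => hu _ (by omega) (by rw [Finset.mem_range] at hi; omega)

lemma RowEq.right_unique (hα : α ≠ 0) (h : RowEq N α u v l) (h' : RowEq N α u' v' l)
    (hu : ∀ i, l ≤ i → i ≤ l + N → u i = u' i) (hv : ∀ i, l ≤ i → i < l + N → v i = v' i) :
    v (l + N) = v' (l + N) := by
  rw [rowEq_iff] at h h'
  rw [← pairHead_congr (fun i h1 h2 => hu i h1 h2.le) hv,
    ← prod_congr_row (fun i h1 h2 => hu i h1 h2.le), ← hu _ (by omega) le_rfl, ← h] at h'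
  refine (mul_left_cancel₀ (fun h0 => hα ?_) h').symm
  rw [h0, zero_mul] at h
  linarith

/-! ### Extension of pairs of rows -/

lemma RowPairOn.exists_next (hα : α ≠ 0) (hN : 1 ≤ N) {L : ℤ → Prop}
    (hL : ∀ y z, y ≤ z → L y → L z) {k : ℤ} (h : RowPairOn N α {i | L i ∧ i ≤ k} u v) :
    ∃ p q : ℝ, RowPairOn N α {i | L i ∧ i ≤ k + 1} (Function.update u (k + 1) p)
      (Function.update v (k + 1) q) := by
  have hup : ∀ (w : ℤ → ℝ) (p : ℝ) (i : ℤ), i ≤ k → Function.update w (k + 1) p i = w i :=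
    fun w p i hi => Function.update_of_ne (by omega) _ _
  have main : ∀ p q : ℝ, p ≠ 0 → q ≠ 0 →
      (L (k + 1 - N) → RowEq N α (Function.update u (k + 1) p) (Function.update v (k + 1) q)
        (k + 1 - N)) →
      RowPairOn N α {i | L i ∧ i ≤ k + 1} (Function.update u (k + 1) p)
        (Function.update v (k + 1) q) := by
    intro p q hp hq heq
    refine ⟨fun i hi => ?_, fun i hi => ?_, fun l hl hlN => ?_⟩
    · rcases eq_or_ne i (k + 1) with rfl | hik
      · rwa [Function.update_self]
      · rw [Function.update_of_ne hik]
        exact h.left_ne i ⟨hi.1, by have := hi.2; omega⟩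
    · rcases eq_or_ne i (k + 1) with rfl | hik
      · rwa [Function.update_self]
      · rw [Function.update_of_ne hik]
        exact h.right_ne i ⟨hi.1, by have := hi.2; omega⟩
    · by_cases hlk : l + N ≤ k
      · exact (h.rowEq l ⟨hl.1, by omega⟩ ⟨hlN.1, hlk⟩).congr
          (fun i _ hi => (hup u p i (by omega)).symm) fun i _ hi => (hup v q i (by omega)).symm
      · have e : l = k + 1 - N := by have := hlN.2; omega
        subst e
        exact heq hl.1
  by_cases hLk : L (k + 1 - N)
  · set H := pairHead N u v (k + 1 - N)
    have hP : ∏ i ∈ Finset.range N, u (k + 1 - N + i) ≠ 0 :=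
      prod_row_ne_zero fun i h1 h2 => h.left_ne i ⟨hL _ _ h1 hLk, by omega⟩
    obtain ⟨q, hq0, hq⟩ : ∃ q : ℝ, q ≠ 0 ∧ -α / q - H ≠ 0 := by
      by_cases h1 : -α / 1 - H = 0
      · refine ⟨2, two_ne_zero, fun h2 => hα ?_⟩
        linarith
      · exact ⟨1, one_ne_zero, h1⟩
    refine ⟨_, q, main ((-α / q - H) / ∏ i ∈ Finset.range N, u (k + 1 - N + i)) q
      (div_ne_zero hq hP) hq0 fun _ => ?_⟩
    rw [rowEq_iff, pairHead_congr (fun i _ hi => hup u _ i (by omega))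
      (fun i _ hi => hup v q i (by omega)), prod_congr_row (fun i _ hi => hup u _ i (by omega)),
      sub_add_cancel, Function.update_self, Function.update_self, mul_div_cancel₀ _ hP,
      add_sub_cancel, div_mul_cancel₀ _ hq0]
  · exact ⟨1, 1, main 1 1 one_ne_zero one_ne_zero fun h => absurd h hLk⟩

lemma RowPairOn.exists_right (hα : α ≠ 0) (hN : 1 ≤ N) {L : ℤ → Prop}
    (hL : ∀ y z, y ≤ z → L y → L z) {k : ℤ} (h : RowPairOn N α {i | L i ∧ i ≤ k} u v) :
    ∃ u' v' : ℤ → ℝ, (∀ i ≤ k, u' i = u i ∧ v' i = v i) ∧ RowPairOn N α {i | L i} u' v' := by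
  obtain ⟨f, h1, h2⟩ := exists_chain (X := ℝ × ℝ)
    (fun k f => RowPairOn N α {i | L i ∧ i ≤ k} (fun i => (f i).1) (fun i => (f i).2))
    (fun k f g hfg hf => hf.congr ⟨fun a ha b hb c hc => ⟨hL _ _ hc.1 ha.1, hc.2.trans hb.2⟩⟩
      (fun i hi => by rw [hfg i hi.2]) fun i hi => by rw [hfg i hi.2]) k
    (fun k _ f hf => by
      obtain ⟨p, q, hpq⟩ := hf.exists_next hα hN hL
      refine ⟨(p, q), ?_⟩
      convert hpq using 1 <;>
      · funext i
        by_cases hi : i = k + 1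
        · subst hi; simp
        · simp [Function.update_of_ne hi]) (fun i => (u i, v i)) h
  refine ⟨fun i => (f i).1, fun i => (f i).2, fun i hi => by simp [h1 i hi],
    fun i hi => ?_, fun i hi => ?_, fun l hl hlN => ?_⟩
  · exact (h2 (max i k) (le_max_right _ _)).left_ne i ⟨hi, le_max_left _ _⟩
  · exact (h2 (max i k) (le_max_right _ _)).right_ne i ⟨hi, le_max_left _ _⟩
  · exact (h2 (max (l + N) k) (le_max_right _ _)).rowEq l
      ⟨hl, le_trans (by omega) (le_max_left _ _)⟩ ⟨hlN, le_max_left _ _⟩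

/-- A finite pair of rows that satisfies the equations extends to a solution on the lattice. -/
theorem RowPairOn.exists_latticeSol (hα : α ≠ 0) (hN : 1 ≤ N) {a b : ℤ}
    (h : RowPairOn N α (Set.Icc a b) u v) :
    ∃ W, LatticeSol N α W ∧ ∀ i ∈ Set.Icc a b, W i 0 = u i ∧ W i 1 = v i := by
  obtain ⟨u₁, v₁, h1, h2⟩ := RowPairOn.exists_right (L := fun i => a ≤ i) hα hN
    (fun y z hyz hy => hy.trans hyz) h
  -- the reflected half-infinite pair is extended to the right in turn
  have h3 : RowPairOn N α {i | True ∧ i ≤ -a} (reflectRow v₁) (reflectRow u₁) :=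
    h2.reflect.mono fun i hi => by
      have := hi.2
      simp only [Set.mem_ofPred_eq]; omega
  obtain ⟨v₂, u₂, h4, h5⟩ := RowPairOn.exists_right (L := fun _ => True) hα hN
    (fun _ _ _ _ => trivial) h3
  have h6 := h5.reflect
  have hu : ∀ i ∈ Set.Icc a b, reflectRow u₂ i = u i := fun i hi => by
    have := (h4 (-i) (by have := hi.1; omega)).2
    rw [reflectRow_apply, this, reflectRow_apply, neg_neg, (h1 i hi.2).1]
  have hv : ∀ i ∈ Set.Icc a b, reflectRow v₂ i = v i := fun i hi => by
    have := (h4 (-i) (by have := hi.1; omega)).1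
    rw [reflectRow_apply, this, reflectRow_apply, neg_neg, (h1 i hi.2).2]
  obtain ⟨W, hW1, hW2⟩ := RowsSol.exists_latticeSol (N := N) (M := 1)
    (w := fun x y => if y = 0 then reflectRow u₂ x else reflectRow v₂ x) hα hN zero_le_one (by
      refine ⟨fun x y _ _ => ?_, fun x y j h1 h2 hy hyj => ?_⟩
      · show (if y = 0 then _ else _) ≠ _
        split_ifs
        · exact h6.left_ne x trivial
        · exact h6.right_ne x trivial
      · obtain rfl : y = 0 := by omega
        obtain rfl : j = 1 := by omega
        have e := pathSum_enter_row (fun x y : ℤ => if y = 0 then reflectRow u₂ x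
          else reflectRow v₂ x) 0 N x 0
        simp only [Nat.cast_zero, zero_add, add_comm 1 N] at e
        rw [pow_one, neg_one_mul, ← h6.rowEq x trivial trivial]
        simp only [Nat.cast_one, add_sub_cancel_right, zero_add]
        rw [e]
        refine Finset.sum_congr rfl fun n _ => ?_
        rw [pathSum_row]
        simp [pairTerm])
  refine ⟨W, hW1, fun i hi => ⟨?_, ?_⟩⟩
  · rw [hW2 i 0 le_rfl zero_le_one, if_pos rfl, hu i hi]
  · rw [hW2 i 1 zero_le_one le_rfl, if_neg one_ne_zero, hv i hi]

lemma LatticeSol.rowEq {W : ℤ → ℤ → ℝ} (h : LatticeSol N α W) (hN : 1 ≤ N) (y l : ℤ) :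
    RowEq N α (fun i => W i y) (fun i => W i (y + 1)) l := by
  have e := pathSum_enter_row W 0 N l y
  have e2 := h l y 1 le_rfl hN
  simp only [Nat.zero_add, Nat.cast_zero, add_zero] at e
  rw [add_comm N 1] at e2
  simp only [Nat.cast_one, add_sub_cancel_right] at e2
  rw [RowEq, ← neg_one_mul, ← pow_one (-1 : ℝ), ← e2, e]
  refine Finset.sum_congr rfl fun n _ => ?_
  rw [pathSum_row]
  simp [pairTerm]

/-- Every nowhere vanishing row has a row above it. -/
lemma exists_rowPair (hα : α ≠ 0) (hN : 1 ≤ N) (hu : ∀ i, u i ≠ 0) :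
    ∃ v, RowPairOn N α Set.univ u v := by
  obtain ⟨W, hW1, hW2⟩ := RowsSol.exists_latticeSol (N := N) (α := α) (M := 0)
    (w := fun x _ => u x) hα hN le_rfl
    ⟨fun x y _ _ => hu x, fun x y j h1 h2 hy hyj => by omega⟩
  refine ⟨fun i => W i 1, fun i _ => hu i, fun i _ => hW1.ne_zero hN hα i 1, fun l _ _ => ?_⟩
  have := hW1.rowEq hN 0 l
  simpa only [hW2 _ 0 le_rfl le_rfl, zero_add] using this

/-- The derivative of the equation of a pair of rows under a logarithmic variation. -/
lemma pathDeriv_row_pair (W a : ℤ → ℤ → ℝ) (N : ℕ) (x y : ℤ) :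
    pathDeriv W (fun x y => W x y * a x y) (N + 1) x y (x + N) (y + 1) =
      ∑ n ∈ Finset.range (N + 1), pairTerm N (fun i => W i y) (fun i => W i (y + 1)) x n *
        (∑ i ∈ Finset.range (n + 1), a (x + i) y +
          ∑ i ∈ Finset.range (N + 1 - n), a (x + n + i) (y + 1)) := by
  have top : ∀ (m : ℕ) (x b : ℤ), pathDeriv W (fun x y => W x y * a x y) m x b (x + m) b =
      (∏ i ∈ Finset.range (m + 1), W (x + i) b) * ∑ i ∈ Finset.range (m + 1), a (x + i) b := by
    intro m
    induction m with
    | zero => intro x b; simp [pathDeriv_zero]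
    | succ m ih =>
      intro x b
      have hz : ∀ (m : ℕ) (x c d : ℤ), d < b + 1 →
          pathDeriv W (fun x y => W x y * a x y) m x (b + 1) c d = 0 := by
        intro m x c d hd
        rw [← pathDeriv_swap]
        exact pathDeriv_eq_zero _ _ _ _ _ _ _ hd
      rw [pathDeriv_succ, hz _ _ _ _ (by omega), pathSum_eq_zero _ _ _ (b + 1) _ _ (by omega),
        show x + ((m + 1 : ℕ) : ℤ) = x + 1 + m by push_cast; ring, ih, pathSum_row,
        Finset.prod_range_succ' _ (m + 1), Finset.sum_range_succ' _ (m + 1)]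
      simp only [Nat.cast_add, Nat.cast_one, Nat.cast_zero, add_zero, add_assoc, add_comm (1 : ℤ)]
      ring
  have hsum : ∀ (m : ℕ) (x : ℤ), pathSum W (m + 1) x y (x + m) (y + 1) =
      ∑ n ∈ Finset.range (m + 1), pairTerm m (fun i => W i y) (fun i => W i (y + 1)) x n := by
    intro m x
    have e := pathSum_enter_row W 0 m x y
    simp only [Nat.zero_add, Nat.cast_zero, add_zero] at e
    rw [add_comm m 1, e, add_comm 1 m]
    refine Finset.sum_congr rfl fun n _ => ?_
    rw [pathSum_row]
    simp [pairTerm]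
  have hstep : ∀ (m n : ℕ) (x : ℤ), n ≤ m →
      pairTerm (m + 1) (fun i => W i y) (fun i => W i (y + 1)) x (n + 1) =
      W x y * pairTerm m (fun i => W i y) (fun i => W i (y + 1)) (x + 1) n := by
    intro m n x hn
    simp only [pairTerm]
    rw [Finset.prod_range_succ' _ (n + 1), show m + 1 + 1 - (n + 1) = m + 1 - n by omega]
    simp only [Nat.cast_add, Nat.cast_one, Nat.cast_zero, add_zero, add_assoc, add_comm (1 : ℤ)]
    ring
  induction N generalizing x with
  | zero =>
    rw [pathDeriv_succ, Nat.cast_zero, add_zero, pathDeriv_eq_zero _ _ _ _ _ _ _ (by omega),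
      pathSum_eq_zero _ _ _ _ _ _ (by omega)]
    simp [pathDeriv_zero, pathSum_zero, pairTerm]
    ring
  | succ m ih =>
    have e1 := top (m + 1) x (y + 1)
    have e2 := pathSum_row W (m + 1) x (y + 1)
    rw [pathDeriv_succ, e1, e2, show x + ((m + 1 : ℕ) : ℤ) = x + 1 + m by push_cast; ring, ih, hsum]
    refine Eq.trans ?_ (Finset.sum_range_succ' _ (m + 1)).symm
    have h0 : pairTerm (m + 1) (fun i => W i y) (fun i => W i (y + 1)) x 0 =
        W x y * ∏ i ∈ Finset.range (m + 1 + 1), W (x + i) (y + 1) := by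
      simp [pairTerm]
    have hS : ∀ n ∈ Finset.range (m + 1),
        pairTerm (m + 1) (fun i => W i y) (fun i => W i (y + 1)) x (n + 1) *
        (∑ i ∈ Finset.range (n + 1 + 1), a (x + i) y +
          ∑ i ∈ Finset.range (m + 1 + 1 - (n + 1)), a (x + (n + 1 : ℕ) + i) (y + 1)) =
        W x y * (pairTerm m (fun i => W i y) (fun i => W i (y + 1)) (x + 1) n *
          (∑ i ∈ Finset.range (n + 1), a (x + 1 + i) y +
          ∑ i ∈ Finset.range (m + 1 - n), a (x + 1 + n + i) (y + 1))) +
        W x y * a x y * pairTerm m (fun i => W i y) (fun i => W i (y + 1)) (x + 1) n := by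
      intro n hn
      rw [Finset.mem_range] at hn
      rw [hstep m n x (by omega), Finset.sum_range_succ' _ (n + 1),
        show m + 1 + 1 - (n + 1) = m + 1 - n by omega]
      simp only [Nat.cast_add, Nat.cast_one, Nat.cast_zero, add_zero, add_assoc, add_comm (1 : ℤ)]
      ring
    rw [Finset.sum_congr rfl hS, Finset.sum_add_distrib, ← Finset.mul_sum, ← Finset.mul_sum, h0]
    simp
    ring

end RowPairs

open Filter Topology

/-! ### Differentiation along curves of rows -/

/-- `L` is the derivative of `K` at `x` along all curves of rows through `x` whose coordinates are
differentiable. The space `ℤ → ℝ` of rows carries no norm; since the functions that occur depend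
locally on finitely many coordinates, this notion replaces the Fréchet derivative. -/
def HasCurveDeriv (K : (ℤ → ℝ) → ℝ) (L : (ℤ → ℝ) →ₗ[ℝ] ℝ) (x : ℤ → ℝ) : Prop :=
  ∀ (c : ℝ → ℤ → ℝ) (w : ℤ → ℝ), c 0 = x → (∀ k, HasDerivAt (fun s => c s k) (w k) 0) →
    HasDerivAt (fun s => K (c s)) (L w) 0

/-- `K` is differentiable at `x` along curves of rows. -/
def CurveDiff (K : (ℤ → ℝ) → ℝ) (x : ℤ → ℝ) : Prop := ∃ L, HasCurveDeriv K L x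

/-- The partial derivative with respect to the coordinate `r`. -/
noncomputable def rowPartial (K : (ℤ → ℝ) → ℝ) (r : ℤ) (x : ℤ → ℝ) : ℝ :=
  deriv (fun t => K (Function.update x r t)) (x r)

section CurveDeriv

variable {K K' : (ℤ → ℝ) → ℝ} {L L' : (ℤ → ℝ) →ₗ[ℝ] ℝ} {x : ℤ → ℝ}

lemma tendsto_curve {c : ℝ → ℤ → ℝ} {w : ℤ → ℝ} (hc : c 0 = x)
    (hw : ∀ k, HasDerivAt (fun s => c s k) (w k) 0) : Tendsto c (𝓝 0) (𝓝 x) := by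
  rw [tendsto_pi_nhds]
  intro k
  have := (hw k).continuousAt.tendsto
  rwa [hc] at this

lemma hasCurveDeriv_const (a : ℝ) : HasCurveDeriv (fun _ => a) 0 x :=
  fun _ _ _ _ => hasDerivAt_const _ _

lemma hasCurveDeriv_apply (k : ℤ) : HasCurveDeriv (fun x => x k) (LinearMap.proj k) x :=
  fun _ _ _ hw => hw k

lemma HasCurveDeriv.mul (h : HasCurveDeriv K L x) (h' : HasCurveDeriv K' L' x) :
    HasCurveDeriv (fun y => K y * K' y) (K' x • L + K x • L') x := by
  intro c w hc hw
  subst hc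
  have := (h c w rfl hw).mul (h' c w rfl hw)
  refine HasDerivAt.congr_deriv this ?_
  simp only [LinearMap.add_apply, LinearMap.smul_apply, smul_eq_mul]
  ring

lemma HasCurveDeriv.add (h : HasCurveDeriv K L x) (h' : HasCurveDeriv K' L' x) :
    HasCurveDeriv (fun y => K y + K' y) (L + L') x :=
  fun c w hc hw => (h c w hc hw).add (h' c w hc hw)

lemma HasCurveDeriv.inv (h : HasCurveDeriv K L x) (h0 : K x ≠ 0) :
    HasCurveDeriv (fun y => (K y)⁻¹) (-((K x) ^ 2)⁻¹ • L) x := by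
  intro c w hc hw
  subst hc
  have := (h c w rfl hw).inv h0
  refine HasDerivAt.congr_deriv this ?_
  simp only [LinearMap.smul_apply, smul_eq_mul]
  ring

lemma HasCurveDeriv.comp_index (e : ℤ → ℤ) (h : HasCurveDeriv K L fun i => x (e i)) :
    HasCurveDeriv (fun y => K fun i => y (e i)) (L.comp (LinearMap.funLeft ℝ ℝ e)) x :=
  fun c w hc hw => h (fun s i => c s (e i)) (fun i => w (e i)) (by rw [hc]) fun k => hw (e k)

lemma HasCurveDeriv.congr (h : HasCurveDeriv K L x) (hK : K' =ᶠ[𝓝 x] K) :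
    HasCurveDeriv K' L x := fun c w hc hw =>
  (h c w hc hw).congr_of_eventuallyEq ((tendsto_curve hc hw).eventually hK)

lemma HasCurveDeriv.hasDerivAt_update (h : HasCurveDeriv K L x) (r : ℤ) :
    HasDerivAt (fun t => K (Function.update x r t)) (L (Pi.single r 1)) (x r) := by
  have := h (fun s => Function.update x r (x r + s)) (Pi.single r 1) (by simp) (fun k => by
    rcases eq_or_ne k r with rfl | hk
    · simpa using (hasDerivAt_id (0 : ℝ)).const_add (x k)
    · simpa [Function.update_of_ne hk, Pi.single_eq_of_ne hk] using hasDerivAt_const (0 : ℝ) (x k))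
  have h2 := HasDerivAt.comp_sub_const (x r) (x r) (f := fun s => K (Function.update x r (x r + s)))
    (by simpa using this)
  simpa using h2

lemma HasCurveDeriv.rowPartial_eq (h : HasCurveDeriv K L x) (r : ℤ) :
    rowPartial K r x = L (Pi.single r 1) := (h.hasDerivAt_update r).deriv

lemma CurveDiff.hasDerivAt_update (h : CurveDiff K x) (r : ℤ) :
    HasDerivAt (fun t => K (Function.update x r t)) (rowPartial K r x) (x r) := by
  obtain ⟨L, hL⟩ := h
  rw [hL.rowPartial_eq r]
  exact hL.hasDerivAt_update r

lemma CurveDiff.mul (h : CurveDiff K x) (h' : CurveDiff K' x) : CurveDiff (fun y => K y * K' y) x :=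
  let ⟨_, hL⟩ := h; let ⟨_, hL'⟩ := h'; ⟨_, hL.mul hL'⟩

lemma CurveDiff.add (h : CurveDiff K x) (h' : CurveDiff K' x) : CurveDiff (fun y => K y + K' y) x :=
  let ⟨_, hL⟩ := h; let ⟨_, hL'⟩ := h'; ⟨_, hL.add hL'⟩

lemma CurveDiff.inv (h : CurveDiff K x) (h0 : K x ≠ 0) : CurveDiff (fun y => (K y)⁻¹) x :=
  let ⟨_, hL⟩ := h; ⟨_, hL.inv h0⟩

lemma curveDiff_const (a : ℝ) : CurveDiff (fun _ => a) x := ⟨_, hasCurveDeriv_const a⟩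

lemma curveDiff_apply (k : ℤ) : CurveDiff (fun x => x k) x := ⟨_, hasCurveDeriv_apply k⟩

lemma CurveDiff.comp_index (e : ℤ → ℤ) (h : CurveDiff K fun i => x (e i)) :
    CurveDiff (fun y => K fun i => y (e i)) x :=
  let ⟨_, hL⟩ := h; ⟨_, hL.comp_index e⟩

lemma CurveDiff.congr (h : CurveDiff K x) (hK : K' =ᶠ[𝓝 x] K) : CurveDiff K' x :=
  let ⟨_, hL⟩ := h; ⟨_, hL.congr hK⟩

lemma curveDiff_prod {ι : Type*} (s : Finset ι) {F : ι → (ℤ → ℝ) → ℝ}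
    (h : ∀ i ∈ s, CurveDiff (F i) x) :
    CurveDiff (fun y => ∏ i ∈ s, F i y) x := by
  classical
  induction s using Finset.induction_on with
  | empty => simpa using curveDiff_const 1
  | insert i s hi ih =>
    simp only [Finset.prod_insert hi]
    exact (h i (Finset.mem_insert_self _ _)).mul
      (ih fun j hj => h j (Finset.mem_insert_of_mem hj))

lemma hasCurveDeriv_of_differentiableAt {ι : Type*} [Fintype ι] {g : (ι → ℝ) → ℝ} (φ : ι → ℤ)
    (h : DifferentiableAt ℝ g fun i => x (φ i)) :
    HasCurveDeriv (fun y => g fun i => y (φ i))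
      ((fderiv ℝ g fun i => x (φ i)).toLinearMap.comp (LinearMap.funLeft ℝ ℝ φ)) x := by
  intro c w hc hw
  subst hc
  have h1 : HasDerivAt (fun s i => c s (φ i)) (fun i => w (φ i)) 0 :=
    hasDerivAt_pi.2 fun i => hw (φ i)
  exact h.hasFDerivAt.comp_hasDerivAt 0 h1

end CurveDeriv

/-! ### The symmetry condition for pairs of rows -/

/-- `x ↦ x 0 * A x` is a smooth flow on the rows `x ∈ D`, which depends on the `x k` with `|k| ≤ N`,
and which satisfies the symmetry condition for the equation of pairs of rows. Membership in `D` may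
depend on the larger range `|k| ≤ M` of values, and the condition is stated for finite pairs of rows
that are just long enough for it to make sense. -/
structure RowSymmetry (N M : ℕ) (α : ℝ) (D : Set (ℤ → ℝ)) (A : (ℤ → ℝ) → ℝ) : Prop where
  isOpen : IsOpen D
  dense : Dense D
  mem_congr : ∀ x ∈ D, ∀ y : ℤ → ℝ, (∀ k : ℤ, |k| ≤ M → x k = y k) → y ∈ D
  dep : ∀ x ∈ D, ∀ y ∈ D, (∀ k : ℤ, |k| ≤ N → x k = y k) → A x = A y
  curveDiff : ∀ x ∈ D, CurveDiff A x
  curveDiff_partial : ∀ x ∈ D, ∀ r, CurveDiff (rowPartial A r) x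
  continuousAt_partial : ∀ x ∈ D, ∀ r, ContinuousAt (rowPartial A r) x
  rel : ∀ u v, RowPairOn N α (Set.Icc (-M) (N + M)) u v →
    (∀ k : ℤ, 0 ≤ k → k ≤ N → shiftRow k u ∈ D ∧ shiftRow k v ∈ D) →
    ∑ n ∈ Finset.range (N + 1), pairTerm N u v 0 n *
      (∑ i ∈ Finset.range (n + 1), A (shiftRow i u) +
        ∑ i ∈ Finset.range (N + 1 - n), A (shiftRow (n + i) v)) = 0

/-- The part of a row seen by a flow `G`, when the index of a stencil point in the row is given by
`φ`. -/
def rowWindow (G : Flow) (φ : Pt → ℤ) (x : ℤ → ℝ) : G.stencil → ℝ := fun q => x (φ q)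

lemma continuous_rowWindow (G : Flow) (φ : Pt → ℤ) : Continuous (rowWindow G φ) :=
  continuous_pi fun q => continuous_apply (φ q)

lemma dense_rowWindow_preimage {G : Flow} {φ : Pt → ℤ} (hφ : Set.InjOn φ G.stencil)
    {S : Set (G.stencil → ℝ)} (hS : Dense S) : Dense (rowWindow G φ ⁻¹' S) := by
  intro x
  rw [mem_closure_iff_nhds]
  intro V hV
  have hinj : Function.Injective fun q : G.stencil => φ q :=
    fun q q' h => Subtype.ext (hφ q.2 q'.2 h)
  -- a continuous section of the projection to the window, through `x`
  set g : (G.stencil → ℝ) → ℤ → ℝ := fun z => Function.extend (fun q : G.stencil => φ q) z x with hg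
  have hgc : Continuous g := by
    refine continuous_pi fun k => ?_
    by_cases hk : ∃ q : G.stencil, φ q = k
    · obtain ⟨q, rfl⟩ := hk
      simp only [hg, hinj.extend_apply]
      exact continuous_apply q
    · simp only [hg, Function.extend_apply' _ _ _ hk]
      exact continuous_const
  have hgx : g (rowWindow G φ x) = x := by
    funext k
    by_cases hk : ∃ q : G.stencil, φ q = k
    · obtain ⟨q, rfl⟩ := hk
      simp only [hg, hinj.extend_apply]
      rfl
    · simp only [hg, Function.extend_apply' _ _ _ hk]
  have hpre : g ⁻¹' V ∈ 𝓝 (rowWindow G φ x) := hgc.continuousAt.preimage_mem_nhds (by rwa [hgx])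
  obtain ⟨z, hz1, hz2⟩ := mem_closure_iff_nhds.1 (hS (rowWindow G φ x)) _ hpre
  refine ⟨g z, hz1, ?_⟩
  have : rowWindow G φ (g z) = z := by
    funext q
    exact hinj.extend_apply _ _ q
  rw [Set.mem_preimage, this]
  exact hz2

/-- A smooth flow in a lattice direction that satisfies the symmetry condition for the equation of
pairs of rows. -/
lemma rowSymmetry_of_flow {N M : ℕ} {α : ℝ} (hN : 1 ≤ N) (hα : α ≠ 0) {G : Flow} (hG : G.IsSmooth)
    {φ : Pt → ℤ} (hφ : Set.InjOn φ G.stencil) (hM : ∀ q ∈ G.stencil, |φ q| ≤ M)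
    (hdep : ∀ x ∈ G.dom, ∀ y ∈ G.dom, (∀ q : G.stencil, |φ q| ≤ N → x q = y q) →
      G.toFun x = G.toFun y)
    (hrel : ∀ W, LatticeSol N α W → (∀ k : ℤ, 0 ≤ k → k ≤ N → ∀ y : ℤ, 0 ≤ y → y ≤ 1 →
        rowWindow G φ (shiftRow k fun i => W i y) ∈ G.dom) →
      pathDeriv W (fun x y => G.toFun (rowWindow G φ (shiftRow x fun i => W i y))) (N + 1)
        0 0 N 1 = 0) :
    RowSymmetry N M α {x | rowWindow G φ x ∈ G.dom ∧ x 0 ≠ 0}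
      (fun x => G.toFun (rowWindow G φ x) * (x 0)⁻¹) := by
  have hM' : ∀ x y : ℤ → ℝ, (∀ k : ℤ, |k| ≤ M → x k = y k) → rowWindow G φ x = rowWindow G φ y :=
    fun x y h => funext fun q => h _ (hM q q.2)
  have hopen : IsOpen {x : ℤ → ℝ | rowWindow G φ x ∈ G.dom ∧ x 0 ≠ 0} :=
    (hG.isOpen_dom.preimage (continuous_rowWindow G φ)).inter
      (isOpen_ne_fun (continuous_apply 0) continuous_const)
  have hcd : ∀ {x : ℤ → ℝ}, rowWindow G φ x ∈ G.dom → ContDiffAt ℝ ∞ G.toFun (rowWindow G φ x) :=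
    fun hx => hG.contDiffOn.contDiffAt (hG.isOpen_dom.mem_nhds hx)
  have hder : ∀ x : ℤ → ℝ, rowWindow G φ x ∈ G.dom → x 0 ≠ 0 →
      HasCurveDeriv (fun x => G.toFun (rowWindow G φ x) * (x 0)⁻¹) _ x := fun x hx hx0 =>
    HasCurveDeriv.mul (hasCurveDeriv_of_differentiableAt (fun q : G.stencil => φ q)
      ((hcd hx).differentiableAt (by simp))) ((hasCurveDeriv_apply 0).inv hx0)
  have hpar : ∀ x : ℤ → ℝ, rowWindow G φ x ∈ G.dom → x 0 ≠ 0 → ∀ r,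
      rowPartial (fun x => G.toFun (rowWindow G φ x) * (x 0)⁻¹) r =ᶠ[𝓝 x] fun x =>
        (x 0)⁻¹ * fderiv ℝ G.toFun (rowWindow G φ x) (fun q => (Pi.single r 1 : ℤ → ℝ) (φ q)) +
          G.toFun (rowWindow G φ x) * ((x 0)⁻¹ * (x 0)⁻¹ * -(Pi.single r 1 : ℤ → ℝ) 0) := by
    intro x hx hx0 r
    filter_upwards [hopen.mem_nhds ⟨hx, hx0⟩] with y hy
    rw [(hder y hy.1 hy.2).rowPartial_eq r]
    simp [pow_two, LinearMap.funLeft, Function.comp_def]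
    exact Or.inl rfl
  have hfd : ∀ x : ℤ → ℝ, rowWindow G φ x ∈ G.dom → ∀ w, DifferentiableAt ℝ
      (fun z => fderiv ℝ G.toFun z w) (rowWindow G φ x) := by
    intro x hx w
    have : ContDiffAt ℝ 1 (fderiv ℝ G.toFun) (rowWindow G φ x) := (hcd hx).fderiv_right (by
      rw [one_add_one_eq_two]
      exact ENat.LEInfty.out)
    exact (this.differentiableAt one_ne_zero).clm_apply (differentiableAt_const w)
  refine ⟨hopen, ?_, ?_, ?_, ?_, ?_, ?_, ?_⟩
  · refine (dense_rowWindow_preimage hφ hG.dense_dom).inter_of_isOpen_left ?_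
      (hG.isOpen_dom.preimage (continuous_rowWindow G φ))
    exact (dense_compl_singleton (0 : ℝ)).preimage (isOpenMap_eval 0)
  · intro x hx y hxy
    refine ⟨?_, ?_⟩
    · rw [← hM' x y hxy]; exact hx.1
    · rw [← hxy 0 (by simp)]; exact hx.2
  · intro x hx y hy hxy
    show G.toFun _ * (x 0)⁻¹ = G.toFun _ * (y 0)⁻¹
    rw [hxy 0 (by simp), hdep _ hx.1 _ hy.1 fun q hq => hxy _ hq]
  · exact fun x hx => ⟨_, hder x hx.1 hx.2⟩
  · intro x hx r
    refine CurveDiff.congr ?_ (hpar x hx.1 hx.2 r)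
    have h0 : CurveDiff (fun x => (x 0)⁻¹) x := (curveDiff_apply 0).inv hx.2
    refine CurveDiff.add (h0.mul ⟨_, hasCurveDeriv_of_differentiableAt (fun q : G.stencil => φ q)
      (hfd x hx.1 _)⟩) (CurveDiff.mul ⟨_, hasCurveDeriv_of_differentiableAt
        (fun q : G.stencil => φ q) ((hcd hx.1).differentiableAt (by simp))⟩ ?_)
    exact (h0.mul h0).mul (curveDiff_const _)
  · intro x hx r
    refine ContinuousAt.congr ?_ (hpar x hx.1 hx.2 r).symm
    have h0 : ContinuousAt (fun x : ℤ → ℝ => (x 0)⁻¹) x :=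
        (continuous_apply 0).continuousAt.inv₀ hx.2
    have h1 := (continuous_rowWindow G φ).continuousAt (x := x)
    exact (h0.mul ((hfd x hx.1 _).continuousAt.comp h1)).add
      (((hcd hx.1).continuousAt.comp h1).mul ((h0.mul h0).mul continuousAt_const))
  · intro u v huv hD
    obtain ⟨W, hW, hWuv⟩ := huv.exists_latticeSol hα hN
    have hne := hW.ne_zero hN hα
    have hwin : ∀ k : ℤ, 0 ≤ k → k ≤ N → ∀ y : ℤ, 0 ≤ y → y ≤ 1 → ∀ i : ℤ, |i| ≤ M →
        W (k + i) y = (if y = 0 then u else v) (k + i) := by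
      intro k h1 h2 y h3 h4 i hi
      rw [abs_le] at hi
      have := hWuv (k + i) ⟨by omega, by omega⟩
      obtain rfl | rfl : y = 0 ∨ y = 1 := by omega
      · exact this.1
      · exact this.2
    have key := hrel W hW (fun k h1 h2 y h3 h4 => by
      rw [hM' (shiftRow k fun i => W i y) (shiftRow k (if y = 0 then u else v))
        fun i hi => hwin k h1 h2 y h3 h4 i hi]
      split_ifs
      · exact (hD k h1 h2).1.1
      · exact (hD k h1 h2).2.1)
    have e : (fun x y => G.toFun (rowWindow G φ (shiftRow x fun i => W i y))) =
        fun x y => W x y * (G.toFun (rowWindow G φ (shiftRow x fun i => W i y)) * (W x y)⁻¹) := by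
      funext x y
      have := hne x y
      field_simp
    have e2 := pathDeriv_row_pair W
      (fun x y => G.toFun (rowWindow G φ (shiftRow x fun i => W i y)) * (W x y)⁻¹) N 0 0
    rw [zero_add, zero_add, ← e, key] at e2
    rw [e2]
    have eA : ∀ k : ℤ, 0 ≤ k → k ≤ N → ∀ y : ℤ, 0 ≤ y → y ≤ 1 →
        G.toFun (rowWindow G φ (shiftRow k fun i => W i y)) * (W k y)⁻¹ =
        G.toFun (rowWindow G φ (shiftRow k (if y = 0 then u else v))) *
          (shiftRow k (if y = 0 then u else v) 0)⁻¹ := by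
      intro k h1 h2 y h3 h4
      have := hwin k h1 h2 y h3 h4 0 (by simp)
      rw [add_zero] at this
      rw [hM' (shiftRow k fun i => W i y) (shiftRow k (if y = 0 then u else v))
        fun i hi => hwin k h1 h2 y h3 h4 i hi, this,
        shiftRow_apply, add_zero]
    refine Finset.sum_congr rfl fun n hn => ?_
    rw [Finset.mem_range] at hn
    congr 1
    · refine pairTerm_congr (by omega) (fun i h1 h2 => ?_) fun i h1 h2 => ?_
      · exact (hWuv i ⟨by omega, by omega⟩).1.symm
      · exact (hWuv i ⟨by omega, by omega⟩).2.symm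
    · congr 1
      · refine Finset.sum_congr rfl fun i hi => ?_
        rw [Finset.mem_range] at hi
        rw [zero_add, eA i (by omega) (by omega) 0 le_rfl zero_le_one, if_pos rfl]
      · refine Finset.sum_congr rfl fun i hi => ?_
        rw [Finset.mem_range] at hi
        rw [zero_add, eA (n + i) (by omega) (by omega) 1 zero_le_one le_rfl, if_neg one_ne_zero]

/-! ### Local dependence on coordinates -/

/-- Near each point of `D`, the function `K` depends on the coordinates in `S` only. -/
def LocDep (D : Set (ℤ → ℝ)) (S : Set ℤ) (K : (ℤ → ℝ) → ℝ) : Prop :=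
  ∀ x ∈ D, ∃ V ∈ 𝓝 x, ∀ y ∈ V, ∀ z ∈ V, (∀ k ∈ S, y k = z k) → K y = K z

section LocDep

variable {D : Set (ℤ → ℝ)} {S : Set ℤ} {K : (ℤ → ℝ) → ℝ}

lemma LocDep.mono {T : Set ℤ} (h : LocDep D S K) (hST : ∀ k ∈ S, k ∈ T) : LocDep D T K :=
  fun x hx => let ⟨V, hV, hK⟩ := h x hx
    ⟨V, hV, fun y hy z hz hyz => hK y hy z hz fun k hk => hyz k (hST k hk)⟩

/-- A coordinate with vanishing partial derivative may be dropped. -/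
lemma LocDep.erase (hD : IsOpen D) (h : LocDep D S K) (hK : ∀ x ∈ D, CurveDiff K x) {r : ℤ}
    (hr : ∀ x ∈ D, rowPartial K r x = 0) : LocDep D (S \ {r}) K := by
  intro x hx
  obtain ⟨V, hV, hVK⟩ := h x hx
  have hcont : Tendsto (fun p : (ℤ → ℝ) × ℝ => Function.update p.1 r p.2) (𝓝 (x, x r)) (𝓝 x) := by
    have : Continuous fun p : (ℤ → ℝ) × ℝ => Function.update p.1 r p.2 :=
      continuous_fst.update r continuous_snd
    have h2 := this.tendsto (x, x r)
    rwa [Function.update_eq_self] at h2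
  have hmem := hcont (inter_mem hV (hD.mem_nhds hx))
  rw [mem_map, nhds_prod_eq, mem_prod_iff] at hmem
  obtain ⟨U, hU, B, hB, hUB⟩ := hmem
  obtain ⟨ε, hε, hball⟩ := Metric.mem_nhds_iff.1 hB
  refine ⟨U ∩ {y | y r ∈ Metric.ball (x r) ε}, inter_mem hU
    ((continuous_apply r).continuousAt.preimage_mem_nhds (Metric.ball_mem_nhds _ hε)), ?_⟩
  have hin : ∀ y ∈ U, ∀ t ∈ Metric.ball (x r) ε, Function.update y r t ∈ V ∩ D :=
    fun y hy t ht => hUB (Set.mk_mem_prod hy (hball ht))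
  rintro y ⟨hyU, hyb⟩ z ⟨hzU, hzb⟩ hyz
  have hder : ∀ t ∈ Metric.ball (x r) ε,
      HasDerivWithinAt (fun t => K (Function.update y r t)) 0 (Metric.ball (x r) ε) t := by
    intro t ht
    have hD' := (hin y hyU t ht).2
    have := (hK _ hD').hasDerivAt_update r
    simp only [Function.update_idem, Function.update_self, hr _ hD'] at this
    exact this.hasDerivWithinAt
  have hconst := (convex_ball (x r) ε).norm_image_sub_le_of_norm_hasDerivWithin_le hder
    (C := 0) (fun t _ => by simp) hyb hzb
  rw [zero_mul, norm_le_zero_iff, sub_eq_zero, Function.update_eq_self] at hconst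
  rw [← hconst]
  refine hVK _ (hin y hyU _ hzb).1 _ ?_ fun k hk => ?_
  · have := (hin z hzU _ hzb).1
    rwa [Function.update_eq_self] at this
  · rcases eq_or_ne k r with rfl | hkr
    · rw [Function.update_self]
    · rw [Function.update_of_ne hkr, hyz k ⟨hk, hkr⟩]

lemma LocDep.rowPartial (h : LocDep D S K) {r : ℤ} (hr : r ∈ S) : LocDep D S (rowPartial K r) := by
  intro x hx
  obtain ⟨V, hV, hVK⟩ := h x hx
  refine ⟨interior V, isOpen_interior.mem_nhds (mem_interior_iff_mem_nhds.2 hV), ?_⟩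
  intro y hy z hz hyz
  have hev : ∀ y ∈ interior V, ∀ᶠ t in 𝓝 (y r), Function.update y r t ∈ V := by
    intro y hy
    have : Continuous fun t : ℝ => Function.update y r t := continuous_const.update r continuous_id
    refine this.continuousAt.eventually_mem ?_
    rw [Function.update_eq_self]
    exact mem_interior_iff_mem_nhds.1 hy
  rw [LatticePathSystem.rowPartial, LatticePathSystem.rowPartial, hyz r hr]
  refine Filter.EventuallyEq.deriv_eq ?_
  have h1 := hev y hy
  rw [hyz r hr] at h1
  filter_upwards [h1, hev z hz] with t ht1 ht2
  refine hVK _ ht1 _ ht2 fun k hk => ?_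
  rcases eq_or_ne k r with rfl | hkr
  · simp
  · simp [Function.update_of_ne hkr, hyz k hk]

end LocDep

/-! ### Charts for pairs of rows -/

section Chart

variable {N : ℕ} {α : ℝ} {u v : ℤ → ℝ} {a b : ℤ}

lemma continuousAt_pairHead {l : ℤ} (p : (ℤ → ℝ) × (ℤ → ℝ)) :
    ContinuousAt (fun p : (ℤ → ℝ) × (ℤ → ℝ) => pairHead N p.1 p.2 l) p := by
  unfold pairHead
  fun_prop

/-- The equations solved for the values of the lower row to the right of the index `m + N`. -/
lemma RowPairOn.exists_chart_right (h : RowPairOn N α (Set.Icc a b) u v) {m : ℤ} (ham : a ≤ m)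
    (k : ℕ) (hk : m + N - 1 + k ≤ b) :
    ∃ s : (ℤ → ℝ) × (ℤ → ℝ) → (ℤ → ℝ) × (ℤ → ℝ), ContinuousAt s (u, v) ∧ s (u, v) = (u, v) ∧
      (∀ (p) (i : ℤ), i < m + N ∨ m + N - 1 + k < i → (s p).1 i = p.1 i) ∧ (∀ p, (s p).2 = p.2) ∧
      ∀ᶠ p in 𝓝 (u, v), ∀ l, m ≤ l → l < m + k → RowEq N α (s p).1 (s p).2 l := by
  induction k with
  | zero =>
    exact ⟨fun p => p, continuousAt_id, rfl, fun _ _ _ => rfl, fun _ => rfl,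
      Eventually.of_forall fun p l h1 h2 => absurd h2 (by simpa using h1)⟩
  | succ k ih =>
    push_cast at hk
    obtain ⟨s, h1, h2, h3, h4, h5⟩ := ih (by omega)
    set l₀ : ℤ := m + k with hl₀
    set f : (ℤ → ℝ) × (ℤ → ℝ) → ℝ := fun p => (-α / p.2 (l₀ + N) - pairHead N p.1 p.2 l₀) /
      ∏ i ∈ Finset.range N, p.1 (l₀ + i) with hf
    have hv0 : v (l₀ + N) ≠ 0 := h.right_ne _ ⟨by omega, by omega⟩
    have hu0 : ∏ i ∈ Finset.range N, u (l₀ + i) ≠ 0 :=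
      prod_row_ne_zero fun i _ _ => h.left_ne _ ⟨by omega, by omega⟩
    have c1 : ContinuousAt (fun p : (ℤ → ℝ) × (ℤ → ℝ) => p.2 (l₀ + N)) (u, v) := by fun_prop
    have c2 : ContinuousAt (fun p : (ℤ → ℝ) × (ℤ → ℝ) => ∏ i ∈ Finset.range N, p.1 (l₀ + i))
        (u, v) := by fun_prop
    have hfc : ContinuousAt f (u, v) :=
      ((continuousAt_const.div c1 hv0).sub (continuousAt_pairHead _)).div c2 hu0
    have hs : Tendsto s (𝓝 (u, v)) (𝓝 (u, v)) := by
      have := h1.tendsto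
      rwa [h2] at this
    have hfuv : f (u, v) = u (l₀ + N) := by
      have := rowEq_iff.1 (h.rowEq l₀ ⟨by omega, by omega⟩ ⟨by omega, by omega⟩)
      simp only [hf]
      rw [div_eq_iff hu0, ← this, mul_div_cancel_right₀ _ hv0]
      ring
    refine ⟨fun p => (Function.update (s p).1 (l₀ + N) (f (s p)), (s p).2), ?_, ?_, ?_, h4, ?_⟩
    · have hfs : ContinuousAt (fun p => f (s p)) (u, v) := by
        have h6 : ContinuousAt f (s (u, v)) := by rwa [h2]
        exact h6.comp h1
      exact (ContinuousAt.update h1.fst _ hfs).prodMk h1.snd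
    · simp only [h2, hfuv, Function.update_eq_self]
    · intro p i hi
      push_cast at hi
      show Function.update (s p).1 (l₀ + N) (f (s p)) i = p.1 i
      rw [Function.update_of_ne (by omega), h3 p i (by omega)]
    · filter_upwards [h5, hs.eventually (c1.eventually_ne hv0),
        hs.eventually (c2.eventually_ne hu0)]
        with p hp hp1 hp2 l hl1 hl2
      push_cast at hl2
      rcases (show l < l₀ ∨ l = l₀ by omega) with hl | rfl
      · refine (hp l hl1 hl).congr (fun i _ hi => ?_) fun i _ _ => rfl
        rw [Function.update_of_ne (by omega)]
      · rw [rowEq_iff, pairHead_congr (u' := (s p).1) (v' := (s p).2)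
          (fun i _ hi => Function.update_of_ne (by omega) _ _) (fun i _ _ => rfl),
          prod_congr_row (u' := (s p).1) (fun i _ hi => Function.update_of_ne (by omega) _ _),
          Function.update_self]
        simp only [hf]
        rw [mul_div_cancel₀ _ hp2, add_sub_cancel, div_mul_cancel₀ _ hp1]

/-- Near a pair of rows, the pairs of rows are parametrized by the values of the lower row at the
indices `< m + N` and those of the upper row at the indices `≥ m`. -/
lemma RowPairOn.exists_chart (h : RowPairOn N α (Set.Icc a b) u v) {m : ℤ} (ham : a ≤ m)
    (hmb : m + N - 1 ≤ b) :
    ∃ s : (ℤ → ℝ) × (ℤ → ℝ) → (ℤ → ℝ) × (ℤ → ℝ), ContinuousAt s (u, v) ∧ s (u, v) = (u, v) ∧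
      (∀ p i, i < m + N ∨ b < i → (s p).1 i = p.1 i) ∧
      (∀ p i, m ≤ i ∨ i < a → (s p).2 i = p.2 i) ∧
      ∀ᶠ p in 𝓝 (u, v), RowPairOn N α (Set.Icc a b) (s p).1 (s p).2 := by
  obtain ⟨s, h1, h2, h3, h4, h5⟩ := h.exists_chart_right ham (b - (m + N - 1)).toNat (by omega)
  have h' : RowPairOn N α (Set.Icc (-b) (-a)) (reflectRow v) (reflectRow u) :=
    h.reflect.mono fun i hi => ⟨by have := hi.2; omega, by have := hi.1; omega⟩
  obtain ⟨t, t1, t2, t3, t4, t5⟩ := h'.exists_chart_right (m := 1 - m - N) (by omega)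
    (m - a).toNat (by omega)
  -- exchanges and reflects the rows
  set ρ : (ℤ → ℝ) × (ℤ → ℝ) → (ℤ → ℝ) × (ℤ → ℝ) := fun p => (reflectRow p.2, reflectRow p.1) with hρ
  have hρc : Continuous ρ := by
    unfold ρ reflectRow
    fun_prop
  have hsc : Tendsto s (𝓝 (u, v)) (𝓝 (u, v)) := by
    have := h1.tendsto
    rwa [h2] at this
  have hs' : Tendsto (fun p => ρ (s p)) (𝓝 (u, v)) (𝓝 (reflectRow v, reflectRow u)) :=
    (hρc.tendsto (u, v)).comp hsc
  have hρv : ρ (reflectRow v, reflectRow u) = (u, v) := by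
    simp only [hρ, reflectRow_reflectRow]
  have hτ : Tendsto (fun p => ρ (t (ρ (s p)))) (𝓝 (u, v)) (𝓝 (u, v)) := by
    have e1 := t1.tendsto
    rw [t2] at e1
    have e2 := hρc.tendsto (reflectRow v, reflectRow u)
    rw [hρv] at e2
    exact e2.comp (e1.comp hs')
  have hfix : ρ (t (ρ (s (u, v)))) = (u, v) := by
    rw [h2]
    have : ρ (u, v) = (reflectRow v, reflectRow u) := rfl
    rw [this, t2, hρv]
  have keepu : ∀ p, (ρ (t (ρ (s p)))).1 = (s p).1 := by
    intro p
    show reflectRow (t (ρ (s p))).2 = _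
    rw [t4]
    exact reflectRow_reflectRow _
  have keepv : ∀ p i, m ≤ i ∨ i < a → (ρ (t (ρ (s p)))).2 i = (s p).2 i := by
    intro p i hi
    show (t (ρ (s p))).1 (-i) = _
    rw [t3 _ _ (by omega)]
    show (s p).2 (- -i) = _
    rw [neg_neg]
  refine ⟨fun p => ρ (t (ρ (s p))), ?_, hfix, fun p i hi => ?_, fun p i hi => ?_, ?_⟩
  · rw [ContinuousAt, hfix]; exact hτ
  · rw [keepu, h3 p i (by omega)]
  · rw [keepv p i hi, h4]
  · have hne : ∀ᶠ p in 𝓝 (u, v), ∀ i ∈ Set.Icc a b, p.1 i ≠ 0 ∧ p.2 i ≠ 0 := by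
      rw [eventually_all_finite (Set.finite_Icc a b)]
      intro i hi
      have c1 : ContinuousAt (fun p : (ℤ → ℝ) × (ℤ → ℝ) => p.1 i) (u, v) := by fun_prop
      have c2 : ContinuousAt (fun p : (ℤ → ℝ) × (ℤ → ℝ) => p.2 i) (u, v) := by fun_prop
      exact (c1.eventually_ne (h.left_ne i hi)).and (c2.eventually_ne (h.right_ne i hi))
    filter_upwards [h5, hs'.eventually t5, hτ.eventually hne] with p hp1 hp2 hp3
    refine ⟨fun i hi => (hp3 i hi).1, fun i hi => (hp3 i hi).2, fun l hl hlN => ?_⟩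
    have hl1 := hl.1
    have hl2 := hlN.2
    by_cases hlm : m ≤ l
    · refine (hp1 l hlm (by omega)).congr (fun i _ _ => ?_) fun i hi _ => ?_
      · rw [keepu]
      · exact (keepv p i (Or.inl (by omega))).symm
    · have := hp2 (-(l + N)) (by omega) (by omega)
      have e := (rowEq_reflect (N := N) (α := α) (u := (ρ (t (ρ (s p)))).1)
        (v := (ρ (t (ρ (s p)))).2) (l := -(l + N))).1 (by
          simpa only [hρ, reflectRow_reflectRow] using this)
      rwa [neg_add, neg_neg, add_neg_cancel_right] at e

end Chart

/-! ### Generic pairs of rows -/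

/-- A pair of rows on the window `[-K, K]` such that the translates of both rows by at most `K`
belong to `D`. -/
structure GoodPair (D : Set (ℤ → ℝ)) (N : ℕ) (α : ℝ) (K : ℤ) (u v : ℤ → ℝ) : Prop where
  pair : RowPairOn N α (Set.Icc (-K) K) u v
  left_mem : ∀ k, |k| ≤ K → shiftRow k u ∈ D
  right_mem : ∀ k, |k| ≤ K → shiftRow k v ∈ D

lemma continuous_shiftRow (k : ℤ) : Continuous (shiftRow k) :=
  continuous_pi fun i => continuous_apply (k + i)

lemma continuous_reflectRow : Continuous reflectRow :=
  continuous_pi fun i => continuous_apply (-i)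

lemma isOpenMap_shiftRow (k : ℤ) : IsOpenMap (shiftRow k) :=
  Homeomorph.isOpenMap
    { toFun := shiftRow k
      invFun := shiftRow (-k)
      left_inv := fun x => by rw [shiftRow_shiftRow, add_neg_cancel, shiftRow_zero]
      right_inv := fun x => by rw [shiftRow_shiftRow, neg_add_cancel, shiftRow_zero]
      continuous_toFun := continuous_shiftRow k
      continuous_invFun := continuous_shiftRow (-k) }

lemma isOpenMap_reflectRow : IsOpenMap reflectRow :=
  Homeomorph.isOpenMap
    { toFun := reflectRow
      invFun := reflectRow
      left_inv := reflectRow_reflectRow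
      right_inv := reflectRow_reflectRow
      continuous_toFun := continuous_reflectRow
      continuous_invFun := continuous_reflectRow }

section GoodPairs

variable {N M : ℕ} {α : ℝ} {D : Set (ℤ → ℝ)} {A : (ℤ → ℝ) → ℝ} {K : ℤ} {u v : ℤ → ℝ}

lemma isOpen_goodRows (hD : IsOpen D) (K : ℤ) :
    IsOpen {x : ℤ → ℝ | ∀ k, |k| ≤ K → shiftRow k x ∈ D} := by
  have : {x : ℤ → ℝ | ∀ k, |k| ≤ K → shiftRow k x ∈ D} =
      ⋂ k ∈ Set.Icc (-K) K, shiftRow k ⁻¹' D := by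
    ext x; simp [abs_le]
  rw [this]
  exact (Set.finite_Icc _ _).isOpen_biInter fun k _ => hD.preimage (continuous_shiftRow k)

lemma dense_goodRows (hD : IsOpen D) (hD' : Dense D) (K : ℤ) :
    Dense {x : ℤ → ℝ | ∀ k, |k| ≤ K → shiftRow k x ∈ D} := by
  have key : ∀ s : Finset ℤ, IsOpen (⋂ k ∈ s, shiftRow k ⁻¹' D) ∧
      Dense (⋂ k ∈ s, shiftRow k ⁻¹' D) := by
    intro s
    induction s using Finset.induction_on with
    | empty => simp [dense_univ]
    | insert k s _ ih =>
      rw [Finset.set_biInter_insert]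
      have h1 := hD.preimage (continuous_shiftRow k)
      exact ⟨h1.inter ih.1, (hD'.preimage (isOpenMap_shiftRow k)).inter_of_isOpen_left ih.2 h1⟩
  have : {x : ℤ → ℝ | ∀ k, |k| ≤ K → shiftRow k x ∈ D} =
      ⋂ k ∈ Finset.Icc (-K) K, shiftRow k ⁻¹' D := by
    ext x; simp [abs_le]
  rw [this]
  exact (key _).2

lemma GoodPair.reflect (g : GoodPair D N α K u v) :
    GoodPair (reflectRow ⁻¹' D) N α K (reflectRow v) (reflectRow u) where
  pair := g.pair.reflect.mono fun i hi => ⟨by have := hi.2; omega, by have := hi.1; omega⟩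
  left_mem k hk := by
    have := g.right_mem (-k) (by rwa [abs_neg])
    rw [Set.mem_preimage]
    convert this using 1
    funext i
    simp [add_comm]
  right_mem k hk := by
    have := g.left_mem (-k) (by rwa [abs_neg])
    rw [Set.mem_preimage]
    convert this using 1
    funext i
    simp [add_comm]

lemma GoodPair.exists_chart (hD : IsOpen D) (g : GoodPair D N α K u v) {m : ℤ} (h1 : -K ≤ m)
    (h2 : m + N - 1 ≤ K) :
    ∃ s : (ℤ → ℝ) × (ℤ → ℝ) → (ℤ → ℝ) × (ℤ → ℝ), ContinuousAt s (u, v) ∧ s (u, v) = (u, v) ∧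
      (∀ p i, i < m + N ∨ K < i → (s p).1 i = p.1 i) ∧
      (∀ p i, m ≤ i ∨ i < -K → (s p).2 i = p.2 i) ∧
      ∀ᶠ p in 𝓝 (u, v), GoodPair D N α K (s p).1 (s p).2 := by
  obtain ⟨s, s1, s2, s3, s4, s5⟩ := g.pair.exists_chart h1 h2
  refine ⟨s, s1, s2, s3, s4, ?_⟩
  have hs : Tendsto s (𝓝 (u, v)) (𝓝 (u, v)) := by
    have := s1.tendsto
    rwa [s2] at this
  have e1 := (continuous_fst.tendsto (u, v)).comp hs
  have e2 := (continuous_snd.tendsto (u, v)).comp hs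
  filter_upwards [s5, e1.eventually ((isOpen_goodRows hD K).mem_nhds g.left_mem),
    e2.eventually ((isOpen_goodRows hD K).mem_nhds g.right_mem)] with p hp1 hp2 hp3
  exact ⟨hp1, hp2, hp3⟩

/-- Varying one value of the upper row changes the lower row from this index on only. -/
lemma GoodPair.exists_right_variation (hD : IsOpen D) (g : GoodPair D N α K u v) {m : ℤ}
    (h1 : -K ≤ m) (h2 : m + N ≤ K) :
    ∃ U : ℝ → ℤ → ℝ, ContinuousAt U (v (m + N)) ∧ U (v (m + N)) = u ∧
      (∀ t, ∀ i < m + N, U t i = u i) ∧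
      (∀ᶠ t in 𝓝 (v (m + N)), GoodPair D N α K (U t) (Function.update v (m + N) t)) ∧
      HasDerivAt (fun t => U t (m + N))
        (α / (v (m + N) ^ 2 * ∏ i ∈ Finset.range N, u (m + i))) (v (m + N)) := by
  obtain ⟨s, s1, s2, s3, s4, s5⟩ := g.pair.exists_chart_right h1 (K - (m + N - 1)).toNat (by omega)
  set t₀ := v (m + N) with ht₀
  set V : ℝ → ℤ → ℝ := fun t => Function.update v (m + N) t with hV
  have hVc : Continuous V := continuous_const.update _ continuous_id
  have hVt : V t₀ = v := Function.update_eq_self _ _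
  have hc : ContinuousAt (fun t => (u, V t)) t₀ :=
    (continuous_const.prodMk hVc).continuousAt
  have ht : Tendsto (fun t => (u, V t)) (𝓝 t₀) (𝓝 (u, v)) := by
    have := hc.tendsto
    rwa [hVt] at this
  have hs : Tendsto (fun t => s (u, V t)) (𝓝 t₀) (𝓝 (u, v)) := by
    have := s1.tendsto
    rw [s2] at this
    exact this.comp ht
  have hUt : Tendsto (fun t => (s (u, V t)).1) (𝓝 t₀) (𝓝 u) :=
    (continuous_fst.tendsto (u, v)).comp hs
  have hVt' : Tendsto V (𝓝 t₀) (𝓝 v) := by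
    have := hVc.tendsto t₀
    rwa [hVt] at this
  have hu : ∀ t, ∀ i < m + N, (s (u, V t)).1 i = u i := fun t i hi => s3 _ i (Or.inl hi)
  have hVi : ∀ t i, i ≠ m + N → V t i = v i := fun t i hi => Function.update_of_ne hi _ _
  have hne : ∀ᶠ p in 𝓝 (u, v), ∀ i ∈ Set.Icc (-K) K, p.1 i ≠ 0 ∧ p.2 i ≠ 0 := by
    rw [eventually_all_finite (Set.finite_Icc (-K) K)]
    intro i hi
    have c1 : ContinuousAt (fun p : (ℤ → ℝ) × (ℤ → ℝ) => p.1 i) (u, v) := by fun_prop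
    have c2 : ContinuousAt (fun p : (ℤ → ℝ) × (ℤ → ℝ) => p.2 i) (u, v) := by fun_prop
    exact (c1.eventually_ne (g.pair.left_ne i hi)).and (c2.eventually_ne (g.pair.right_ne i hi))
  have hgood : ∀ᶠ t in 𝓝 t₀, GoodPair D N α K (s (u, V t)).1 (V t) := by
    filter_upwards [ht.eventually s5, hs.eventually hne,
      hUt.eventually ((isOpen_goodRows hD K).mem_nhds g.left_mem),
      hVt'.eventually ((isOpen_goodRows hD K).mem_nhds g.right_mem)] with t ht1 ht2 ht3 ht4
    simp only [s4] at ht1 ht2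
    refine ⟨⟨fun i hi => (ht2 i hi).1, fun i hi => (ht2 i hi).2, fun l hl hlN => ?_⟩, ht3, ht4⟩
    have hl2 := hlN.2
    by_cases hlm : m ≤ l
    · exact ht1 l hlm (by omega)
    · exact (g.pair.rowEq l hl hlN).congr (fun i _ hi => (hu t i (by omega)).symm)
        fun i _ hi => (hVi t i (by omega)).symm
  refine ⟨fun t => (s (u, V t)).1, ?_, ?_, hu, hgood, ?_⟩
  · show Tendsto _ _ (𝓝 (s (u, V t₀)).1)
    rwa [hVt, s2]
  · show (s (u, V t₀)).1 = u
    rw [hVt, s2]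
  · have hv0 : t₀ ≠ 0 := g.pair.right_ne _ ⟨by omega, h2⟩
    have hu0 : ∏ i ∈ Finset.range N, u (m + i) ≠ 0 :=
      prod_row_ne_zero fun i _ _ => g.pair.left_ne _ ⟨by omega, by omega⟩
    have hd : HasDerivAt (fun t => (-α * t⁻¹ - pairHead N u v m) / ∏ i ∈ Finset.range N, u (m + i))
        (-α * -(t₀ ^ 2)⁻¹ / ∏ i ∈ Finset.range N, u (m + i)) t₀ :=
      (((hasDerivAt_inv hv0).const_mul (-α)).sub_const _).div_const _
    refine HasDerivAt.congr_deriv (hd.congr_of_eventuallyEq ?_) ?_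
    · filter_upwards [hgood, eventually_ne_nhds hv0] with t hg ht0
      have e := rowEq_iff.1 (hg.pair.rowEq m ⟨h1, by omega⟩ ⟨by omega, h2⟩)
      rw [pairHead_congr (u' := u) (v' := v) (fun i _ hi => hu t i hi)
        (fun i _ hi => hVi t i (by omega)), prod_congr_row (u' := u) (fun i _ hi => hu t i hi),
        show V t (m + N) = t from Function.update_self _ _ _] at e
      rw [eq_div_iff hu0, ← e]
      field_simp
      ring
    · field_simp

/-- Good pairs of rows are dense among the pairs of rows. -/
lemma RowPairOn.exists_goodPair (hD : IsOpen D) (hD' : Dense D) (hK : (N : ℤ) ≤ 2 * K + 1)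
    (h : RowPairOn N α (Set.Icc (-K) K) u v) {V : Set ((ℤ → ℝ) × (ℤ → ℝ))} (hV : V ∈ 𝓝 (u, v)) :
    ∃ u' v', GoodPair D N α K u' v' ∧ (u', v') ∈ V := by
  -- the first perturbation moves the lower row into general position
  obtain ⟨s, s1, s2, s3, s4, s5⟩ := h.exists_chart (m := K - N + 1) (by omega) (by omega)
  have hs : Tendsto s (𝓝 (u, v)) (𝓝 (u, v)) := by
    have := s1.tendsto
    rwa [s2] at this
  have hc : Tendsto (fun x : ℤ → ℝ => (x, v)) (𝓝 u) (𝓝 (u, v)) :=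
    (continuous_id.prodMk continuous_const).tendsto u
  have e1 := hc.eventually (s5.and (hs.eventually (interior_mem_nhds.2 hV)))
  obtain ⟨x, ⟨hx1, hx2⟩, hx3⟩ := mem_closure_iff_nhds.1 (dense_goodRows hD hD' K u) _ e1
  have hsx : (s (x, v)).1 = x := funext fun i => s3 _ i (by omega)
  set w := (s (x, v)).2 with hw
  have hsx2 : s (x, v) = (x, w) := Prod.ext hsx rfl
  rw [hsx2] at hx1 hx2
  -- the second one the upper row
  obtain ⟨t, t1, t2, t3, t4, t5⟩ := hx1.exists_chart (m := -K) le_rfl (by omega)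
  have ht : Tendsto t (𝓝 (x, w)) (𝓝 (x, w)) := by
    have := t1.tendsto
    rwa [t2] at this
  have hc' : Tendsto (fun y : ℤ → ℝ => (x, y)) (𝓝 w) (𝓝 (x, w)) :=
    (continuous_const.prodMk continuous_id).tendsto w
  have ht1 := (continuous_fst.tendsto (x, w)).comp ht
  have e2 := hc'.eventually (t5.and ((ht.eventually (mem_interior_iff_mem_nhds.1 hx2)).and
    (ht1.eventually ((isOpen_goodRows hD K).mem_nhds hx3))))
  obtain ⟨y, ⟨hy1, hy2, hy3⟩, hy4⟩ := mem_closure_iff_nhds.1 (dense_goodRows hD hD' K w) _ e2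
  have hty : (t (x, y)).2 = y := funext fun i => t4 _ i (by omega)
  refine ⟨(t (x, y)).1, (t (x, y)).2, ⟨hy1, hy3, ?_⟩, hy2⟩
  rw [hty]
  exact hy4

lemma exists_ne_zero_near (x : ℤ → ℝ) {V : Set (ℤ → ℝ)} (hV : V ∈ 𝓝 x) :
    ∃ y ∈ V, ∀ i, y i ≠ 0 := by
  set c : ℝ → ℤ → ℝ := fun t i => if x i = 0 then t else x i with hc
  have hcc : Continuous c := continuous_pi fun i => by
    by_cases h : x i = 0
    · simpa [hc, h] using continuous_id'
    · simpa [hc, h] using continuous_const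
  have hc0 : c 0 = x := by
    funext i
    by_cases h : x i = 0 <;> simp [hc, h]
  have h1 : ∀ᶠ t in 𝓝[≠] (0 : ℝ), c t ∈ V := by
    refine Filter.Eventually.filter_mono nhdsWithin_le_nhds ?_
    refine hcc.continuousAt.eventually_mem ?_
    rwa [hc0]
  obtain ⟨t, ht1, ht2⟩ := (h1.and self_mem_nhdsWithin).exists
  refine ⟨c t, ht1, fun i => ?_⟩
  by_cases h : x i = 0
  · simpa [hc, h] using ht2
  · simp [hc, h]

/-- Every open set of rows contains the lower row of a good pair. -/
lemma exists_goodPair_left (hα : α ≠ 0) (hN : 1 ≤ N) (hD : IsOpen D) (hD' : Dense D)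
    (hK : (N : ℤ) ≤ 2 * K + 1) (x : ℤ → ℝ) {V : Set (ℤ → ℝ)} (hV : V ∈ 𝓝 x) :
    ∃ u v, GoodPair D N α K u v ∧ u ∈ V := by
  obtain ⟨y, hy1, hy2⟩ := exists_ne_zero_near x (interior_mem_nhds.2 hV)
  obtain ⟨w, hw⟩ := exists_rowPair hα hN hy2
  obtain ⟨u, v, h1, h2⟩ := (hw.mono (Set.subset_univ (Set.Icc (-K) K))).exists_goodPair hD hD' hK
    ((continuous_fst.tendsto (y, w)) (mem_interior_iff_mem_nhds.1 hy1))
  exact ⟨u, v, h1, h2⟩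

/-- Every open set of rows contains a row that belongs to two good pairs, with a row below it and a
row above it. -/
lemma exists_goodPair_middle (hα : α ≠ 0) (hN : 1 ≤ N) (hD : IsOpen D) (hD' : Dense D)
    (hK : (N : ℤ) ≤ 2 * K + 1) (x : ℤ → ℝ) {V : Set (ℤ → ℝ)} (hV : V ∈ 𝓝 x) :
    ∃ y z v, GoodPair D N α K y z ∧ GoodPair D N α K z v ∧ z ∈ V := by
  obtain ⟨x₁, v₁, h1, h2⟩ := exists_goodPair_left hα hN hD hD' hK x (interior_mem_nhds.2 hV)
  obtain ⟨s, s1, s2, s3, s4, s5⟩ := h1.exists_chart hD (m := K - N + 1) (by omega) (by omega)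
  have hc : Tendsto (fun x : ℤ → ℝ => (x, v₁)) (𝓝 x₁) (𝓝 (x₁, v₁)) :=
    (continuous_id.prodMk continuous_const).tendsto x₁
  have e1 := (hc.eventually s5).and (mem_interior_iff_mem_nhds.1 h2)
  -- a row below a perturbation of the first row, found by reflection
  obtain ⟨x₂, hx₂, hx₂0⟩ := exists_ne_zero_near x₁ (eventually_eventually_nhds.2 e1)
  obtain ⟨w, hw⟩ := exists_rowPair (α := α) hα hN (u := reflectRow x₂) fun i => hx₂0 _
  have hw' : RowPairOn N α (Set.Icc (-K) K) (reflectRow w) x₂ := by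
    have := hw.reflect
    rw [reflectRow_reflectRow] at this
    exact this.mono fun _ _ => trivial
  obtain ⟨y, z, h3, h4⟩ := hw'.exists_goodPair hD hD' hK
    ((continuous_snd.tendsto (reflectRow w, x₂)) hx₂)
  have h5 : GoodPair D N α K (s (z, v₁)).1 (s (z, v₁)).2 ∧ z ∈ V := h4
  have hz : (s (z, v₁)).1 = z := funext fun i => s3 _ i (by omega)
  rw [hz] at h5
  exact ⟨y, z, _, h3, h5.1, h5.2⟩

end GoodPairs

/-! ### Variations of one row of a pair -/

/-- The product of `N + 2` consecutive values of a row. -/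
def longProd (N : ℕ) (u : ℤ → ℝ) (k : ℤ) : ℝ := ∏ i ∈ Finset.range (N + 2), u (k + i)

/-- The derivative at `l` of the equation for a pair of rows when the lower row varies by
`u k ↦ u k * (1 + s η k) / (1 + s η (k - 1))`. -/
def tiltSum (N : ℕ) (u v η : ℤ → ℝ) (l : ℤ) : ℝ :=
  ∑ n ∈ Finset.range (N + 1), (η (l + n) - η (l - 1)) * pairTerm N u v l n

/-- The recurrence, in the window `[-K, K]`, under which the variation of the lower row defined by
`η` preserves the equations of all pairs `u, v` in the window as soon as it preserves one of them.
It does not involve `v`. -/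
def TiltRec (N : ℕ) (α : ℝ) (K : ℤ) (u η : ℤ → ℝ) : Prop :=
  ∀ k, -K ≤ k → k + N + 1 ≤ K → longProd N u k * (η (k + N + 1) - η k) = α * (η (k - 1) - η k)

section Tilt

variable {N : ℕ} {α : ℝ} {D : Set (ℤ → ℝ)} {K : ℤ} {u v η : ℤ → ℝ} {l : ℤ} {n : ℕ}

lemma pairTerm_succ_mul (hn : n < N) :
    pairTerm N u v l (n + 1) * v (l + n) = pairTerm N u v l n * u (l + n + 1) := by
  simp only [pairTerm]
  rw [Finset.prod_range_succ _ (n + 1), show N + 1 - n = (N + 1 - (n + 1)) + 1 by omega,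
    Finset.prod_range_succ' (fun i : ℕ => v (l + n + i))]
  simp only [Nat.cast_add, Nat.cast_one, Nat.cast_zero, add_zero, add_assoc, add_comm (1 : ℤ)]
  ring

lemma pairTerm_translate_one (hn : n < N) :
    pairTerm N u v (l + 1) n * u l = pairTerm N u v l (n + 1) * v (l + N + 1) := by
  simp only [pairTerm]
  rw [Finset.prod_range_succ' _ (n + 1), show N + 1 - n = (N + 1 - (n + 1)) + 1 by omega,
    Finset.prod_range_succ (fun i : ℕ => v (l + 1 + n + i)),
    show l + 1 + n + ((N + 1 - (n + 1) : ℕ) : ℤ) = l + N + 1 by omega]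
  simp only [Nat.cast_add, Nat.cast_one, Nat.cast_zero, add_zero, add_assoc, add_comm (1 : ℤ)]
  ring

lemma pairTerm_translate_one_self :
    pairTerm N u v (l + 1) N * u l = longProd N u l * v (l + N + 1) := by
  rw [pairTerm, longProd, Finset.prod_range_succ' _ (N + 1), Nat.add_sub_cancel_left,
    Finset.prod_range_one]
  simp only [Nat.cast_add, Nat.cast_one, Nat.cast_zero, add_zero, add_assoc, add_comm (1 : ℤ)]
  ring

lemma tiltSum_succ (h : RowEq N α u v l) :
    tiltSum N u v η (l + 1) * u l = v (l + N + 1) * (tiltSum N u v η l + α * (η l - η (l - 1)) +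
      (η (l + N + 1) - η l) * longProd N u l) := by
  have e1 : tiltSum N u v η (l + 1) * u l =
      v (l + N + 1) * (∑ n ∈ Finset.range N, (η (l + (n + 1)) - η l) * pairTerm N u v l (n + 1) +
        (η (l + N + 1) - η l) * longProd N u l) := by
    rw [tiltSum, Finset.sum_range_succ, add_mul, mul_add, mul_assoc, pairTerm_translate_one_self,
      Finset.sum_mul, Finset.mul_sum]
    congr 1
    · refine Finset.sum_congr rfl fun n hn => ?_
      rw [mul_assoc, pairTerm_translate_one (Finset.mem_range.1 hn), add_sub_cancel_right,
        show l + 1 + (n : ℤ) = l + (n + 1) by ring]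
      ring
    · rw [add_sub_cancel_right, show l + 1 + (N : ℤ) = l + N + 1 by ring]
      ring
  have e2 : tiltSum N u v η l =
      ∑ n ∈ Finset.range N, (η (l + (n + 1)) - η l) * pairTerm N u v l (n + 1) -
        α * (η l - η (l - 1)) := by
    have h' := h
    rw [RowEq, Finset.sum_range_succ'] at h'
    have h2 : α = -(∑ n ∈ Finset.range N, pairTerm N u v l (n + 1) + pairTerm N u v l 0) := by
      rw [h', neg_neg]
    rw [tiltSum, Finset.sum_range_succ', h2, neg_mul, sub_neg_eq_add, add_mul, ← add_assoc,
      Finset.sum_mul, ← Finset.sum_add_distrib]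
    push_cast
    rw [add_zero]
    congr 1
    · exact Finset.sum_congr rfl fun n _ => by ring
    · ring
  rw [e1, e2]
  ring

/-- The recurrence has solutions with arbitrary values at `N + 2` consecutive indices. -/
lemma exists_tiltRec (hα : α ≠ 0) (hN : 1 ≤ N) (hu : ∀ i ∈ Set.Icc (-K) K, u i ≠ 0) (m : ℤ)
    (f₀ : ℤ → ℝ) :
    ∃ η : ℤ → ℝ, (∀ i, m ≤ i → i < m + N + 2 → η i = f₀ i) ∧ TiltRec N α K u η := by
  -- outside the window, vanishing leading coefficients are replaced by `1`
  set P : ℤ → ℝ := fun k => if longProd N u k = 0 then 1 else longProd N u k with hP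
  have hP0 : ∀ k, P k ≠ 0 := by
    intro k
    simp only [hP]
    split_ifs with h
    · exact one_ne_zero
    · exact h
  obtain ⟨η, h1, h2⟩ := linrec_exists (D := N + 2)
    (c := fun l k => if k = 0 then -α else if k = 1 then α - P (l + 1) else
      if k = N + 2 then P (l + 1) else 0)
    (fun l => by rw [if_pos rfl]; exact neg_ne_zero.2 hα)
    (fun l => by rw [if_neg (by omega), if_neg (by omega), if_pos rfl]; exact hP0 _) m f₀
  refine ⟨η, fun i hi hi' => h1 i hi (by push_cast; omega), fun k hk hk' => ?_⟩
  have hPk : P k = longProd N u k := by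
    simp only [hP]
    rw [if_neg]
    exact prod_row_ne_zero fun i hi hi' => hu i ⟨by omega, by push_cast at hi'; omega⟩
  have e := h2 (k - 1)
  rw [Finset.sum_range_succ, Finset.sum_range_succ', Finset.sum_range_succ',
      Finset.sum_eq_zero] at e
  · simp only [if_pos, if_neg (show ¬(N + 2 = 0) by omega), if_neg (show ¬(N + 2 = 1) by omega),
      if_neg (show ¬(0 + 1 = 0) by omega), sub_add_cancel, hPk] at e
    push_cast at e
    rw [show k - 1 + ((N : ℤ) + 2) = k + N + 1 by ring] at e
    simp only [zero_add, add_zero, sub_add_cancel] at e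
    linarith
  · intro i hi
    rw [Finset.mem_range] at hi
    rw [if_neg (by omega), if_neg (by omega), if_neg (by omega), zero_mul]

lemma prod_tilt {lam : ℤ → ℝ} (h : ∀ i, l - 1 ≤ i → i ≤ l + n → lam i ≠ 0) :
    ∏ i ∈ Finset.range (n + 1), u (l + i) * (lam (l + i) / lam (l + i - 1)) =
      (∏ i ∈ Finset.range (n + 1), u (l + i)) * (lam (l + n) / lam (l - 1)) := by
  induction n with
  | zero => simp
  | succ n ih =>
    rw [Finset.prod_range_succ, Finset.prod_range_succ _ (n + 1),
      ih fun i h1 h2 => h i h1 (by push_cast; omega)]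
    have h1 := h (l - 1) le_rfl (by omega)
    have h2 := h (l + n) (by omega) (by push_cast; omega)
    rw [show l + ((n + 1 : ℕ) : ℤ) - 1 = l + n by push_cast; ring]
    field_simp

lemma RowEq.tilt (h : RowEq N α u v l) (h0 : tiltSum N u v η l = 0) {s : ℝ}
    (hs : ∀ i, l - 1 ≤ i → i ≤ l + N → 1 + s * η i ≠ 0) :
    RowEq N α (fun k => u k * ((1 + s * η k) / (1 + s * η (k - 1)))) v l := by
  have h1 := hs (l - 1) le_rfl (by omega)
  have e : ∀ n ∈ Finset.range (N + 1),
      pairTerm N (fun k => u k * ((1 + s * η k) / (1 + s * η (k - 1)))) v l n =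
      pairTerm N u v l n + s / (1 + s * η (l - 1)) *
        ((η (l + n) - η (l - 1)) * pairTerm N u v l n) := by
    intro n hn
    rw [Finset.mem_range] at hn
    rw [pairTerm, prod_tilt (lam := fun k => 1 + s * η k) fun i h2 h3 => hs i h2 (by omega),
        pairTerm]
    field_simp
    ring
  rw [RowEq, Finset.sum_congr rfl e, Finset.sum_add_distrib, ← Finset.mul_sum, h]
  rw [tiltSum] at h0
  rw [h0]
  ring

lemma tiltSum_eq_zero (h : RowPairOn N α (Set.Icc (-K) K) u v) (hη : TiltRec N α K u η)
    (h0 : tiltSum N u v η (K - N) = 0) (hl : -K ≤ l) (hl' : l + N ≤ K) : tiltSum N u v η l = 0 := by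
  have key : ∀ j : ℕ, -K ≤ K - N - j → tiltSum N u v η (K - N - j) = 0 := by
    intro j
    induction j with
    | zero => intro _; simpa using h0
    | succ j ih =>
      intro hj
      push_cast at hj
      have e := tiltSum_succ (η := η) (h.rowEq (K - N - ((j + 1 : ℕ) : ℤ)) ⟨by push_cast; omega,
        by push_cast; omega⟩ ⟨by push_cast; omega, by push_cast; omega⟩)
      have r := hη (K - N - ((j + 1 : ℕ) : ℤ)) (by push_cast; omega) (by push_cast; omega)
      rw [show K - N - ((j + 1 : ℕ) : ℤ) + 1 = K - N - j by push_cast; ring, ih (by omega),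
          zero_mul]
        at e
      have hv := h.right_ne (K - N - ((j + 1 : ℕ) : ℤ) + N + 1) ⟨by push_cast; omega,
        by push_cast; omega⟩
      have := (mul_eq_zero.1 e.symm).resolve_left hv
      linarith
  have := key (K - N - l).toNat (by omega)
  rwa [show K - N - ((K - N - l).toNat : ℤ) = l by omega] at this

/-- Variations of the lower row that keep the upper row fixed annihilate a function `Φ` of the lower
row that is determined by the upper row. -/
lemma GoodPair.tilt_deriv_eq_zero_of_tiltSum (hD : IsOpen D) {Φ Ψ : (ℤ → ℝ) → ℝ}
    (hΦ : ∀ u v, GoodPair D N α K u v → Φ u = Ψ v) (g : GoodPair D N α K u v)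
    {L : (ℤ → ℝ) →ₗ[ℝ] ℝ} (hL : HasCurveDeriv Φ L u) (hη : TiltRec N α K u η)
    (h0 : tiltSum N u v η (K - N) = 0) : L (fun k => u k * (η k - η (k - 1))) = 0 := by
  set c : ℝ → ℤ → ℝ := fun s k => u k * ((1 + s * η k) / (1 + s * η (k - 1))) with hc
  have hc0 : c 0 = u := by funext k; simp [hc]
  have hder : ∀ k, HasDerivAt (fun s => c s k) (u k * (η k - η (k - 1))) 0 := by
    intro k
    have h1 : ∀ k, HasDerivAt (fun s : ℝ => 1 + s * η k) (η k) 0 := fun k => by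
      simpa using ((hasDerivAt_id (0 : ℝ)).mul_const (η k)).const_add 1
    have h2 := ((h1 k).div (h1 (k - 1)) (by simp)).const_mul (u k)
    simpa using h2
  have hct := tendsto_curve hc0 hder
  have hlam : ∀ᶠ s in 𝓝 (0 : ℝ), ∀ i ∈ Set.Icc (-K - 1) K, 1 + s * η i ≠ 0 := by
    rw [eventually_all_finite (Set.finite_Icc _ _)]
    intro i _
    have : ContinuousAt (fun s : ℝ => 1 + s * η i) 0 := by fun_prop
    exact this.eventually_ne (by simp)
  have hgood : ∀ᶠ s in 𝓝 (0 : ℝ), GoodPair D N α K (c s) v := by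
    filter_upwards [hlam, hct.eventually ((isOpen_goodRows hD K).mem_nhds g.left_mem)] with s h1 h2
    refine ⟨⟨fun i hi => ?_, g.pair.right_ne, fun l hl hlN => ?_⟩, h2, g.right_mem⟩
    · exact mul_ne_zero (g.pair.left_ne i hi) (div_ne_zero (h1 i ⟨by have := hi.1; omega, hi.2⟩)
        (h1 _ ⟨by have := hi.1; omega, by have := hi.2; omega⟩))
    · have hl1 := hl.1
      have hl2 := hlN.2
      exact (g.pair.rowEq l hl hlN).tilt (tiltSum_eq_zero g.pair hη h0 hl1 hl2)
        fun i h3 h4 => h1 i ⟨by omega, by omega⟩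
  have hconst : (fun s => Φ (c s)) =ᶠ[𝓝 0] fun _ => Ψ v := hgood.mono fun s hs => hΦ _ _ hs
  exact (hL c _ hc0 hder).unique ((hasDerivAt_const (0 : ℝ) (Ψ v)).congr_of_eventuallyEq hconst)

/-- A good pair has a neighbour with the same lower row and an essentially different upper row. -/
lemma GoodPair.exists_second (hα : α ≠ 0) (hN : 1 ≤ N) (hD : IsOpen D) (hK : (N : ℤ) ≤ 2 * K)
    (g : GoodPair D N α K u v) :
    ∃ v', GoodPair D N α K u v' ∧ ∃ n < N, v (K - N + n) ≠ v' (K - N + n) := by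
  obtain ⟨s, s1, s2, s3, s4, s5⟩ := g.exists_chart hD (m := K - N + 1) (by omega) (by omega)
  have hc : Continuous fun t : ℝ => (u, Function.update v K t) :=
    continuous_const.prodMk (continuous_const.update _ continuous_id)
  have hct : Tendsto (fun t : ℝ => (u, Function.update v K t)) (𝓝 (v K)) (𝓝 (u, v)) := by
    have := hc.tendsto (v K)
    rwa [Function.update_eq_self] at this
  obtain ⟨t, ht1, ht2⟩ := (((hct.eventually s5).filter_mono nhdsWithin_le_nhds).and
    (self_mem_nhdsWithin (a := v K) (s := {v K}ᶜ))).exists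
  have hu : (s (u, Function.update v K t)).1 = u := funext fun i => s3 _ i (by omega)
  rw [hu] at ht1
  refine ⟨_, ht1, ?_⟩
  by_contra! hcon
  have e := (g.pair.rowEq (K - N) ⟨by omega, by omega⟩ ⟨by omega, by omega⟩).right_unique hα
    (ht1.pair.rowEq (K - N) ⟨by omega, by omega⟩ ⟨by omega, by omega⟩) (fun i _ _ => rfl)
    (fun i h1 h2 => by
      have := hcon (i - (K - N)).toNat (by omega)
      rwa [show K - N + ((i - (K - N)).toNat : ℤ) = i by omega] at this)
  rw [sub_add_cancel, s4 _ K (by omega)] at e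
  exact ht2 (e.trans (Function.update_self K t v)).symm

lemma RowPairOn.pairTerm_ne_zero (h : RowPairOn N α (Set.Icc (-K) K) u v) (hn : n ≤ N) (hl : -K ≤ l)
    (hl' : l + N ≤ K) : pairTerm N u v l n ≠ 0 :=
  mul_ne_zero
    (prod_row_ne_zero fun i h1 h2 => h.left_ne i ⟨by omega, by push_cast at h2; omega⟩)
    (prod_row_ne_zero fun i h1 h2 => h.right_ne i ⟨by omega, by omega⟩)

/-- If a function `Φ` of the lower row of a pair is determined by the upper row, then it is
annihilated by all solutions of the recurrence: those that preserve the equations with a given upper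
row form a hyperplane, and the hyperplanes for two upper rows differ. -/
theorem GoodPair.tilt_deriv_eq_zero (hα : α ≠ 0) (hN : 1 ≤ N) (hD : IsOpen D)
    (hK : (N : ℤ) ≤ 2 * K) {Φ Ψ : (ℤ → ℝ) → ℝ} (hΦ : ∀ u v, GoodPair D N α K u v → Φ u = Ψ v)
    (g : GoodPair D N α K u v) {L : (ℤ → ℝ) →ₗ[ℝ] ℝ} (hL : HasCurveDeriv Φ L u)
    (hη : TiltRec N α K u η) : L (fun k => u k * (η k - η (k - 1))) = 0 := by
  obtain ⟨v', g', n, hn, hvn⟩ := g.exists_second hα hN hD hK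
  set l := K - N with hl
  -- a solution `e` that preserves the equations with the upper row `v'`, but not those with `v`
  obtain ⟨e, e1, e2⟩ := exists_tiltRec hα hN g.pair.left_ne (l - 1)
    (fun i => if i = l + n then pairTerm N u v' l (n + 1) else
      if i = l + n + 1 then -pairTerm N u v' l n else 0)
  have he : ∀ w, tiltSum N u w e l =
      pairTerm N u v' l (n + 1) * pairTerm N u w l n -
        pairTerm N u v' l n * pairTerm N u w l (n + 1) := by
    intro w
    have e0 : e (l - 1) = 0 := by
      rw [e1 (l - 1) le_rfl (by omega), if_neg (by omega), if_neg (by omega)]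
    have e3 : ∀ k ∈ Finset.range (N + 1), (e (l + k) - e (l - 1)) * pairTerm N u w l k =
        (if k = n then pairTerm N u v' l (n + 1) * pairTerm N u w l n else 0) +
        (if k = n + 1 then -pairTerm N u v' l n * pairTerm N u w l (n + 1) else 0) := by
      intro k hk
      rw [Finset.mem_range] at hk
      rw [e1 (l + k) (by omega) (by omega), e0, sub_zero]
      by_cases h1 : k = n
      · subst h1
        rw [if_pos rfl, if_pos rfl, if_neg (by omega)]
        ring
      · rw [if_neg (by omega), if_neg h1]
        by_cases h2 : k = n + 1
        · subst h2
          rw [if_pos (by push_cast; ring), if_pos rfl, zero_add]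
        · rw [if_neg (by omega), if_neg h2]
          ring
    rw [tiltSum, Finset.sum_congr rfl e3, Finset.sum_add_distrib, Finset.sum_ite_eq',
      Finset.sum_ite_eq', if_pos (by simp; omega), if_pos (by simp; omega)]
    ring
  have hne : tiltSum N u v e l ≠ 0 := by
    rw [he]
    intro h0
    have r1 := pairTerm_succ_mul (u := u) (v := v) (l := l) hn
    have r2 := pairTerm_succ_mul (u := u) (v := v') (l := l) hn
    have p1 := g.pair.pairTerm_ne_zero (l := l) hn.le (by omega) (by omega)
    have p2 := g'.pair.pairTerm_ne_zero (l := l) hn.le (by omega) (by omega)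
    have p3 := g.pair.left_ne (l + n + 1) ⟨by omega, by omega⟩
    have : pairTerm N u v l n * pairTerm N u v' l n * u (l + n + 1) *
        (v (l + n) - v' (l + n)) = 0 := by
      linear_combination v (l + n) * v' (l + n) * h0 - pairTerm N u v l n * v (l + n) * r2 +
        pairTerm N u v' l n * v' (l + n) * r1
    exact mul_ne_zero (mul_ne_zero (mul_ne_zero p1 p2) p3) (sub_ne_zero.2 hvn) this
  set t := tiltSum N u v η l / tiltSum N u v e l with ht
  have lin : ∀ (w f f' : ℤ → ℝ) (a : ℝ), tiltSum N u w (fun k => f k + a * f' k) l =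
      tiltSum N u w f l + a * tiltSum N u w f' l := by
    intro w f f' a
    simp only [tiltSum, Finset.mul_sum, ← Finset.sum_add_distrib]
    exact Finset.sum_congr rfl fun k _ => by ring
  have h1 := g.tilt_deriv_eq_zero_of_tiltSum hD hΦ hL (η := fun k => η k + -t * e k)
    (fun k hk hk' => by
      have r1 := hη k hk hk'
      have r2 := e2 k hk hk'
      linear_combination r1 - t * r2)
    (by rw [← hl, lin, ht]; field_simp; ring)
  have h2 := g'.tilt_deriv_eq_zero_of_tiltSum hD hΦ hL e2 (by rw [← hl, he]; ring)
  have hsum : (fun k => u k * (η k - η (k - 1))) =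
      (fun k => u k * ((η k + -t * e k) - (η (k - 1) + -t * e (k - 1)))) +
        t • fun k => u k * (e k - e (k - 1)) := by
    funext k
    simp only [Pi.add_apply, Pi.smul_apply, smul_eq_mul]
    ring
  rw [hsum, map_add, map_smul, h1, h2]
  simp

/-- The mirror image of `GoodPair.tilt_deriv_eq_zero`, for variations of the upper row. -/
theorem GoodPair.tilt_deriv_eq_zero' (hα : α ≠ 0) (hN : 1 ≤ N) (hD : IsOpen D)
    (hK : (N : ℤ) ≤ 2 * K) {Φ Ψ : (ℤ → ℝ) → ℝ} (hΦ : ∀ u v, GoodPair D N α K u v → Φ u = Ψ v)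
    (g : GoodPair D N α K u v) {L : (ℤ → ℝ) →ₗ[ℝ] ℝ} (hL : HasCurveDeriv Ψ L v)
    (hη : TiltRec N α K (reflectRow v) fun k => -η (-k - 1)) :
    L (fun k => v k * (η k - η (k - 1))) = 0 := by
  have hL' : HasCurveDeriv (fun x => Ψ (reflectRow x)) (L.comp (LinearMap.funLeft ℝ ℝ Neg.neg))
      (reflectRow v) := HasCurveDeriv.comp_index (K := Ψ) (fun i : ℤ => -i) (by
    have : (fun i => reflectRow v (-i)) = v := reflectRow_reflectRow v
    rwa [this])
  have := g.reflect.tilt_deriv_eq_zero hα hN (hD.preimage continuous_reflectRow) hK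
    (Φ := fun x => Ψ (reflectRow x)) (Ψ := fun x => Φ (reflectRow x)) (fun x y hxy => by
      have h := hxy.reflect
      rw [← Set.preimage_comp, show reflectRow ∘ reflectRow = id from funext reflectRow_reflectRow,
        Set.preimage_id] at h
      exact (hΦ _ _ h).symm) hL' hη
  rw [← this, LinearMap.comp_apply]
  congr 1
  funext k
  simp only [LinearMap.funLeft_apply, reflectRow_apply]
  rw [neg_neg, show -(-k - 1) - 1 = k by ring]
  ring

end Tilt

/-! ### Symmetries of low order depend on one value only -/

/-- The expression `x_0 ⋯ x_N B / (x_r ⋯ x_{r+N-1})`, with `B` shifted by `N`. When `B` is the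
partial derivative of `A` with respect to the value at `r`, this is the part of the differentiated
symmetry condition that depends on the lower row. -/
noncomputable def lowerTerm (N r : ℕ) (B : (ℤ → ℝ) → ℝ) (x : ℤ → ℝ) : ℝ :=
  (∏ i ∈ Finset.range (N + 1), x (0 + i)) * (∏ i ∈ Finset.range N, x (r + i))⁻¹ * B (shiftRow N x)

/-- The counterpart `x_{r+N} ^ 2 B / x_N` of `lowerTerm` for the upper row, with `B` shifted by `N`.
-/
noncomputable def upperTerm (N r : ℕ) (B : (ℤ → ℝ) → ℝ) (x : ℤ → ℝ) : ℝ :=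
  x (r + N) * x (r + N) * (x N)⁻¹ * B (shiftRow N x)

lemma sum_rel_last {N : ℕ} {τ : ℕ → ℝ} {a b : ℤ → ℝ} (ha : ∀ i : ℕ, i < N → a i = 0)
    (hb : ∀ i : ℕ, i < N → b i = 0) :
    ∑ n ∈ Finset.range (N + 1), τ n * (∑ i ∈ Finset.range (n + 1), a i +
      ∑ i ∈ Finset.range (N + 1 - n), b (n + i)) =
      τ N * a N + (∑ n ∈ Finset.range (N + 1), τ n) * b N := by
  have h1 : ∀ n ∈ Finset.range (N + 1), ∑ i ∈ Finset.range (N + 1 - n), b (n + i) = b N := by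
    intro n hn
    rw [Finset.mem_range] at hn
    rw [show N + 1 - n = N - n + 1 by omega, Finset.sum_range_succ, Finset.sum_eq_zero, zero_add]
    · congr 1; omega
    · intro i hi
      rw [Finset.mem_range] at hi
      exact_mod_cast hb (n + i) (by omega)
  have h2 : ∀ n ∈ Finset.range N, ∑ i ∈ Finset.range (n + 1), a i = 0 := by
    intro n hn
    rw [Finset.mem_range] at hn
    refine Finset.sum_eq_zero fun i hi => ?_
    rw [Finset.mem_range] at hi
    exact ha i (by omega)
  rw [Finset.sum_congr rfl (g := fun n => τ n * ∑ i ∈ Finset.range (n + 1), a i + τ n * b N)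
    fun n hn => by rw [h1 n hn, mul_add], Finset.sum_add_distrib, ← Finset.sum_mul,
    Finset.sum_range_succ, Finset.sum_eq_zero fun n hn => by rw [h2 n hn, mul_zero], zero_add,
    Finset.sum_range_succ, Finset.sum_eq_zero fun i hi => ha i (Finset.mem_range.1 hi), zero_add]

section Vanishing

variable {N M : ℕ} {α : ℝ} {D : Set (ℤ → ℝ)} {A : (ℤ → ℝ) → ℝ} {K : ℤ} {u v : ℤ → ℝ}

lemma RowSymmetry.rel_good (h : RowSymmetry N M α D A) (g : GoodPair D N α K u v) {l : ℤ}
    (h1 : -K ≤ l - M) (h2 : l + N + M ≤ K) :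
    ∑ n ∈ Finset.range (N + 1), pairTerm N u v l n *
      (∑ i ∈ Finset.range (n + 1), A (shiftRow (l + i) u) +
        ∑ i ∈ Finset.range (N + 1 - n), A (shiftRow (l + n + i) v)) = 0 := by
  have := h.rel (shiftRow l u) (shiftRow l v)
    ((g.pair.shift l).mono fun i hi => ⟨by have := hi.1; omega, by have := hi.2; omega⟩)
    (fun k hk hk' => by
      rw [shiftRow_shiftRow, shiftRow_shiftRow]
      have hk : |l + k| ≤ K := by rw [abs_le]; omega
      exact ⟨g.left_mem _ hk, g.right_mem _ hk⟩)
  rw [← this]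
  refine Finset.sum_congr rfl fun n _ => ?_
  rw [pairTerm_shift, add_zero]
  simp only [shiftRow_shiftRow, add_assoc]

lemma LocDep.eventually_eq {S : Set ℤ} {F : (ℤ → ℝ) → ℝ} (hF : LocDep D S F) {x : ℤ → ℝ}
    (hx : x ∈ D)
    {t₀ : ℝ} {f g : ℝ → ℤ → ℝ} (hf : Tendsto f (𝓝 t₀) (𝓝 x)) (hg : Tendsto g (𝓝 t₀) (𝓝 x))
    (hfg : ∀ t, ∀ k ∈ S, f t k = g t k) : ∀ᶠ t in 𝓝 t₀, F (f t) = F (g t) := by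
  obtain ⟨V, hV, hVF⟩ := hF x hx
  filter_upwards [hf hV, hg hV] with t h1 h2
  exact hVF _ h1 _ h2 (hfg t)

/-- If `A` depends locally on the values at the indices `≤ r` only, where `1 ≤ r`, then the
derivative of the symmetry condition along the variation of the upper row at `N + r` separates the
two rows. -/
lemma RowSymmetry.lowerTerm_eq_upperTerm (h : RowSymmetry N M α D A) (hα : α ≠ 0) {r : ℕ}
    (hr : 1 ≤ r) (hrN : r ≤ N) (hloc : LocDep D {k | -N ≤ k ∧ k ≤ r} A)
    (hK : N + N + M ≤ K) (g : GoodPair D N α K u v) :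
    lowerTerm N r (rowPartial A r) u = upperTerm N r (rowPartial A r) v := by
  obtain ⟨U, U1, U2, U3, U4, U5⟩ := g.exists_right_variation h.isOpen (m := r) (by omega) (by omega)
  set t₀ := v (r + N) with ht₀
  set V : ℝ → ℤ → ℝ := fun t => Function.update v (r + N) t with hV
  have hUt : Tendsto U (𝓝 t₀) (𝓝 u) := by
    have := U1.tendsto
    rwa [U2] at this
  have hmem : ∀ i : ℕ, i ≤ N → shiftRow i u ∈ D ∧ shiftRow i v ∈ D := fun i hi => by
    have hk : |(i : ℤ)| ≤ K := by rw [abs_le]; omega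
    exact ⟨g.left_mem _ hk, g.right_mem _ hk⟩
  set x := shiftRow N u with hx
  set y := shiftRow N v with hy
  have eU : ∀ᶠ t in 𝓝 t₀, ∀ i ∈ Finset.range N, A (shiftRow i (U t)) = A (shiftRow i u) := by
    rw [eventually_all_finset]
    intro i hi
    rw [Finset.mem_range] at hi
    refine hloc.eventually_eq (hmem i hi.le).1 (((continuous_shiftRow i).tendsto u).comp hUt)
      tendsto_const_nhds fun t k hk => ?_
    exact U3 t _ (by have := hk.2; omega)
  have eUN : ∀ᶠ t in 𝓝 t₀, A (shiftRow N (U t)) = A (Function.update x r (U t (r + N))) := by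
    refine hloc.eventually_eq (x := x) (hmem N le_rfl).1
      (((continuous_shiftRow N).tendsto u).comp hUt) ?_ fun t k hk => ?_
    · have h1 : Continuous fun s : ℝ => Function.update x r s :=
          continuous_const.update _ continuous_id
      have h2 := h1.tendsto (u (r + N))
      rw [show u (r + N) = x r by rw [hx, shiftRow_apply, add_comm], Function.update_eq_self] at h2
      refine h2.comp ?_
      have h3 := ((continuous_apply (r + N : ℤ)).tendsto u).comp hUt
      rwa [show u (r + N) = x r by rw [hx, shiftRow_apply, add_comm]] at h3
    · rcases eq_or_ne k r with rfl | hkr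
      · rw [Function.update_self, shiftRow_apply, add_comm]
      · rw [Function.update_of_ne hkr]
        exact U3 t _ (by have := hk.2; omega)
  have hVt : Tendsto V (𝓝 t₀) (𝓝 v) := by
    have h1 : Continuous V := continuous_const.update _ continuous_id
    have h2 := h1.tendsto t₀
    rwa [show V t₀ = v from Function.update_eq_self _ _] at h2
  have eV : ∀ᶠ t in 𝓝 t₀, ∀ i ∈ Finset.range N, A (shiftRow i (V t)) = A (shiftRow i v) := by
    rw [eventually_all_finset]
    intro i hi
    rw [Finset.mem_range] at hi
    refine hloc.eventually_eq (hmem i hi.le).2 (((continuous_shiftRow i).tendsto v).comp hVt)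
      tendsto_const_nhds fun t k hk => ?_
    exact Function.update_of_ne (by have := hk.2; omega) _ _
  have eVN : ∀ t, shiftRow N (V t) = Function.update y r t := by
    intro t
    funext k
    rcases eq_or_ne k r with rfl | hkr
    · rw [Function.update_self, shiftRow_apply, add_comm]
      exact Function.update_self _ _ _
    · rw [Function.update_of_ne hkr]
      exact Function.update_of_ne (by omega) _ _
  -- the variation of the symmetry condition at `0`; only the summands at `N` vary
  have key : ∀ᶠ t in 𝓝 t₀, pairTerm N u v 0 N * (A (Function.update x r (U t (r + N))) - A x) +
      -α * (A (Function.update y r t) - A y) = 0 := by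
    filter_upwards [eU, eUN, eV, U4] with t h1 h2 h3 h4
    have r1 := h.rel_good h4 (l := 0) (by omega) (by omega)
    have r2 := h.rel_good g (l := 0) (by omega) (by omega)
    have e1 : ∀ n ∈ Finset.range (N + 1), pairTerm N (U t) (V t) 0 n = pairTerm N u v 0 n :=
      fun n hn => by
        rw [Finset.mem_range] at hn
        exact pairTerm_congr (by omega) (fun i _ hi => U3 t i (by omega))
          fun i _ hi => Function.update_of_ne (by omega) _ _
    have e2 := sum_rel_last (N := N) (τ := pairTerm N u v 0)
      (a := fun i => A (shiftRow i (U t)) - A (shiftRow i u))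
      (b := fun i => A (shiftRow i (V t)) - A (shiftRow i v))
      (fun i hi => sub_eq_zero.2 (h1 i (Finset.mem_range.2 hi)))
      (fun i hi => sub_eq_zero.2 (h3 i (Finset.mem_range.2 hi)))
    have e3 : ∑ n ∈ Finset.range (N + 1), pairTerm N u v 0 n = -α :=
      g.pair.rowEq 0 ⟨by omega, by omega⟩ ⟨by omega, by omega⟩
    rw [e3, h2, eVN] at e2
    rw [← e2]
    simp only [zero_add] at r1 r2
    rw [Finset.sum_congr rfl fun n hn => by rw [← e1 n hn]] at r2
    have r3 := sub_eq_zero.2 (r1.trans r2.symm)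
    rw [← Finset.sum_sub_distrib] at r3
    rw [← r3]
    refine Finset.sum_congr rfl fun n hn => ?_
    rw [← e1 n hn, Finset.sum_sub_distrib, Finset.sum_sub_distrib]
    ring
  have dA := (h.curveDiff x (hmem N le_rfl).1).hasDerivAt_update r
  have dA' := (h.curveDiff y (hmem N le_rfl).2).hasDerivAt_update r
  rw [show x r = U t₀ (r + N) by rw [U2, hx, shiftRow_apply, add_comm]] at dA
  rw [show y r = t₀ by rw [hy, shiftRow_apply, add_comm]] at dA'
  have d1 := ((((dA.comp t₀ U5).sub_const (A x)).const_mul (pairTerm N u v 0 N)).add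
    ((dA'.sub_const (A y)).const_mul (-α))).unique
      ((hasDerivAt_const t₀ (0 : ℝ)).congr_of_eventuallyEq key)
  have ht0 : t₀ ≠ 0 := g.pair.right_ne _ ⟨by omega, by omega⟩
  have hv0 : v N ≠ 0 := g.pair.right_ne _ ⟨by omega, by omega⟩
  have hP : ∏ i ∈ Finset.range N, u (r + i) ≠ 0 :=
    prod_row_ne_zero fun i _ _ => g.pair.left_ne i ⟨by omega, by omega⟩
  rw [pairTerm, Nat.add_sub_cancel_left, Finset.prod_range_one, zero_add, Nat.cast_zero, add_zero]
    at d1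
  have d2 : (∏ i ∈ Finset.range (N + 1), u (0 + i)) * v N *
      (rowPartial A r x * (1 / (t₀ ^ 2 * ∏ i ∈ Finset.range N, u (r + i)))) =
      rowPartial A r y := by
    have : α * ((∏ i ∈ Finset.range (N + 1), u (0 + i)) * v N *
      (rowPartial A r x * (1 / (t₀ ^ 2 * ∏ i ∈ Finset.range N, u (r + i))))) =
      α * rowPartial A r y := by
      rw [← sub_eq_zero, ← d1]
      ring
    exact mul_left_cancel₀ hα this
  rw [lowerTerm, upperTerm, ← hx, ← hy, ← d2]
  simp only [← ht₀]
  field_simp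

lemma sum_range_sub_int (η : ℤ → ℝ) (l : ℤ) (n : ℕ) :
    ∑ i ∈ Finset.range n, (η (l + i) - η (l + i - 1)) = η (l + n - 1) - η (l - 1) := by
  induction n with
  | zero => simp
  | succ n ih =>
    rw [Finset.sum_range_succ, ih]
    push_cast
    rw [← add_assoc, add_sub_cancel_right]
    ring

lemma longProd_reflect (N : ℕ) (x : ℤ → ℝ) (k : ℤ) :
    longProd N (reflectRow x) k = longProd N x (-k - N - 1) := by
  rw [longProd, longProd, ← Finset.prod_range_reflect]
  refine Finset.prod_congr rfl fun i hi => ?_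
  rw [Finset.mem_range] at hi
  rw [reflectRow_apply]
  congr 1
  omega

/-- The common solution of the recurrence and of its mirror image on the window `[-1, N + r]`. -/
noncomputable def tiltStart (N r : ℕ) (α : ℝ) (z : ℤ → ℝ) (k : ℤ) : ℝ :=
  if k ≤ N - 1 then ∑ i ∈ Finset.range (min (k + 1).toNat r), longProd N z i
  else ∑ i ∈ Finset.range (k - N).toNat, longProd N z i - α

lemma tiltStart_low {N r j : ℕ} {z : ℤ → ℝ} (hj : j ≤ N) :
    tiltStart N r α z (j - 1) = ∑ i ∈ Finset.range (min j r), longProd N z i := by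
  rw [tiltStart, if_pos (by omega), show ((j : ℤ) - 1 + 1).toNat = j by omega]

lemma tiltStart_high {N r j : ℕ} {z : ℤ → ℝ} :
    tiltStart N r α z (N + j) = ∑ i ∈ Finset.range j, longProd N z i - α := by
  rw [tiltStart, if_neg (by omega), show ((N : ℤ) + j - N).toNat = j by omega]

lemma exists_tilt (hα : α ≠ 0) (hN : 1 ≤ N) {r : ℕ} (hrN : r ≤ N) (hK : N + N + 1 ≤ K) {z : ℤ → ℝ}
    (hz : ∀ i ∈ Set.Icc (-K) K, z i ≠ 0) :
    ∃ η : ℤ → ℝ, TiltRec N α K z η ∧ ∀ i : ℤ, -1 ≤ i → i ≤ N + r → η i = tiltStart N r α z i := by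
  obtain ⟨η, h1, h2⟩ := exists_tiltRec hα hN hz (-1) (tiltStart N r α z)
  refine ⟨η, h2, ?_⟩
  have high : ∀ j : ℕ, j ≤ r → η (N + j) = ∑ i ∈ Finset.range j, longProd N z i - α := by
    intro j
    cases j with
    | zero =>
      intro _
      rw [h1 _ (by omega) (by push_cast; omega), tiltStart_high]
    | succ j =>
      intro hj
      have e := h2 j (by omega) (by omega)
      have hP : longProd N z j ≠ 0 :=
        prod_row_ne_zero fun i h3 h4 => hz i ⟨by omega, by push_cast at h4; omega⟩
      have e1 := tiltStart_low (α := α) (r := r) (z := z) (show j ≤ N by omega)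
      have e2 := tiltStart_low (α := α) (r := r) (z := z) (show j + 1 ≤ N by omega)
      rw [min_eq_left (by omega)] at e1 e2
      push_cast at e2
      rw [add_sub_cancel_right, Finset.sum_range_succ] at e2
      rw [h1 (j - 1) (by omega) (by omega), h1 j (by omega) (by omega), e1, e2] at e
      have e3 := mul_left_cancel₀ hP (e.trans (by ring : _ = longProd N z j * (-α)))
      rw [Finset.sum_range_succ, show (N : ℤ) + ((j + 1 : ℕ) : ℤ) = j + N + 1 by push_cast; ring]
      linarith
  intro i hi hi'
  by_cases hiN : i ≤ N
  · exact h1 i hi (by omega)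
  · obtain ⟨j, rfl⟩ : ∃ j : ℕ, i = N + j := ⟨(i - N).toNat, by omega⟩
    rw [high j (by omega), tiltStart_high]

lemma exists_tilt_reflect (hα : α ≠ 0) (hN : 1 ≤ N) {r : ℕ} (hrN : r ≤ N) (hK : N + N + 1 ≤ K)
    {z : ℤ → ℝ} (hz : ∀ i ∈ Set.Icc (-K) K, z i ≠ 0) :
    ∃ η : ℤ → ℝ, TiltRec N α K (reflectRow z) (fun k => -η (-k - 1)) ∧
      ∀ i : ℤ, -1 ≤ i → i ≤ N + r → η i = tiltStart N r α z i := by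
  obtain ⟨θ, h1, h2⟩ := exists_tiltRec (u := reflectRow z) (K := K) hα hN
    (fun i hi => hz _ ⟨by have := hi.2; omega, by have := hi.1; omega⟩) (-N - 1)
    (fun k => -tiltStart N r α z (-k - 1))
  have hθ : ∀ i : ℤ, -1 ≤ i → i ≤ N → -θ (-i - 1) = tiltStart N r α z i := by
    intro i hi hi'
    rw [h1 _ (by omega) (by omega), neg_neg, show -(-i - 1) - 1 = i by ring]
  refine ⟨fun k => -θ (-k - 1), ?_, ?_⟩
  · have : (fun k : ℤ => - -θ (-(-k - 1) - 1)) = θ := by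
      funext k
      rw [neg_neg, show -(-k - 1) - 1 = k by ring]
    rwa [this]
  have high : ∀ j : ℕ, j ≤ r → -θ (-(N + j) - 1) = ∑ i ∈ Finset.range j, longProd N z i - α := by
    intro j
    induction j with
    | zero =>
      intro _
      rw [hθ _ (by omega) (by push_cast; omega), tiltStart_high]
    | succ j ih =>
      intro hj
      have e := h2 (-j - N - 1) (by omega) (by omega)
      have e1 := hθ (j - 1) (by omega) (by omega)
      rw [tiltStart_low (by omega), min_eq_left (by omega),
          show -((j : ℤ) - 1) - 1 = -j by ring] at e1
      have e2 := ih (by omega)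
      rw [show -((N : ℤ) + j) - 1 = -j - N - 1 by ring] at e2
      rw [longProd_reflect, show -(-(j : ℤ) - N - 1) - N - 1 = j by ring,
        show -(j : ℤ) - N - 1 + N + 1 = -j by ring] at e
      rw [Finset.sum_range_succ, show -((N : ℤ) + ((j + 1 : ℕ) : ℤ)) - 1 = -j - N - 1 - 1 by
        push_cast; ring]
      have e3 : α * (θ (-j - N - 1 - 1) +
          (∑ i ∈ Finset.range j, longProd N z i + longProd N z j - α)) =
          0 := by
        linear_combination -e - longProd N z j * e1 + (longProd N z j - α) * e2
      have := (mul_eq_zero.1 e3).resolve_left hα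
      linarith
  intro i hi hi'
  by_cases hiN : i ≤ N
  · exact hθ i hi (by omega)
  · obtain ⟨j, rfl⟩ : ∃ j : ℕ, i = N + j := ⟨(i - N).toNat, by omega⟩
    show -θ (-(N + j) - 1) = _
    rw [high j (by omega), tiltStart_high]

end Vanishing

/-! ### Vanishing of the partial derivatives -/

section Vanishing

variable {N M : ℕ} {α : ℝ} {D : Set (ℤ → ℝ)} {A : (ℤ → ℝ) → ℝ} {K : ℤ}

/-- The curve that scales the value at `k` with the rate `ε k`. -/
noncomputable def expCurve (z ε : ℤ → ℝ) (s : ℝ) : ℤ → ℝ := fun k => z k * Real.exp (s * ε k)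

lemma expCurve_zero (z ε : ℤ → ℝ) : expCurve z ε 0 = z := by
  funext k; simp [expCurve]

lemma hasDerivAt_expCurve (z ε : ℤ → ℝ) (k : ℤ) :
    HasDerivAt (fun s => expCurve z ε s k) (z k * ε k) 0 := by
  have := ((((hasDerivAt_id (0 : ℝ)).mul_const (ε k))).exp).const_mul (z k)
  simpa [expCurve] using this

lemma prod_expCurve (z ε : ℤ → ℝ) (s : ℝ) (l : ℤ) (n : ℕ) :
    ∏ i ∈ Finset.range n, expCurve z ε s (l + i) =
      (∏ i ∈ Finset.range n, z (l + i)) * Real.exp (s * ∑ i ∈ Finset.range n, ε (l + i)) := by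
  simp only [expCurve]
  rw [Finset.prod_mul_distrib, Finset.mul_sum, Real.exp_sum]

lemma lowerTerm_expCurve (N r : ℕ) (B : (ℤ → ℝ) → ℝ) (z ε : ℤ → ℝ) (s : ℝ) :
    lowerTerm N r B (expCurve z ε s) =
      ((∏ i ∈ Finset.range (N + 1), z (0 + i)) * (∏ i ∈ Finset.range N, z (r + i))⁻¹) *
      Real.exp (s * (∑ i ∈ Finset.range (N + 1), ε (0 + i) - ∑ i ∈ Finset.range N, ε (r + i))) *
      B (shiftRow N (expCurve z ε s)) := by
  rw [lowerTerm, prod_expCurve, prod_expCurve, mul_inv, ← Real.exp_neg, mul_sub, sub_eq_add_neg,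
    Real.exp_add]
  ring

lemma upperTerm_expCurve (N r : ℕ) (B : (ℤ → ℝ) → ℝ) (z ε : ℤ → ℝ) (s : ℝ) :
    upperTerm N r B (expCurve z ε s) =
      (z (r + N) * z (r + N) * (z N)⁻¹) *
      Real.exp (s * (ε (r + N) + ε (r + N) - ε N)) *
      B (shiftRow N (expCurve z ε s)) := by
  simp only [upperTerm, expCurve]
  rw [mul_inv, ← Real.exp_neg, mul_sub, mul_add, sub_eq_add_neg, Real.exp_add, Real.exp_add]
  ring

/-- If the derivative of `c e^{σ s} F(s)` vanishes at `0`, then `F'(0) = -σ F(0)`. -/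
lemma deriv_exp_mul_eq_zero {c σ F' : ℝ} {F : ℝ → ℝ} (hc : c ≠ 0) (hF : HasDerivAt F F' 0)
    (h : HasDerivAt (fun s => c * Real.exp (s * σ) * F s) 0 0) : σ * F 0 + F' = 0 := by
  have h1 := ((((hasDerivAt_id (0 : ℝ)).mul_const σ).exp).const_mul c).mul hF
  have h2 := h.unique h1
  simp only [id_eq, zero_mul, Real.exp_zero, one_mul, mul_one] at h2
  have h3 : c * (σ * F 0 + F') = 0 := by linarith
  exact (mul_eq_zero.1 h3).resolve_left hc

/-- A row can be scaled such that a given homogeneous function avoids the value `-α`. -/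
lemma exists_scale (hα : α ≠ 0) (P : ℝ) (n : ℕ) : ∃ᶠ t in 𝓝 (1 : ℝ), t ^ (n + 1) * P + α ≠ 0 := by
  by_cases hP : P + α = 0
  · have h1 : ∀ᶠ t in 𝓝[>] (1 : ℝ), t ^ (n + 1) * P + α ≠ 0 := by
      filter_upwards [self_mem_nhdsWithin] with t ht
      have ht1 : (1 : ℝ) < t := ht
      have h2 : 1 < t ^ (n + 1) := one_lt_pow₀ ht1 (by omega)
      intro h3
      have h4 : α * (1 - t ^ (n + 1)) = 0 := by linear_combination h3 - t ^ (n + 1) * hP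
      rcases mul_eq_zero.1 h4 with h5 | h5
      · exact hα h5
      · linarith
    exact h1.frequently.filter_mono nhdsWithin_le_nhds
  · have h1 : ContinuousAt (fun t : ℝ => t ^ (n + 1) * P + α) 1 := by fun_prop
    exact (h1.eventually_ne (by simpa using hP)).frequently

/-- The top partial derivative vanishes when the order is between `1` and `N`: at a row that belongs
to two good pairs, logarithmic differentiation of `lowerTerm` and `upperTerm` along a common vector
field gives different rates. -/
theorem RowSymmetry.rowPartial_eq_zero_of_locDep (h : RowSymmetry N M α D A) (hα : α ≠ 0)
    (hN : 1 ≤ N)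
    {r : ℕ} (hr : 1 ≤ r) (hrN : r ≤ N) (hloc : LocDep D {k | -N ≤ k ∧ k ≤ r} A) :
    ∀ x ∈ D, rowPartial A r x = 0 := by
  intro x hx
  by_contra hBx
  set B := rowPartial A r with hB
  set K : ℤ := N + N + M + 1 with hK
  -- `G z + α` will be the difference of the two rates; a small scaling of the row makes it nonzero
  set G : (ℤ → ℝ) → ℝ := fun z => longProd N z (r - 1) +
    ∑ k ∈ Finset.range r, longProd N z k with hG
  have hGc : Continuous G := by
    unfold G longProd
    fun_prop
  have hGs : ∀ (t : ℝ) (z : ℤ → ℝ), G (t • z) = t ^ (N + 2) * G z := by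
    intro t z
    have : ∀ k, longProd N (t • z) k = t ^ (N + 2) * longProd N z k := by
      intro k
      simp [longProd, Finset.prod_mul_distrib]
    simp only [hG, this]
    rw [mul_add, Finset.mul_sum]
  set x₁ := shiftRow (-N) x with hx₁
  have hx₁x : shiftRow N x₁ = x := by rw [hx₁, shiftRow_shiftRow, neg_add_cancel, shiftRow_zero]
  have hW : ∀ᶠ z in 𝓝 x₁, shiftRow N z ∈ D ∧ B (shiftRow N z) ≠ 0 := by
    have h1 : Tendsto (shiftRow N) (𝓝 x₁) (𝓝 x) := by
      have := (continuous_shiftRow N).tendsto x₁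
      rwa [hx₁x] at this
    exact h1.eventually (Filter.Eventually.and (h.isOpen.mem_nhds hx)
      ((h.continuousAt_partial x hx r).eventually_ne hBx))
  obtain ⟨z₀, h1, h2⟩ : ∃ z₀ : ℤ → ℝ, (∀ᶠ z in 𝓝 z₀, shiftRow N z ∈ D ∧ B (shiftRow N z) ≠ 0) ∧
      G z₀ + α ≠ 0 := by
    have h3 : Continuous fun t : ℝ => t • x₁ := continuous_id.smul continuous_const
    have h4 := h3.tendsto 1
    rw [one_smul] at h4
    obtain ⟨t, ht1, ht2⟩ := ((exists_scale hα (G x₁) (N + 1)).and_eventually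
      (h4.eventually (eventually_eventually_nhds.2 hW))).exists
    exact ⟨t • x₁, ht2, by rw [hGs]; exact ht1⟩
  have h3 : ∀ᶠ z in 𝓝 z₀, G z + α ≠ 0 :=
    (hGc.add continuous_const).continuousAt.eventually_ne h2
  obtain ⟨y, z, w, gy, gw, ⟨hzD, hzB⟩, hzG⟩ := exists_goodPair_middle hα hN h.isOpen h.dense
    (K := K) (by omega) z₀ (h1.and h3)
  have hz := gw.pair.left_ne
  obtain ⟨η, η1, η2⟩ := exists_tilt hα hN hrN (by omega) hz
  obtain ⟨θ, θ1, θ2⟩ := exists_tilt_reflect hα hN hrN (by omega) hz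
  set ε : ℤ → ℝ := fun k => η k - η (k - 1) with hε
  set δ : ℤ → ℝ := fun k => θ k - θ (k - 1) with hδ
  have hεδ : ∀ k : ℤ, 0 ≤ k → k ≤ N + r → ε k = δ k := by
    intro k hk hk'
    simp only [hε, hδ]
    rw [η2 k (by omega) hk', η2 (k - 1) (by omega) (by omega), θ2 k (by omega) hk',
      θ2 (k - 1) (by omega) (by omega)]
  have cB : CurveDiff (fun z => B (shiftRow N z)) z :=
    CurveDiff.comp_index (fun i => (N : ℤ) + i) (h.curveDiff_partial _ hzD r)
  have cL : CurveDiff (lowerTerm N r B) z :=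
    ((curveDiff_prod _ fun i _ => curveDiff_apply _).mul
      ((curveDiff_prod _ fun i _ => curveDiff_apply _).inv
        (prod_row_ne_zero fun i hi hi' => hz i ⟨by omega, by omega⟩))).mul cB
  have cU : CurveDiff (upperTerm N r B) z :=
    (((curveDiff_apply _).mul (curveDiff_apply _)).mul ((curveDiff_apply _).inv
      (hz N ⟨by omega, by omega⟩))).mul cB
  obtain ⟨LB, hLB⟩ := cB
  obtain ⟨LL, hLL⟩ := cL
  obtain ⟨LU, hLU⟩ := cU
  have hΦ : ∀ u v, GoodPair D N α K u v → lowerTerm N r B u = upperTerm N r B v := fun u v g =>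
    h.lowerTerm_eq_upperTerm hα hr hrN hloc (by omega) g
  have dL := hLL _ _ (expCurve_zero z ε) (hasDerivAt_expCurve z ε)
  rw [show (fun k => z k * ε k) = fun k => z k * (η k - η (k - 1)) from rfl,
    gw.tilt_deriv_eq_zero hα hN h.isOpen (by omega) hΦ hLL η1] at dL
  have dU := hLU _ _ (expCurve_zero z δ) (hasDerivAt_expCurve z δ)
  rw [show (fun k => z k * δ k) = fun k => z k * (θ k - θ (k - 1)) from rfl,
    gy.tilt_deriv_eq_zero' hα hN h.isOpen (by omega) hΦ hLU θ1] at dU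
  have dB := hLB _ _ (expCurve_zero z ε) (hasDerivAt_expCurve z ε)
  have dB' := hLB _ _ (expCurve_zero z δ) (hasDerivAt_expCurve z δ)
  simp only [lowerTerm_expCurve] at dL
  simp only [upperTerm_expCurve] at dU
  have e1 := deriv_exp_mul_eq_zero (mul_ne_zero
    (prod_row_ne_zero fun i hi hi' => hz i ⟨by omega, by push_cast at hi'; omega⟩)
    (inv_ne_zero (prod_row_ne_zero fun i hi hi' => hz i ⟨by omega, by omega⟩))) dB dL
  have e2 := deriv_exp_mul_eq_zero (mul_ne_zero (mul_ne_zero (hz _ ⟨by omega, by omega⟩)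
    (hz _ ⟨by omega, by omega⟩)) (inv_ne_zero (hz N ⟨by omega, by omega⟩))) dB' dU
  -- the two curves agree in the window, so the derivatives of `B` are the same
  have eB : LB (fun k => z k * ε k) = LB fun k => z k * δ k := by
    refine dB.unique (dB'.congr_of_eventuallyEq ?_)
    have hcurve : ∀ ε : ℤ → ℝ, Tendsto (fun s => shiftRow N (expCurve z ε s)) (𝓝 0)
        (𝓝 (shiftRow N z)) := fun ε => ((continuous_shiftRow N).tendsto z).comp
          (tendsto_curve (expCurve_zero z ε) (hasDerivAt_expCurve z ε))
    refine (hloc.rowPartial (r := r) ⟨by omega, le_rfl⟩).eventually_eq hzD (hcurve ε) (hcurve δ) ?_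
    intro t k hk
    simp only [shiftRow_apply, expCurve]
    rw [hεδ (N + k) (by have := hk.1; omega) (by have := hk.2; omega)]
  simp only [expCurve_zero] at e1 e2
  rw [eB] at e1
  -- the two rates `s1` and `s2` at which the factors of `B` vary
  obtain ⟨q, rfl⟩ : ∃ q, r = q + 1 := ⟨r - 1, by omega⟩
  set S := ∑ i ∈ Finset.range q, longProd N z i with hS
  have val : ∀ ζ : ℤ → ℝ, (∀ i : ℤ, -1 ≤ i → i ≤ N + (q + 1 : ℕ)  →
      ζ i = tiltStart N (q + 1) α z i) →
      ζ (-1) = 0 ∧ ζ q = S + longProd N z q ∧ ζ (N - 1) = S + longProd N z q ∧ ζ N = -α ∧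
        ζ (N + q) = S - α ∧ ζ (N + (q + 1)) = S + longProd N z q - α := by
    intro ζ hζ
    have t0 := tiltStart_low (N := N) (r := q + 1) (α := α) (z := z) (j := 0) (by omega)
    have t1 := tiltStart_low (N := N) (r := q + 1) (α := α) (z := z) (j := q + 1) hrN
    have t2 := tiltStart_low (N := N) (r := q + 1) (α := α) (z := z) (j := N) le_rfl
    have t3 := tiltStart_high (N := N) (r := q + 1) (α := α) (z := z) (j := 0)
    have t4 := tiltStart_high (N := N) (r := q + 1) (α := α) (z := z) (j := q)
    have t5 := tiltStart_high (N := N) (r := q + 1) (α := α) (z := z) (j := q + 1)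
    rw [min_self] at t1
    rw [min_eq_right hrN] at t2
    simp only [Nat.zero_min, Finset.range_zero, Finset.sum_empty, Finset.sum_range_succ, ← hS,
      Nat.cast_add, Nat.cast_one, Nat.cast_zero, add_zero, zero_sub, add_sub_cancel_right]
      at t0 t1 t2 t3 t4 t5
    refine ⟨?_, ?_, ?_, ?_, ?_, ?_⟩
    · rw [hζ _ (by omega) (by omega), t0]
    · rw [hζ _ (by omega) (by omega), t1]
    · rw [hζ _ (by omega) (by omega), t2]
    · rw [hζ _ (by omega) (by omega), t3]
    · rw [hζ _ (by omega) (by omega), t4]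
    · rw [hζ _ (by omega) (by push_cast; omega), t5]
  obtain ⟨a1, a2, -, a4, a5, -⟩ := val η η2
  obtain ⟨-, -, b3, b4, b5, b6⟩ := val θ θ2
  have s1 : ∑ i ∈ Finset.range (N + 1), ε (0 + i) - ∑ i ∈ Finset.range N, ε ((q + 1 : ℕ) + i) =
      longProd N z q := by
    have p1 := sum_range_sub_int η 0 (N + 1)
    have p2 := sum_range_sub_int η (q + 1 : ℕ) N
    simp only [hε]
    rw [p1, p2]
    push_cast
    rw [show (0 : ℤ) + (N + 1) - 1 = N by ring,
      show (q : ℤ) + 1 + N - 1 = N + q by ring,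
      add_sub_cancel_right, a1, a2, a4, a5]
    ring
  have s2 : δ ((q + 1 : ℕ) + N) + δ ((q + 1 : ℕ) + N) - δ N =
      longProd N z q + longProd N z q + α + (S + longProd N z q) := by
    simp only [hδ]
    push_cast
    rw [show (q : ℤ) + 1 + N = N + (q + 1) by ring, show (N : ℤ) + (q + 1) - 1 = N + q by ring,
      b3, b4, b5, b6]
    ring
  rw [s1] at e1
  rw [s2] at e2
  have hG' : G z = longProd N z q + (S + longProd N z q) := by
    simp only [hG, Finset.sum_range_succ, ← hS]
    push_cast
    rw [add_sub_cancel_right]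
  rw [hG'] at hzG
  have e3 : (longProd N z q + (S + longProd N z q) + α) * B (shiftRow N z) = 0 := by
    linear_combination e2 - e1
  exact (mul_ne_zero hzG hzB) e3

end Vanishing

/-! ### Local constancy -/

section LocalConstancy

variable {N M : ℕ} {α : ℝ} {D : Set (ℤ → ℝ)} {A : (ℤ → ℝ) → ℝ} {K : ℤ} {u v : ℤ → ℝ}

lemma rowPartial_reflect (A : (ℤ → ℝ) → ℝ) (r : ℤ) :
    rowPartial (fun x => A (reflectRow x)) r = fun x => rowPartial A (-r) (reflectRow x) := by
  funext x
  simp only [rowPartial, reflectRow_apply, neg_neg]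
  congr 1
  funext t
  congr 1
  funext i
  rw [reflectRow_apply]
  rcases eq_or_ne i (-r) with rfl | h
  · simp
  · rw [Function.update_of_ne h, Function.update_of_ne (by omega), reflectRow_apply]

lemma RowSymmetry.reflect (h : RowSymmetry N M α D A) :
    RowSymmetry N M α (reflectRow ⁻¹' D) (fun x => A (reflectRow x)) where
  isOpen := h.isOpen.preimage continuous_reflectRow
  dense := h.dense.preimage isOpenMap_reflectRow
  mem_congr x hx y hxy := h.mem_congr _ hx _ fun k hk => hxy (-k) (by rwa [abs_neg])
  dep x hx y hy hxy := h.dep _ hx _ hy fun k hk => hxy (-k) (by rwa [abs_neg])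
  curveDiff x hx := (h.curveDiff _ hx).comp_index fun i => -i
  curveDiff_partial x hx r := by
    rw [rowPartial_reflect]
    exact (h.curveDiff_partial _ hx (-r)).comp_index fun i => -i
  continuousAt_partial x hx r := by
    rw [rowPartial_reflect]
    exact ContinuousAt.comp (g := rowPartial A (-r)) (h.continuousAt_partial _ hx (-r))
      continuous_reflectRow.continuousAt
  rel u v huv hD := by
    have hs : ∀ (w : ℤ → ℝ) (k : ℤ), reflectRow (shiftRow k w) = shiftRow (-k) (reflectRow w) := by
      intro w k
      funext i
      simp only [reflectRow_apply, shiftRow_apply]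
      congr 1; ring
    have hp : RowPairOn N α (Set.Icc (-M) (N + M)) (shiftRow (-N) (reflectRow v))
        (shiftRow (-N) (reflectRow u)) :=
      (huv.reflect.shift (-N)).mono fun i hi => by
        have h1 := hi.1
        have h2 := hi.2
        exact ⟨by omega, by omega⟩
    have := h.rel _ _ hp (fun k hk hk' => by
      have e := hD (N - k) (by omega) (by omega)
      simp only [Set.mem_preimage, hs] at e
      rw [shiftRow_shiftRow, shiftRow_shiftRow, show -(N : ℤ) + k = -(N - k) by ring]
      exact ⟨e.2, e.1⟩)
    rw [← this, ← Finset.sum_range_reflect]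
    refine Finset.sum_congr rfl fun n hn => ?_
    rw [Finset.mem_range] at hn
    rw [pairTerm_shift, pairTerm_reflect (by omega), show N + 1 - 1 - n = N - n by omega,
      show -(-(N : ℤ) + 0 + N) = 0 by ring]
    congr 1
    rw [add_comm]
    congr 1
    · rw [← Finset.sum_range_reflect, show N + 1 - (N - n) = n + 1 by omega]
      refine Finset.sum_congr rfl fun i hi => ?_
      rw [Finset.mem_range] at hi
      rw [hs, shiftRow_shiftRow]
      congr 2; omega
    · rw [← Finset.sum_range_reflect, show N + 1 - n = N - n + 1 by omega]
      refine Finset.sum_congr rfl fun i hi => ?_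
      rw [Finset.mem_range] at hi
      rw [hs, shiftRow_shiftRow]
      congr 2; omega

lemma RowSymmetry.locDep_nonpos (h : RowSymmetry N M α D A) (hα : α ≠ 0) (hN : 1 ≤ N) :
    LocDep D {k | -N ≤ k ∧ k ≤ 0} A ∧
      ∀ r : ℕ, 1 ≤ r → r ≤ N → ∀ x ∈ D, rowPartial A r x = 0 := by
  have key : ∀ j : ℕ, j ≤ N → LocDep D {k | -N ≤ k ∧ k ≤ N - j} A := by
    intro j
    induction j with
    | zero =>
      intro _ x hx
      refine ⟨D, h.isOpen.mem_nhds hx, fun y hy z hz hyz => h.dep y hy z hz fun k hk => hyz k ?_⟩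
      rw [abs_le] at hk
      exact ⟨hk.1, by push_cast; omega⟩
    | succ j ih =>
      intro hj
      have h1 := ih (by omega)
      have h2 := h.rowPartial_eq_zero_of_locDep hα hN (r := N - j) (by omega) (by omega)
        (h1.mono fun k hk => ⟨hk.1, by have := hk.2; omega⟩)
      refine (h1.erase h.isOpen h.curveDiff h2).mono fun k hk => ⟨hk.1.1, ?_⟩
      have h3 := hk.1.2
      have h4 : k ≠ ((N - j : ℕ) : ℤ) := hk.2
      push_cast
      omega
  refine ⟨(key N le_rfl).mono fun k hk => ⟨hk.1, by have := hk.2; omega⟩, fun r hr hrN => ?_⟩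
  exact h.rowPartial_eq_zero_of_locDep hα hN hr hrN
    ((key (N - r) (by omega)).mono fun k hk => ⟨hk.1, by have := hk.2; omega⟩)

/-- A symmetry of order at most `N` has the form `u_0 A(u_0)` locally. -/
lemma RowSymmetry.locDep_zero (h : RowSymmetry N M α D A) (hα : α ≠ 0) (hN : 1 ≤ N) :
    LocDep D {0} A := by
  have hneg : ∀ r : ℕ, 1 ≤ r → r ≤ N → ∀ x ∈ D, rowPartial A (-r) x = 0 := by
    intro r hr hrN x hx
    have := (h.reflect.locDep_nonpos hα hN).2 r hr hrN (reflectRow x) (by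
      rwa [Set.mem_preimage, reflectRow_reflectRow])
    rw [rowPartial_reflect] at this
    dsimp only at this
    rwa [reflectRow_reflectRow] at this
  have key : ∀ j : ℕ, j ≤ N → LocDep D {k | -N + j ≤ k ∧ k ≤ 0} A := by
    intro j
    induction j with
    | zero =>
      intro _
      exact (h.locDep_nonpos hα hN).1.mono fun k hk => ⟨by push_cast; linarith [hk.1], hk.2⟩
    | succ j ih =>
      intro hj
      refine ((ih (by omega)).erase h.isOpen h.curveDiff (hneg (N - j) (by omega) (by omega))).mono
        fun k hk => ⟨?_, hk.1.2⟩
      have h3 := hk.1.1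
      have h4 : k ≠ -((N - j : ℕ) : ℤ) := hk.2
      push_cast
      omega
  refine (key N le_rfl).mono fun k hk => ?_
  have h1 := hk.1
  have h2 := hk.2
  rw [Set.mem_singleton_iff]
  omega

/-- The sum of the values of `A` along the path of `pairTerm N u v 0 n`, which multiplies this
`pairTerm` in the symmetry condition. -/
def relSum (N : ℕ) (A : (ℤ → ℝ) → ℝ) (u v : ℤ → ℝ) (n : ℕ) : ℝ :=
  ∑ i ∈ Finset.range (n + 1), A (shiftRow i u) +
    ∑ i ∈ Finset.range (N + 1 - n), A (shiftRow (n + i) v)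

lemma RowSymmetry.sum_relSum (h : RowSymmetry N M α D A) (hK : N + M ≤ K)
    (g : GoodPair D N α K u v) :
    ∑ n ∈ Finset.range (N + 1), pairTerm N u v 0 n * relSum N A u v n = 0 := by
  have := h.rel_good g (l := 0) (by omega) (by omega)
  simpa only [zero_add, relSum] using this

lemma relSum_self (N : ℕ) (A : (ℤ → ℝ) → ℝ) (u v : ℤ → ℝ) :
    relSum N A u v N = ∑ i ∈ Finset.range (N + 1), A (shiftRow i u) + A (shiftRow N v) := by
  rw [relSum, Nat.add_sub_cancel_left, Finset.sum_range_one, Nat.cast_zero, add_zero]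

lemma GoodPair.mem (g : GoodPair D N α K u v) {i : ℤ} (h1 : -K ≤ i) (h2 : i ≤ K) :
    shiftRow i u ∈ D ∧ shiftRow i v ∈ D :=
  ⟨g.left_mem i (abs_le.2 ⟨h1, h2⟩), g.right_mem i (abs_le.2 ⟨h1, h2⟩)⟩

/-- The derivative of the symmetry condition along the variation of the upper row at `N`, when `A`
depends on the value at `0` only. -/
lemma RowSymmetry.relSum_self_eq (h : RowSymmetry N M α D A) (hα : α ≠ 0) (hloc : LocDep D {0} A)
    (hK : N + M ≤ K) (g : GoodPair D N α K u v) :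
    relSum N A u v N =
      v N * rowPartial A 0 (shiftRow N v) - u N * rowPartial A 0 (shiftRow N u) := by
  obtain ⟨U, U1, U2, U3, U4, U5⟩ := g.exists_right_variation h.isOpen (m := 0) (by omega) (by omega)
  rw [zero_add] at U1 U2 U3 U4 U5
  set t₀ := v N with ht₀
  set V : ℝ → ℤ → ℝ := fun t => Function.update v N t with hV
  have hUt : Tendsto U (𝓝 t₀) (𝓝 u) := by
    have := U1.tendsto
    rwa [U2] at this
  have hVt : Tendsto V (𝓝 t₀) (𝓝 v) := by
    have h1 : Continuous V := continuous_const.update _ continuous_id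
    have h2 := h1.tendsto t₀
    rwa [show V t₀ = v from Function.update_eq_self _ _] at h2
  set x := shiftRow N u with hx
  set y := shiftRow N v with hy
  have eU : ∀ᶠ t in 𝓝 t₀, ∀ i ∈ Finset.range N, A (shiftRow i (U t)) = A (shiftRow i u) := by
    rw [eventually_all_finset]
    intro i hi
    rw [Finset.mem_range] at hi
    refine hloc.eventually_eq (g.mem (by omega) (by omega)).1
      (((continuous_shiftRow i).tendsto u).comp hUt) tendsto_const_nhds fun t k hk => ?_
    rw [Set.mem_singleton_iff.1 hk]
    exact U3 t _ (by omega)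
  have eV : ∀ᶠ t in 𝓝 t₀, ∀ i ∈ Finset.range N, A (shiftRow i (V t)) = A (shiftRow i v) := by
    rw [eventually_all_finset]
    intro i hi
    rw [Finset.mem_range] at hi
    refine hloc.eventually_eq (g.mem (by omega) (by omega)).2
      (((continuous_shiftRow i).tendsto v).comp hVt) tendsto_const_nhds fun t k hk => ?_
    rw [Set.mem_singleton_iff.1 hk]
    exact Function.update_of_ne (by omega) _ _
  have eUN : ∀ᶠ t in 𝓝 t₀, A (shiftRow N (U t)) = A (Function.update x 0 (U t N)) := by
    refine hloc.eventually_eq (x := x) (g.mem (by omega) (by omega)).1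
      (((continuous_shiftRow N).tendsto u).comp hUt) ?_ fun t k hk => ?_
    · have h1 : Continuous fun s : ℝ => Function.update x 0 s :=
          continuous_const.update _ continuous_id
      have h2 := h1.tendsto (u N)
      rw [show u N = x 0 by rw [hx, shiftRow_apply, add_zero], Function.update_eq_self] at h2
      refine h2.comp ?_
      have h3 := ((continuous_apply (N : ℤ)).tendsto u).comp hUt
      rwa [show u N = x 0 by rw [hx, shiftRow_apply, add_zero]] at h3
    · rw [Set.mem_singleton_iff.1 hk, Function.update_self, shiftRow_apply, add_zero]
  have eVN : ∀ t, shiftRow N (V t) = Function.update y 0 t := by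
    intro t
    funext k
    rcases eq_or_ne k 0 with rfl | hk
    · rw [Function.update_self, shiftRow_apply, add_zero]
      exact Function.update_self _ _ _
    · rw [Function.update_of_ne hk]
      exact Function.update_of_ne (by omega) _ _
  -- the `pairTerm`s with `n < N` are proportional to the varied value
  set C : ℕ → ℝ := fun n =>
    (∏ i ∈ Finset.range (n + 1), u (0 + i)) * ∏ i ∈ Finset.range (N - n), v (0 + n + i) with hC
  have ht0 : t₀ ≠ 0 := g.pair.right_ne _ ⟨by omega, by omega⟩
  have hP : ∏ i ∈ Finset.range N, u (0 + i) ≠ 0 :=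
    prod_row_ne_zero fun i _ _ => g.pair.left_ne i ⟨by omega, by omega⟩
  have hterm : ∀ t, ∀ n ∈ Finset.range N, pairTerm N (U t) (V t) 0 n = C n * t := by
    intro t n hn
    rw [Finset.mem_range] at hn
    rw [pairTerm_eq_mul hn, show V t (0 + N) = t by
      rw [zero_add]; exact Function.update_self _ _ _]
    simp only [hC]
    congr 2
    · exact prod_congr_row fun i _ hi => U3 t i (by push_cast at hi; omega)
    · exact prod_congr_row fun i _ hi => Function.update_of_ne (by omega) _ _
  set R := relSum N A u v with hR
  set E := ∑ n ∈ Finset.range N, C n * R n with hE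
  set C' := ∑ n ∈ Finset.range N, C n with hC'
  have key : ∀ᶠ t in 𝓝 t₀, t * E + (-α - t * C') * (R N + (A (Function.update x 0 (U t N)) - A x)) +
      -α * (A (Function.update y 0 t) - A y) = 0 := by
    filter_upwards [eU, eUN, eV, U4] with t h1 h2 h3 h4
    have r1 := h.sum_relSum hK h4
    have q1 : ∑ n ∈ Finset.range (N + 1), pairTerm N (U t) (V t) 0 n = -α :=
      h4.pair.rowEq 0 ⟨by omega, by omega⟩ ⟨by omega, by omega⟩
    have e2 := sum_rel_last (N := N) (τ := pairTerm N (U t) (V t) 0)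
      (a := fun i => A (shiftRow i (U t)) - A (shiftRow i u))
      (b := fun i => A (shiftRow i (V t)) - A (shiftRow i v))
      (fun i hi => sub_eq_zero.2 (h1 i (Finset.mem_range.2 hi)))
      (fun i hi => sub_eq_zero.2 (h3 i (Finset.mem_range.2 hi)))
    have e3 : ∑ n ∈ Finset.range (N + 1), pairTerm N (U t) (V t) 0 n *
        (∑ i ∈ Finset.range (n + 1), (A (shiftRow i (U t)) - A (shiftRow i u)) +
          ∑ i ∈ Finset.range (N + 1 - n), (A (shiftRow (n + i) (V t)) - A (shiftRow (n + i) v))) =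
        -∑ n ∈ Finset.range (N + 1), pairTerm N (U t) (V t) 0 n * R n := by
      rw [← zero_sub, ← r1, ← Finset.sum_sub_distrib]
      refine Finset.sum_congr rfl fun n _ => ?_
      rw [Finset.sum_sub_distrib, Finset.sum_sub_distrib, hR, relSum, relSum]
      ring
    rw [e3, q1, h2, eVN, Finset.sum_range_succ] at e2
    rw [Finset.sum_range_succ] at q1
    rw [Finset.sum_congr rfl (hterm t), ← Finset.sum_mul] at q1
    rw [Finset.sum_congr rfl (g := fun n => t * (C n * R n)) fun n hn => by rw [hterm t n hn]; ring,
      ← Finset.mul_sum] at e2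
    have q2 : pairTerm N (U t) (V t) 0 N = -α - t * C' := by rw [hC']; linarith
    rw [q2] at e2
    linarith
  have dA := (h.curveDiff x (g.mem (by omega) (by omega)).1).hasDerivAt_update 0
  have dA' := (h.curveDiff y (g.mem (by omega) (by omega)).2).hasDerivAt_update 0
  rw [show x 0 = U t₀ N by rw [U2, hx, shiftRow_apply, add_zero]] at dA
  rw [show y 0 = t₀ by rw [hy, shiftRow_apply, add_zero]] at dA'
  have dlin : HasDerivAt (fun t : ℝ => -α - t * C') (-C') t₀ := by
    simpa using ((hasDerivAt_id t₀).mul_const C').const_sub (-α)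
  have d1 := (((((hasDerivAt_id t₀).mul_const E).add
    (dlin.mul (((dA.comp t₀ U5).sub_const (A x)).const_add (R N)))).add
    ((dA'.sub_const (A y)).const_mul (-α)))).unique
      ((hasDerivAt_const t₀ (0 : ℝ)).congr_of_eventuallyEq key)
  have k0 := key.self_of_nhds
  have hx0 : Function.update x 0 (u N) = x := by
    rw [show u N = x 0 by rw [hx, shiftRow_apply, add_zero], Function.update_eq_self]
  have hy0 : Function.update y 0 t₀ = y := by
    rw [show t₀ = y 0 by rw [hy, shiftRow_apply, add_zero], Function.update_eq_self]
  have hτ : -α - t₀ * C' = (∏ i ∈ Finset.range N, u (0 + i)) * u N * t₀ := by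
    have q1 : ∑ n ∈ Finset.range (N + 1), pairTerm N u v 0 n = -α :=
      g.pair.rowEq 0 ⟨by omega, by omega⟩ ⟨by omega, by omega⟩
    have hV0 : V t₀ = v := Function.update_eq_self _ _
    have e := hterm t₀
    rw [U2, hV0] at e
    rw [Finset.sum_range_succ, Finset.sum_congr rfl e, ← Finset.sum_mul, pairTerm_self,
        zero_add] at q1
    rw [hC']
    linarith
  simp only [Function.comp_apply, U2, hx0, hy0, sub_self, add_zero, mul_zero, one_mul] at d1 k0
  rw [hτ] at d1 k0
  have e5 : α * R N = α * (t₀ * rowPartial A 0 y - u N * rowPartial A 0 x) := by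
    have e6 : t₀ * ((∏ i ∈ Finset.range N, u (0 + i)) * u N * t₀ *
        (rowPartial A 0 x * (α / (t₀ ^ 2 * ∏ i ∈ Finset.range N, u (0 + i))))) =
        u N * α * rowPartial A 0 x := by
      field_simp
    linear_combination t₀ * d1 - k0 - e6 - R N * hτ
  exact mul_left_cancel₀ hα e5

end LocalConstancy

/-! ### Vanishing of the symmetries of low order -/

section EqZero

variable {N M : ℕ} {α : ℝ} {D : Set (ℤ → ℝ)} {A : (ℤ → ℝ) → ℝ} {K : ℤ} {u v : ℤ → ℝ}

lemma GoodPair.shift (g : GoodPair D N α K u v) {K' l : ℤ} (hl : K' + |l| ≤ K) :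
    GoodPair D N α K' (shiftRow l u) (shiftRow l v) where
  pair := (g.pair.shift l).mono fun i hi => by
    have h1 := hi.1
    have h2 := hi.2
    have := neg_abs_le l
    have := le_abs_self l
    exact ⟨by omega, by omega⟩
  left_mem k hk := by
    rw [shiftRow_shiftRow]
    exact g.left_mem _ ((abs_add_le _ _).trans (by omega))
  right_mem k hk := by
    rw [shiftRow_shiftRow]
    exact g.right_mem _ ((abs_add_le _ _).trans (by omega))

/-- In `relSum_self_eq`, the variation of the lower row at `0` affects one term only. -/
lemma RowSymmetry.rowPartial_zero_good (h : RowSymmetry N M α D A) (hα : α ≠ 0) (hN : 1 ≤ N)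
    (hloc : LocDep D {0} A) (hK : N + M ≤ K) (g : GoodPair D N α K u v) :
    rowPartial A 0 u = 0 := by
  obtain ⟨s, s1, s2, s3, s4, s5⟩ := g.exists_chart h.isOpen (m := 1) (by omega) (by omega)
  have hu : u ∈ D := by
    simpa only [Nat.cast_zero, shiftRow_zero] using (g.mem (i := 0) (by omega) (by omega)).1
  set x : ℝ → ℤ → ℝ := fun t => Function.update u 0 t with hx
  have hxc : Tendsto x (𝓝 (u 0)) (𝓝 u) := by
    have h1 : Continuous x := continuous_const.update _ continuous_id
    have h2 := h1.tendsto (u 0)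
    rwa [show x (u 0) = u from Function.update_eq_self _ _] at h2
  have hpc : Tendsto (fun t => (x t, v)) (𝓝 (u 0)) (𝓝 (u, v)) := hxc.prodMk_nhds tendsto_const_nhds
  have hs : Tendsto (fun t => s (x t, v)) (𝓝 (u 0)) (𝓝 (u, v)) := by
    have := s1.tendsto
    rw [s2] at this
    exact this.comp hpc
  have hUt : Tendsto (fun t => (s (x t, v)).1) (𝓝 (u 0)) (𝓝 u) := (continuous_fst.tendsto _).comp hs
  have hVt : Tendsto (fun t => (s (x t, v)).2) (𝓝 (u 0)) (𝓝 v) := (continuous_snd.tendsto _).comp hs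
  have eU : ∀ F : (ℤ → ℝ) → ℝ, LocDep D {0} F → ∀ i : ℕ, 1 ≤ i → i ≤ N →
      ∀ᶠ t in 𝓝 (u 0), F (shiftRow i (s (x t, v)).1) = F (shiftRow i u) := by
    intro F hF i h1 h2
    refine hF.eventually_eq (g.mem (by omega) (by omega)).1
      (((continuous_shiftRow i).tendsto u).comp hUt) tendsto_const_nhds fun t k hk => ?_
    rw [Set.mem_singleton_iff.1 hk]
    show (s (x t, v)).1 (i + 0) = u (i + 0)
    rw [s3 _ _ (by omega)]
    exact Function.update_of_ne (by omega) _ _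
  have eV : ∀ F : (ℤ → ℝ) → ℝ, LocDep D {0} F →
      ∀ᶠ t in 𝓝 (u 0), F (shiftRow N (s (x t, v)).2) = F (shiftRow N v) := by
    intro F hF
    refine hF.eventually_eq (g.mem (by omega) (by omega)).2
      (((continuous_shiftRow N).tendsto v).comp hVt) tendsto_const_nhds fun t k hk => ?_
    rw [Set.mem_singleton_iff.1 hk]
    exact s4 _ _ (by omega)
  have e0 : ∀ᶠ t in 𝓝 (u 0), A (s (x t, v)).1 = A (x t) := by
    refine hloc.eventually_eq hu hUt hxc fun t k hk => ?_
    rw [Set.mem_singleton_iff.1 hk]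
    exact s3 _ _ (by omega)
  have hloc' : LocDep D {0} (rowPartial A 0) := hloc.rowPartial rfl
  have eS : ∀ᶠ t in 𝓝 (u 0), ∀ i ∈ Finset.range N,
      A (shiftRow (i + 1 : ℕ) (s (x t, v)).1) = A (shiftRow (i + 1 : ℕ) u) := by
    rw [eventually_all_finset]
    intro i hi
    rw [Finset.mem_range] at hi
    exact eU A hloc (i + 1) (by omega) (by omega)
  have key : ∀ᶠ t in 𝓝 (u 0), A (x t) = A u := by
    filter_upwards [hpc.eventually s5, eS, e0, eU _ hloc' N hN le_rfl, eV A hloc, eV _ hloc']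
      with t h1 h2 h3 h4 h5 h6
    have r1 := h.relSum_self_eq hα hloc hK h1
    have r2 := h.relSum_self_eq hα hloc hK g
    rw [relSum_self, Finset.sum_range_succ'] at r1 r2
    rw [Finset.sum_congr rfl h2, Nat.cast_zero, shiftRow_zero, h3, h4, h5, h6,
      s3 _ _ (by omega), s4 _ _ (by omega)] at r1
    simp only [hx] at r1 ⊢
    rw [Function.update_of_ne (by omega)] at r1
    rw [Nat.cast_zero, shiftRow_zero] at r2
    linarith
  have := (h.curveDiff u hu).hasDerivAt_update 0
  exact this.unique ((hasDerivAt_const _ _).congr_of_eventuallyEq key)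

lemma RowSymmetry.rowPartial_zero (h : RowSymmetry N M α D A) (hα : α ≠ 0) (hN : 1 ≤ N) :
    ∀ x ∈ D, rowPartial A 0 x = 0 := by
  intro x hx
  by_contra h0
  obtain ⟨u, v, g, hu⟩ := exists_goodPair_left (K := N + M) hα hN h.isOpen h.dense (by omega) x
    ((h.continuousAt_partial x hx 0).eventually_ne h0)
  exact hu (h.rowPartial_zero_good hα hN (h.locDep_zero hα hN) le_rfl g)

/-- `A` is locally constant. -/
lemma RowSymmetry.locDep_empty (h : RowSymmetry N M α D A) (hα : α ≠ 0) (hN : 1 ≤ N) :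
    LocDep D ∅ A :=
  ((h.locDep_zero hα hN).erase h.isOpen h.curveDiff (h.rowPartial_zero hα hN)).mono
    fun _ hk => hk.2 hk.1

/-- Since `A` is locally constant, the terms of the symmetry condition, which scale differently
under variations of the upper row, vanish one by one. -/
lemma RowSymmetry.relSum_eq_zero (h : RowSymmetry N M α D A) (hα : α ≠ 0) (hN : 1 ≤ N)
    (hK : N + M ≤ K) (g : GoodPair D N α K u v) {n : ℕ} (hn : n ≤ N) : relSum N A u v n = 0 := by
  have hlast : ∀ {u v}, GoodPair D N α K u v → relSum N A u v N = 0 := by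
    intro u v g
    have := g.mem (i := N) (by omega) (by omega)
    rw [h.relSum_self_eq hα (h.locDep_zero hα hN) hK g, h.rowPartial_zero hα hN _ this.1,
      h.rowPartial_zero hα hN _ this.2]
    ring
  have hsum : ∀ {u v}, GoodPair D N α K u v →
      ∑ n ∈ Finset.range N, pairTerm N u v 0 n * relSum N A u v n = 0 := by
    intro u v g
    have := h.sum_relSum hK g
    rwa [Finset.sum_range_succ, hlast g, mul_zero, add_zero] at this
  rcases hn.eq_or_lt with rfl | hn
  · exact hlast g
  obtain ⟨s, s1, s2, s3, s4, s5⟩ := g.exists_chart h.isOpen (m := 0) (by omega) (by omega)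
  have part : ∀ k : ℕ, k < N →
      ∑ n ∈ Finset.range (k + 1), pairTerm N u v 0 n * relSum N A u v n = 0 := by
    intro k hk
    set y : ℝ → ℤ → ℝ := fun t => Function.update v k t with hy
    have hyc : Tendsto y (𝓝 (v k)) (𝓝 v) := by
      have h1 : Continuous y := continuous_const.update _ continuous_id
      have h2 := h1.tendsto (v k)
      rwa [show y (v k) = v from Function.update_eq_self _ _] at h2
    have hpc : Tendsto (fun t => (u, y t)) (𝓝 (v k)) (𝓝 (u, v)) :=
      tendsto_const_nhds.prodMk_nhds hyc
    have hs : Tendsto (fun t => s (u, y t)) (𝓝 (v k)) (𝓝 (u, v)) := by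
      have := s1.tendsto
      rw [s2] at this
      exact this.comp hpc
    have hUt : Tendsto (fun t => (s (u, y t)).1) (𝓝 (v k)) (𝓝 u) :=
        (continuous_fst.tendsto _).comp hs
    have hVt : Tendsto (fun t => (s (u, y t)).2) (𝓝 (v k)) (𝓝 v) :=
        (continuous_snd.tendsto _).comp hs
    have hloc := h.locDep_empty hα hN
    have eA : ∀ᶠ t in 𝓝 (v k), ∀ i ∈ Finset.range (N + 1),
        A (shiftRow i (s (u, y t)).1) = A (shiftRow i u) ∧
          A (shiftRow i (s (u, y t)).2) = A (shiftRow i v) := by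
      rw [eventually_all_finset]
      intro i hi
      rw [Finset.mem_range] at hi
      have hm := g.mem (i := i) (by omega) (by omega)
      exact (hloc.eventually_eq hm.1 (((continuous_shiftRow i).tendsto u).comp hUt)
        tendsto_const_nhds fun t k hk => hk.elim).and
        (hloc.eventually_eq hm.2 (((continuous_shiftRow i).tendsto v).comp hVt)
        tendsto_const_nhds fun t k hk => hk.elim)
    obtain ⟨t, ⟨ht1, ht2⟩, ht⟩ := ((((hpc.eventually s5).and eA).filter_mono nhdsWithin_le_nhds).and
      (self_mem_nhdsWithin (s := {v k}ᶜ))).exists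
    have ht : t ≠ v k := ht
    have hR : ∀ n ∈ Finset.range N, relSum N A (s (u, y t)).1 (s (u, y t)).2 n =
        relSum N A u v n := by
      intro n hn
      rw [Finset.mem_range] at hn
      rw [relSum, relSum]
      congr 1
      · refine Finset.sum_congr rfl fun i hi => (ht2 i ?_).1
        rw [Finset.mem_range] at hi ⊢
        omega
      · refine Finset.sum_congr rfl fun i hi => ?_
        rw [Finset.mem_range] at hi
        have := (ht2 (n + i) (Finset.mem_range.2 (by omega))).2
        rwa [Nat.cast_add] at this
    have hτ : ∀ n ∈ Finset.range N, v k * pairTerm N (s (u, y t)).1 (s (u, y t)).2 0 n =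
        pairTerm N u v 0 n * (if n < k + 1 then t else v k) := by
      intro n hn
      rw [Finset.mem_range] at hn
      rw [pairTerm_congr (u' := u) (v' := y t) hn.le (fun i _ hi => s3 _ i (by omega))
        fun i hi _ => s4 _ i (by omega), pairTerm, pairTerm]
      split_ifs with hnk
      · obtain ⟨j, rfl⟩ := Nat.exists_eq_add_of_le (Nat.lt_succ_iff.1 hnk)
        have hj : j ∈ Finset.range (N + 1 - n) := Finset.mem_range.2 (by omega)
        have e1 : ((0 : ℤ) + n + j) = ((n + j : ℕ) : ℤ) := by push_cast; ring
        have e2 : ∏ i ∈ (Finset.range (N + 1 - n)).erase j, y t (0 + n + (i : ℕ)) =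
            ∏ i ∈ (Finset.range (N + 1 - n)).erase j, v (0 + n + (i : ℕ)) :=
          Finset.prod_congr rfl fun i hi => by
            have := (Finset.mem_erase.1 hi).1
            exact Function.update_of_ne (by push_cast; omega) _ _
        rw [← Finset.mul_prod_erase _ (fun i : ℕ => y t (0 + n + i)) hj,
          ← Finset.mul_prod_erase _ (fun i : ℕ => v (0 + n + i)) hj, e2, e1,
          show y t ((n + j : ℕ) : ℤ) = t from Function.update_self _ _ _]
        ring
      · have e2 : ∏ i ∈ Finset.range (N + 1 - n), y t (0 + n + (i : ℕ)) =
            ∏ i ∈ Finset.range (N + 1 - n), v (0 + n + (i : ℕ)) :=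
          Finset.prod_congr rfl fun i _ => Function.update_of_ne (by omega) _ _
        rw [e2]
        ring
    have q1 := hsum ht1
    have q2 := hsum g
    rw [Finset.sum_congr rfl fun n hn => by rw [hR n hn]] at q1
    have q3 : ∑ n ∈ Finset.range N,
        (if n < k + 1 then pairTerm N u v 0 n * relSum N A u v n else 0) =
        0 := by
      refine mul_left_cancel₀ (sub_ne_zero.2 ht) ?_
      have e : (t - v k) * ∑ n ∈ Finset.range N,
          (if n < k + 1 then pairTerm N u v 0 n * relSum N A u v n else 0) =
          v k * ∑ n ∈ Finset.range N,
            pairTerm N (s (u, y t)).1 (s (u, y t)).2 0 n * relSum N A u v n -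
          v k * ∑ n ∈ Finset.range N, pairTerm N u v 0 n * relSum N A u v n := by
        rw [Finset.mul_sum, Finset.mul_sum, Finset.mul_sum, ← Finset.sum_sub_distrib]
        refine Finset.sum_congr rfl fun n hn => ?_
        rw [← mul_assoc, hτ n hn]
        split_ifs <;> ring
      rw [e, q1, q2, mul_zero, mul_zero, sub_zero]
    rw [← Finset.sum_filter] at q3
    convert q3 using 2
    ext n
    simp only [Finset.mem_range, Finset.mem_filter]
    omega
  have h1 := part n hn
  have h2 : ∑ m ∈ Finset.range n, pairTerm N u v 0 m * relSum N A u v m = 0 := by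
    rcases n with _ | n
    · simp
    · exact part n (by omega)
  rw [Finset.sum_range_succ, h2, zero_add] at h1
  refine (mul_eq_zero.1 h1).resolve_left (mul_ne_zero ?_ ?_)
  · exact prod_row_ne_zero fun i _ hi => g.pair.left_ne _ ⟨by omega, by omega⟩
  · exact prod_row_ne_zero fun i _ hi => g.pair.right_ne _ ⟨by omega, by omega⟩

lemma RowSymmetry.shift_left_eq (h : RowSymmetry N M α D A) (hα : α ≠ 0) (hN : 1 ≤ N)
    (g : GoodPair D N α K u v) {l : ℤ} (hl : N + M + |l| ≤ K) :
    A (shiftRow (l + 1) u) = A (shiftRow l v) := by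
  have g' := g.shift hl
  have e0 := h.relSum_eq_zero hα hN le_rfl g' (Nat.zero_le N)
  have e1 := h.relSum_eq_zero hα hN le_rfl g' hN
  rw [relSum, Finset.sum_range_one, Nat.sub_zero, Finset.sum_range_succ'] at e0
  rw [relSum, Finset.sum_range_succ, Finset.sum_range_one, Nat.add_sub_cancel] at e1
  simp only [Nat.cast_zero, zero_add, add_zero, Nat.cast_one, shiftRow_shiftRow,
    Nat.cast_add, add_comm (1 : ℤ)] at e0 e1
  linarith

lemma RowSymmetry.sum_shift_eq_zero (h : RowSymmetry N M α D A) (hα : α ≠ 0) (hN : 1 ≤ N)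
    (g : GoodPair D N α K u v) {l : ℤ} (hl : 0 ≤ l) (hlK : N + M + (l + N) ≤ K) :
    ∑ i ∈ Finset.range (N + 2), A (shiftRow (l + i) u) = 0 := by
  have e0 := h.relSum_eq_zero hα hN le_rfl (g.shift (K' := N + M) (l := l)
    (by rw [abs_of_nonneg hl]; omega)) (Nat.zero_le N)
  rw [relSum, Finset.sum_range_one, Nat.sub_zero] at e0
  rw [Finset.sum_range_succ', ← e0, add_comm]
  simp only [shiftRow_shiftRow, Nat.cast_zero, zero_add]
  congr 1
  refine Finset.sum_congr rfl fun i hi => ?_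
  rw [Finset.mem_range] at hi
  rw [← h.shift_left_eq hα hN g (by rw [abs_of_nonneg (by omega)]; omega), Nat.cast_succ, add_assoc]

lemma RowSymmetry.shift_period (h : RowSymmetry N M α D A) (hα : α ≠ 0) (hN : 1 ≤ N)
    (g : GoodPair D N α K u v) (q : ℕ) (hq : N + M + ((N + 2) * q + N) ≤ K) :
    A (shiftRow ((N + 2) * q) u) = A u := by
  induction q with
  | zero => simp [shiftRow_zero]
  | succ q ih =>
    have hq' : (N : ℤ) + M + ((N + 2) * q + (N + 2) + N) ≤ K := by
      push_cast at hq; linarith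
    have hnn : (0 : ℤ) ≤ (N + 2) * q := by positivity
    have e1 := h.sum_shift_eq_zero hα hN g hnn (by omega)
    have e2 := h.sum_shift_eq_zero hα hN g (l := (N + 2) * q + 1) (by omega) (by omega)
    rw [Finset.sum_range_succ'] at e1
    rw [Finset.sum_range_succ] at e2
    simp only [Nat.cast_add, Nat.cast_one, Nat.cast_zero, add_zero, add_assoc,
      add_comm (1 : ℤ)] at e1 e2
    rw [← ih (by omega)]
    have e3 : ((N : ℤ) + 2) * ((q + 1 : ℕ) : ℤ) = (N + 2) * q + (N + (1 + 1)) := by push_cast; ring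
    rw [e3]
    linarith

/-- The equation of pairs of rows admits no symmetry of order at most `N`, except zero. -/
theorem RowSymmetry.eq_zero (h : RowSymmetry N M α D A) (hα : α ≠ 0) (hN : 1 ≤ N) :
    ∀ x ∈ D, A x = 0 := by
  have hloc := h.locDep_empty hα hN
  have hconst : ∀ x ∈ D, ∀ x' ∈ D, A x = A x' := by
    intro x hx x' hx'
    set q : ℕ := 2 * (M + N) + 1 with hq
    set P : ℤ := (N + 2) * q with hP
    have hPq : 2 * (M + N) < P := by
      have : (q : ℤ) ≤ P := le_mul_of_one_le_left (by positivity) (by omega)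
      omega
    -- a row that agrees with `x` near `0`, and with `x'` near `P`
    set z : ℤ → ℝ := fun k => if k ≤ M + N then x k else x' (k - P) with hz
    have hz1 : ∀ k : ℤ, |k| ≤ M + N → x k = z k := fun k hk =>
      (if_pos ((le_abs_self k).trans hk)).symm
    have hz2 : ∀ k : ℤ, |k| ≤ M + N → x' k = shiftRow P z k := fun k hk => by
      have := (abs_le.1 hk).1
      rw [shiftRow_apply, hz]
      dsimp only
      rw [if_neg (by omega), add_sub_cancel_left]
    have m1 : z ∈ D := h.mem_congr x hx z fun k hk => hz1 k (by omega)
    have m2 : shiftRow P z ∈ D := h.mem_congr x' hx' _ fun k hk => hz2 k (by omega)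
    rw [h.dep x hx z m1 fun k hk => hz1 k (by omega), h.dep x' hx' _ m2
      fun k hk => hz2 k (by omega)]
    obtain ⟨V, hV, hVA⟩ := hloc z m1
    obtain ⟨V', hV', hVA'⟩ := hloc _ m2
    obtain ⟨u, v, g, hu⟩ := exists_goodPair_left (K := N + M + (P + N)) hα hN h.isOpen h.dense
      (by omega) z (inter_mem hV ((continuous_shiftRow P).continuousAt.preimage_mem_nhds hV'))
    rw [← hVA u hu.1 z (mem_of_mem_nhds hV) fun k hk => hk.elim,
      ← hVA' _ hu.2 _ (mem_of_mem_nhds hV') fun k hk => hk.elim]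
    exact (h.shift_period hα hN g q le_rfl).symm
  intro x hx
  obtain ⟨u, v, g, -⟩ := exists_goodPair_left (K := N + M + (0 + N)) hα hN h.isOpen h.dense
    (by omega) x univ_mem
  have e := h.sum_shift_eq_zero hα hN g le_rfl le_rfl
  rw [Finset.sum_congr rfl (g := fun _ => A x) fun i hi => by
    rw [Finset.mem_range] at hi
    exact hconst _ (g.mem (by omega) (by omega)).1 _ hx, Finset.sum_const, Finset.card_range,
    nsmul_eq_mul] at e
  exact (mul_eq_zero.1 e).resolve_left (by positivity)

end EqZero

/-! ### Minimality of the order -/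

section Minimality

variable {N : ℕ} {α : ℝ} {G : Flow} {φ : Pt → ℤ}

lemma rowWindow_surjective (hφ : Set.InjOn φ G.stencil) : Function.Surjective (rowWindow G φ) := by
  intro z
  have hinj : Function.Injective fun q : G.stencil => φ q :=
    fun q q' h => Subtype.ext (hφ q.2 q'.2 h)
  exact ⟨Function.extend (fun q : G.stencil => φ q) z 0, funext fun q => hinj.extend_apply _ _ q⟩

/-- A nontrivial flow in the direction `e` that satisfies the symmetry condition for pairs of rows
has order at least `N + 1`. -/
lemma lt_order_of_pathDeriv_eq_zero (hN : 1 ≤ N) (hα : α ≠ 0) {e : Pt} (hφ : ∀ k : ℤ, φ (k • e) = k)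
    {s : ℕ} (hG : G.IsSmooth) (hG0 : G.IsNontrivial) (hs : G.HasOrder e s)
    (hrel : ∀ W, LatticeSol N α W → (∀ k : ℤ, 0 ≤ k → k ≤ N → ∀ y : ℤ, 0 ≤ y → y ≤ 1 →
        rowWindow G φ (shiftRow k fun i => W i y) ∈ G.dom) →
      pathDeriv W (fun x y => G.toFun (rowWindow G φ (shiftRow x fun i => W i y))) (N + 1)
        0 0 N 1 = 0) : N + 1 ≤ s := by
  by_contra! hlt
  have hinj : Set.InjOn φ G.stencil := by
    intro p hp q hq hpq
    obtain ⟨k, rfl⟩ := hs.inDirection p hp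
    obtain ⟨l, rfl⟩ := hs.inDirection q hq
    rw [hφ, hφ] at hpq
    rw [hpq]
  have hzero := (rowSymmetry_of_flow hN hα (M := G.stencil.sup fun q => (φ q).natAbs) hG hinj
    (fun q hq => by
      rw [Int.abs_eq_natAbs]
      exact_mod_cast Finset.le_sup (f := fun q => (φ q).natAbs) hq)
    (fun x hx y hy hxy => hs.isLeast.1 x hx y hy (by
      rintro p ⟨k, hk, hp⟩
      refine hxy p ?_
      rw [hp, hφ]
      omega)) hrel).eq_zero hα hN
  obtain ⟨z, hz, hz0⟩ := hG0
  obtain ⟨x, rfl⟩ := rowWindow_surjective hinj z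
  have hU : IsOpen (rowWindow G φ ⁻¹' (G.dom ∩ G.toFun ⁻¹' {0}ᶜ)) :=
    (hG.contDiffOn.continuousOn.isOpen_inter_preimage hG.isOpen_dom isOpen_compl_singleton).preimage
      (continuous_rowWindow G φ)
  -- the value at `0` may be assumed to be nonzero
  obtain ⟨y, hy, hy0⟩ := ((dense_compl_singleton (0 : ℝ)).preimage
    (isOpenMap_eval (0 : ℤ))).inter_open_nonempty _ hU ⟨x, hz, hz0⟩
  exact (mul_ne_zero hy.2 (inv_ne_zero hy0)) (hzero y ⟨hy.1, hy0⟩)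

lemma lt_order_right (hN : 1 ≤ N) (hα : α ≠ 0) {s : ℕ} (hG : G.IsSymmetry (system N α))
    (hG0 : G.IsNontrivial) (hs : G.HasOrder (1, 0) s) : N + 1 ≤ s := by
  refine lt_order_of_pathDeriv_eq_zero (φ := Prod.fst) hN hα (fun k => by simp) hG.isSmooth hG0 hs
    fun W hW hdef => ?_
  set U : LatticeField := fun p => W p.1 p.2 with hU
  have hwin : ∀ p, G.window p U = rowWindow G Prod.fst (shiftRow p.1 fun i => W i p.2) := by
    intro p
    funext q
    obtain ⟨k, hk⟩ := hs.inDirection q q.2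
    simp [Flow.window, rowWindow, hU, hk]
  have := hG.determining U (isSolution_system_iff.2 hW) _ ⟨N, hN, le_rfl, rfl⟩ fun p hp => by
    obtain ⟨⟨h1, h2⟩, h3, h4⟩ := mem_vars_bounds hp
    rw [Flow.DefinedAt, hwin]
    exact hdef _ h1 h2 _ h3 (by rw [Nat.add_sub_cancel_left] at h4; exact_mod_cast h4)
  rw [sum_vars_pderiv_Q U fun p => G.shifted p U, Nat.add_sub_cancel_left] at this
  simp only [Flow.shifted, hwin, Nat.cast_one] at this
  exact this

lemma lt_order_up (hN : 1 ≤ N) (hα : α ≠ 0) {s : ℕ} (hG : G.IsSymmetry (system N α))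
    (hG0 : G.IsNontrivial) (hs : G.HasOrder (0, 1) s) : N + 1 ≤ s := by
  -- reflection in the diagonal turns the second direction into the first one
  refine lt_order_of_pathDeriv_eq_zero (φ := Prod.snd) (α := (-1) ^ (N + 1) * α) hN
    (by positivity) (fun k => by simp) hG.isSmooth hG0 hs fun W hW hdef => ?_
  set U : LatticeField := fun p => W p.2 p.1 with hU
  have hsol : LatticeSol N α fun x y => U (x, y) := by
    have := hW.swap
    rwa [← mul_assoc, ← mul_pow, neg_one_mul, neg_neg, one_pow, one_mul] at this
  have hwin : ∀ p, G.window p U = rowWindow G Prod.snd (shiftRow p.2 fun i => W i p.1) := by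
    intro p
    funext q
    obtain ⟨k, hk⟩ := hs.inDirection q q.2
    simp [Flow.window, rowWindow, hU, hk]
  have := hG.determining U (isSolution_system_iff.2 hsol) _ ⟨1, le_rfl, hN, rfl⟩ fun p hp => by
    obtain ⟨⟨h1, h2⟩, h3, h4⟩ := mem_vars_bounds hp
    rw [Flow.DefinedAt, hwin]
    exact hdef _ h3 (by rwa [Nat.add_sub_cancel] at h4) _ h1 (by exact_mod_cast h2)
  rw [sum_vars_pderiv_Q U fun p => G.shifted p U, Nat.add_sub_cancel, add_comm 1 N] at this
  rw [← pathDeriv_swap]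
  simp only [Flow.shifted, hwin, Nat.cast_one] at this
  exact this

end Minimality

end LatticePathSystem

theorem mainTheorem3 (N : ℕ) (hN : 1 ≤ N) (α : ℝ) (hα : α ≠ 0) :
    (LatticePathSystem.flowUN N α).IsLowestOrderSymmetry
        (LatticePathSystem.system N α) (1, 0) (N + 1) ∧
      (LatticePathSystem.flowUM N α).IsLowestOrderSymmetry
        (LatticePathSystem.system N α) (0, 1) (N + 1) := by
  open LatticePathSystem in
  have h1 := pathFlow_isNontrivial_hasOrder (eval_denom_right N α) smul_right_injective_unit
  have h2 := pathFlow_isNontrivial_hasOrder (eval_denom_up N α) smul_up_injective_unit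
  exact ⟨⟨LatticePathSystem.flowUN_isSymmetry hN hα, h1.1, h1.2, fun G s hG hG0 hs =>
      LatticePathSystem.lt_order_right hN hα hG hG0 hs⟩,
    ⟨LatticePathSystem.flowUM_isSymmetry hN hα, h2.1, h2.2, fun G s hG hG0 hs =>
      LatticePathSystem.lt_order_up hN hα hG hG0 hs⟩⟩
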